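/- (1) Let $M$ and $N$ be closed oriented topological $4$-manifolds with fundamental classes $[M]\in H_4(M;\mathbb Z)$ and $[N]\in H_4(N;\mathbb Z)$, and let $b_2^{+}$ (resp. $b_2^{-}$) denote the maximal dimension of a subspace of $H^2(\,\cdot\,;\mathbb R)$ on which the intersection form $Q(a,b)=\langle a\cup b,[\,\cdot\,]\rangle$ is positive (resp. negative) definite. Let $f:M\to N$ be a continuous map of degree $d\neq 0$, i.e. $f_*[M]=d\,[N]$. If $d>0$, then $b_2^{\pm}(M)\ge b_2^{\pm}(N)$; if $d<0$, then $b_2^{\pm}(M)\ge b_2^{\mp}(N)$. (In other words, $b_2^{\pm}(M)\ge b_2^{\pm}(N)$ once $N$ is oriented so that $f$ has positive degree.) (2) For a closed smooth manifold $M$ of real dimension $2n$ with a smooth almost complex structure $J$, let $H_J^{+}(M)$ (resp. $H_J^{-}(M)$) be the subspace of $H^2(M;\mathbb R)$ (de Rham cohomology) of those classes that are represented by a closed smooth real $2$-form $\alpha$ with $\alpha(J\cdot,J\cdot)=\alpha$ (resp. $\alpha(J\cdot,J\cdot)=-\alpha$), and let $h_J^{\pm}(M)=\dim H_J^{\pm}(M)$.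 Let $(M,J)$ and $(N,J')$ be closed almost complex manifolds of the same dimension $2n$ (not necessarily connected), and let $f:M\to N$ be a surjective $(J,J')$-holomorphic map, i.e. $f$ is smooth and $df\circ J=J'\circ df$. Then $h_J^{+}(M)\ge h_{J'}^{+}(N)$ and $h_J^{-}(M)\ge h_{J'}^{-}(N)$. -/

import Mathlib

open scoped Manifold ContDiff

universe u v

noncomputable section

namespace MappingOrder

/-! ## Singular homology, relative homology and cohomology -/

section Singular

variable (X : Type u) [TopologicalSpace X]

/-- Singular `n`-simplices of `X`: continuous maps from the standard simplex `Δⁿ` to `X`. -/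
abbrev SingularSimplex (n : ℕ) : Type u := C(stdSimplex ℝ (Fin (n + 1)), X)

variable {X}

/-- Precomposition of a singular simplex with the affine map `Δᵐ → Δⁿ` that a map of vertices
induces. -/
def SingularSimplex.pull {m n : ℕ} (g : Fin (m + 1) → Fin (n + 1)) (σ : SingularSimplex X n) :
    SingularSimplex X m :=
  ContinuousMap.comp σ ⟨stdSimplex.map g, stdSimplex.continuous_map g⟩

/-- The `i`-th face of a singular simplex. -/
def SingularSimplex.face {n : ℕ} (i : Fin (n + 2)) (σ : SingularSimplex X (n + 1)) :
    SingularSimplex X n :=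
  σ.pull i.succAbove

theorem SingularSimplex.pull_pull {k m n : ℕ} (h : Fin (k + 1) → Fin (m + 1))
    (g : Fin (m + 1) → Fin (n + 1)) (σ : SingularSimplex X n) :
    SingularSimplex.pull h (SingularSimplex.pull g σ) = SingularSimplex.pull (g ∘ h) σ := by
  ext x
  simp only [SingularSimplex.pull, ContinuousMap.comp_apply, ContinuousMap.coe_mk]
  rw [stdSimplex.map_comp_apply]

theorem SingularSimplex.comp_face {Y : Type v} [TopologicalSpace Y] {n : ℕ} (f : C(X, Y))
    (i : Fin (n + 2)) (σ : SingularSimplex X (n + 1)) :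
    SingularSimplex.face i (f.comp σ) = f.comp (SingularSimplex.face i σ) := rfl

variable (X)

/-- Singular `n`-chains with integer coefficients. -/
abbrev SingularChain (n : ℕ) : Type u := SingularSimplex X n →₀ ℤ

/-- The boundary operator `∂ : C_{n+1}(X; ℤ) → C_n(X; ℤ)`. -/
def boundary (n : ℕ) : SingularChain X (n + 1) →ₗ[ℤ] SingularChain X n :=
  Finsupp.linearCombination ℤ fun σ : SingularSimplex X (n + 1) =>
    ∑ i : Fin (n + 2), ((-1 : ℤ) ^ (i : ℕ)) • Finsupp.single (SingularSimplex.face i σ) (1 : ℤ)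

/-- Singular `n`-cycles. -/
def cycles : (n : ℕ) → Submodule ℤ (SingularChain X n)
  | 0 => ⊤
  | n + 1 => LinearMap.ker (boundary X n)

/-- Singular `n`-boundaries. -/
def boundaries (n : ℕ) : Submodule ℤ (SingularChain X n) := LinearMap.range (boundary X n)

/-- Singular homology `H_n(X; ℤ)`. -/
abbrev Homology (n : ℕ) : Type u := cycles X n ⧸ (boundaries X n).submoduleOf (cycles X n)

variable {X}

/-- The chains of `X` that are supported in the subset `A`. -/
def chainsIn (A : Set X) (n : ℕ) : Submodule ℤ (SingularChain X n) :=
  Finsupp.supported ℤ ℤ {σ : SingularSimplex X n | Set.range σ ⊆ A}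

/-- Relative `n`-cycles of the pair `(X, A)`: chains whose boundary lies in `A`. -/
def relCycles (A : Set X) : (n : ℕ) → Submodule ℤ (SingularChain X n)
  | 0 => ⊤
  | n + 1 => (chainsIn A n).comap (boundary X n)

/-- Relative singular homology `H_n(X, A; ℤ)`: relative cycles modulo boundaries and chains
in `A`. -/
abbrev RelHomology (A : Set X) (n : ℕ) : Type u :=
  relCycles A n ⧸ (boundaries X n ⊔ chainsIn A n).submoduleOf (relCycles A n)

theorem cycles_le_relCycles (A : Set X) : (n : ℕ) → cycles X n ≤ relCycles A n
  | 0 => le_rfl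
  | n + 1 => fun c hc => by
      have h0 : boundary X n c = 0 := hc
      change boundary X n c ∈ chainsIn A n
      rw [h0]
      exact Submodule.zero_mem _

/-- The natural map `H_n(X; ℤ) → H_n(X, A; ℤ)`. -/
def Homology.toRel (A : Set X) (n : ℕ) : Homology X n →ₗ[ℤ] RelHomology A n :=
  Submodule.mapQ _ _ (Submodule.inclusion (cycles_le_relCycles A n)) fun c hc => by
    have hc' : (c : SingularChain X n) ∈ boundaries X n := hc
    exact Submodule.mem_sup_left hc'

/-- `μ ∈ H_n(X; ℤ)` is a fundamental class of the closed `n`-manifold `X`: at every point `x` it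
restricts to a generator of the local homology group `H_n(X, X ∖ {x}; ℤ)`.
The choice of such a class is an orientation of the closed manifold. -/
def IsFundamentalClass {n : ℕ} (μ : Homology X n) : Prop :=
  ∀ x : X, Submodule.span ℤ {Homology.toRel ({x}ᶜ : Set X) n μ} = ⊤

section Functoriality

variable {Y : Type v} [TopologicalSpace Y]

/-- The chain map `f_#` induced by a continuous map. -/
def chainMap (f : C(X, Y)) (n : ℕ) : SingularChain X n →ₗ[ℤ] SingularChain Y n :=
  Finsupp.lmapDomain ℤ ℤ fun σ => f.comp σ

theorem chainMap_boundary (f : C(X, Y)) (n : ℕ) (c : SingularChain X (n + 1)) :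
    chainMap f n (boundary X n c) = boundary Y n (chainMap f (n + 1) c) := by
  suffices h : (chainMap f n).comp (boundary X n) = (boundary Y n).comp (chainMap f (n + 1)) from
    LinearMap.congr_fun h c
  ext1 σ
  ext1
  simp [chainMap, boundary, SingularSimplex.comp_face]

theorem chainMap_mem_cycles (f : C(X, Y)) :
    (n : ℕ) → ∀ c ∈ cycles X n, chainMap f n c ∈ cycles Y n
  | 0 => fun _ _ => Submodule.mem_top
  | n + 1 => fun c hc => by
      have h0 : boundary X n c = 0 := hc
      change boundary Y n (chainMap f (n + 1) c) = 0
      rw [← chainMap_boundary, h0, map_zero]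

/-- The induced map `f_* : H_n(X; ℤ) → H_n(Y; ℤ)`. -/
def Homology.map (f : C(X, Y)) (n : ℕ) : Homology X n →ₗ[ℤ] Homology Y n :=
  Submodule.mapQ _ _ ((chainMap f n).restrict (chainMap_mem_cycles f n)) fun c hc => by
    obtain ⟨b, hb⟩ : (c : SingularChain X n) ∈ boundaries X n := hc
    exact ⟨chainMap f (n + 1) b, by rw [← chainMap_boundary, hb]; rfl⟩

/-- `f` has degree `d` with respect to the fundamental classes `μ` and `ν`: `f_* μ = d ν`. -/
def HasDegree {n : ℕ} (f : C(X, Y)) (μ : Homology X n) (ν : Homology Y n) (d : ℤ) : Prop :=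
  Homology.map f n μ = d • ν

end Functoriality

variable (X)

/-- Singular `n`-cochains with real coefficients. -/
abbrev SingularCochain (n : ℕ) : Type u := SingularSimplex X n → ℝ

/-- The coboundary operator `δ : Cⁿ(X; ℝ) → Cⁿ⁺¹(X; ℝ)`, `(δ c)(σ) = c(∂ σ)`. -/
def coboundary (n : ℕ) : SingularCochain X n →ₗ[ℝ] SingularCochain X (n + 1) where
  toFun c σ := ∑ i : Fin (n + 2), (-1 : ℝ) ^ (i : ℕ) * c (SingularSimplex.face i σ)
  map_add' a b := by
    ext σ
    simp [mul_add, Finset.sum_add_distrib]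
  map_smul' r a := by
    ext σ
    simp [Finset.mul_sum, mul_left_comm]

/-- Singular `n`-cocycles. -/
def cocycles (n : ℕ) : Submodule ℝ (SingularCochain X n) := LinearMap.ker (coboundary X n)

/-- Singular `n`-coboundaries. -/
def coboundaries : (n : ℕ) → Submodule ℝ (SingularCochain X n)
  | 0 => ⊥
  | n + 1 => LinearMap.range (coboundary X n)

/-- Singular cohomology `Hⁿ(X; ℝ)`. -/
abbrev Cohomology (n : ℕ) : Type u := cocycles X n ⧸ (coboundaries X n).submoduleOf (cocycles X n)

variable {X}

/-- The value of a cochain on a chain. -/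
def evalChain {n : ℕ} (c : SingularCochain X n) : SingularChain X n →ₗ[ℤ] ℝ :=
  Finsupp.linearCombination ℤ c

theorem evalChain_apply {n : ℕ} (c : SingularCochain X n) (z : SingularChain X n) :
    evalChain c z = z.sum fun σ k => (k : ℝ) * c σ := by
  simp [evalChain, Finsupp.linearCombination_apply]

theorem evalChain_add {n : ℕ} (a b : SingularCochain X n) (z : SingularChain X n) :
    evalChain (a + b) z = evalChain a z + evalChain b z := by
  simp [evalChain_apply, mul_add, Finsupp.sum_add]

theorem evalChain_smul {n : ℕ} (r : ℝ) (a : SingularCochain X n) (z : SingularChain X n) :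
    evalChain (r • a) z = r * evalChain a z := by
  simp [evalChain_apply, Finsupp.mul_sum, mul_left_comm]

theorem evalChain_boundary {n : ℕ} (c : SingularCochain X n) (z : SingularChain X (n + 1)) :
    evalChain c (boundary X n z) = evalChain (coboundary X n c) z := by
  suffices h : (evalChain c).comp (boundary X n) = evalChain (coboundary X n c) from
    LinearMap.congr_fun h z
  ext σ
  simp [evalChain, boundary, coboundary]

/-- A cocycle as a functional on homology. -/
def kroneckerAux {n : ℕ} (c : cocycles X n) : Homology X n →ₗ[ℤ] ℝ :=
  Submodule.liftQ _ ((evalChain (c : SingularCochain X n)).comp (cycles X n).subtype) fun z hz => by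
    obtain ⟨b, hb⟩ : (z : SingularChain X n) ∈ boundaries X n := hz
    have hc : coboundary X n c = 0 := c.2
    change evalChain (c : SingularCochain X n) (z : SingularChain X n) = 0
    rw [← hb, evalChain_boundary, hc]
    simp [evalChain_apply]

/-- The Kronecker pairing `Hⁿ⁺¹(X; ℝ) × H_{n+1}(X; ℤ) → ℝ` with a fixed homology class. -/
def kronecker {n : ℕ} (μ : Homology X (n + 1)) : Cohomology X (n + 1) →ₗ[ℝ] ℝ :=
  Submodule.liftQ _
    { toFun := fun c => kroneckerAux c μ
      map_add' := fun a b => by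
        induction μ using Submodule.Quotient.induction_on with
        | H z => exact evalChain_add _ _ _
      map_smul' := fun r a => by
        induction μ using Submodule.Quotient.induction_on with
        | H z => exact evalChain_smul _ _ _ } fun c hc => by
    obtain ⟨b, hb⟩ : (c : SingularCochain X (n + 1)) ∈ coboundaries X (n + 1) := hc
    induction μ using Submodule.Quotient.induction_on with
    | H z =>
      have hz : boundary X n z = 0 := z.2
      change evalChain (c : SingularCochain X (n + 1)) (z : SingularChain X (n + 1)) = 0
      rw [← hb, ← evalChain_boundary, hz, map_zero]

/-- Inclusion of the first `p + 1` vertices of a `(p + q)`-simplex. -/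
def frontVertices (p q : ℕ) : Fin (p + 1) → Fin (p + q + 1) := fun i => ⟨i, by omega⟩

/-- Inclusion of the last `q + 1` vertices of a `(p + q)`-simplex. -/
def backVertices (p q : ℕ) : Fin (q + 1) → Fin (p + q + 1) := fun i => ⟨p + i, by omega⟩

/-- The cup product of cochains: `(a ∪ b)(σ) = a(front p-face of σ) b(back q-face of σ)`. -/
def cup {p q : ℕ} (a : SingularCochain X p) (b : SingularCochain X q) : SingularCochain X (p + q) :=
  fun σ => a (SingularSimplex.pull (frontVertices p q) σ) *
    b (SingularSimplex.pull (backVertices p q) σ)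

theorem cup_apply {p q : ℕ} (a : SingularCochain X p) (b : SingularCochain X q)
    (σ : SingularSimplex X (p + q)) :
    cup a b σ = a (SingularSimplex.pull (frontVertices p q) σ) *
      b (SingularSimplex.pull (backVertices p q) σ) := rfl

theorem coboundary_cup_two_two (a : SingularCochain X 2) (b : SingularCochain X 2) :
    (coboundary X 4 (cup a b : SingularCochain X 4) : SingularCochain X 5) =
      (cup (coboundary X 2 a) b : SingularCochain X 5) +
        (cup a (coboundary X 2 b) : SingularCochain X 5) := by
  have key : ∀ (A : (Fin 3 → Fin 6) → ℝ) (B : (Fin 3 → Fin 6) → ℝ),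
      ∑ i : Fin 6, (-1 : ℝ) ^ (i : ℕ) * (A (fun j => i.succAbove (frontVertices 2 2 j)) *
        B (fun j => i.succAbove (backVertices 2 2 j))) =
      (∑ i : Fin 4, (-1 : ℝ) ^ (i : ℕ) * A (fun j => frontVertices 3 2 (i.succAbove j))) *
        B (fun j => backVertices 3 2 j) +
      A (fun j => frontVertices 2 3 j) *
        ∑ i : Fin 4, (-1 : ℝ) ^ (i : ℕ) * B (fun j => backVertices 2 3 (i.succAbove j)) := by
    intro A B
    obtain ⟨A', hA⟩ : ∃ A' : Fin 6 → Fin 6 → Fin 6 → ℝ, ∀ g, A g = A' (g 0) (g 1) (g 2) :=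
      ⟨fun x y z => A ![x, y, z], fun g => by congr 1; ext j; fin_cases j <;> rfl⟩
    obtain ⟨B', hB⟩ : ∃ B' : Fin 6 → Fin 6 → Fin 6 → ℝ, ∀ g, B g = B' (g 0) (g 1) (g 2) :=
      ⟨fun x y z => B ![x, y, z], fun g => by congr 1; ext j; fin_cases j <;> rfl⟩
    simp only [Fin.sum_univ_six, Fin.sum_univ_four, hA, hB]
    simp [frontVertices, backVertices, Fin.succAbove]
    ring
  ext σ
  have e := key (fun g => a (SingularSimplex.pull g σ)) (fun g => b (SingularSimplex.pull g σ))
  refine Eq.trans ?_ (e.trans ?_)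
  · change ∑ i : Fin 6, (-1 : ℝ) ^ (i : ℕ) *
      (a (SingularSimplex.pull _ (SingularSimplex.pull _ σ)) *
        b (SingularSimplex.pull _ (SingularSimplex.pull _ σ))) = _
    simp only [SingularSimplex.pull_pull]
    rfl
  · change _ = (∑ i : Fin 4, (-1 : ℝ) ^ (i : ℕ) *
      a (SingularSimplex.pull _ (SingularSimplex.pull _ σ))) * _ +
      _ * (∑ i : Fin 4, (-1 : ℝ) ^ (i : ℕ) *
      b (SingularSimplex.pull _ (SingularSimplex.pull _ σ)))
    simp only [SingularSimplex.pull_pull]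
    rfl

theorem coboundary_cup_one_two (a : SingularCochain X 1) (b : SingularCochain X 2) :
    (coboundary X 3 (cup a b : SingularCochain X 3) : SingularCochain X 4) =
      (cup (coboundary X 1 a) b : SingularCochain X 4) -
        (cup a (coboundary X 2 b) : SingularCochain X 4) := by
  have key : ∀ (A : (Fin 2 → Fin 5) → ℝ) (B : (Fin 3 → Fin 5) → ℝ),
      ∑ i : Fin 5, (-1 : ℝ) ^ (i : ℕ) * (A (fun j => i.succAbove (frontVertices 1 2 j)) *
        B (fun j => i.succAbove (backVertices 1 2 j))) =
      (∑ i : Fin 3, (-1 : ℝ) ^ (i : ℕ) * A (fun j => frontVertices 2 2 (i.succAbove j))) *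
        B (fun j => backVertices 2 2 j) -
      A (fun j => frontVertices 1 3 j) *
        ∑ i : Fin 4, (-1 : ℝ) ^ (i : ℕ) * B (fun j => backVertices 1 3 (i.succAbove j)) := by
    intro A B
    obtain ⟨A', hA⟩ : ∃ A' : Fin 5 → Fin 5 → ℝ, ∀ g, A g = A' (g 0) (g 1) :=
      ⟨fun x y => A ![x, y], fun g => by congr 1; ext j; fin_cases j <;> rfl⟩
    obtain ⟨B', hB⟩ : ∃ B' : Fin 5 → Fin 5 → Fin 5 → ℝ, ∀ g, B g = B' (g 0) (g 1) (g 2) :=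
      ⟨fun x y z => B ![x, y, z], fun g => by congr 1; ext j; fin_cases j <;> rfl⟩
    simp only [Fin.sum_univ_five, Fin.sum_univ_four, Fin.sum_univ_three, hA, hB]
    simp [frontVertices, backVertices, Fin.succAbove]
    ring
  ext σ
  have e := key (fun g => a (SingularSimplex.pull g σ)) (fun g => b (SingularSimplex.pull g σ))
  refine Eq.trans ?_ (e.trans ?_)
  · change ∑ i : Fin 5, (-1 : ℝ) ^ (i : ℕ) *
      (a (SingularSimplex.pull _ (SingularSimplex.pull _ σ)) *
        b (SingularSimplex.pull _ (SingularSimplex.pull _ σ))) = _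
    simp only [SingularSimplex.pull_pull]
    rfl
  · change _ = (∑ i : Fin 3, (-1 : ℝ) ^ (i : ℕ) *
      a (SingularSimplex.pull _ (SingularSimplex.pull _ σ))) * _ -
      _ * (∑ i : Fin 4, (-1 : ℝ) ^ (i : ℕ) *
      b (SingularSimplex.pull _ (SingularSimplex.pull _ σ)))
    simp only [SingularSimplex.pull_pull]
    rfl

theorem coboundary_cup_two_one (a : SingularCochain X 2) (b : SingularCochain X 1) :
    (coboundary X 3 (cup a b : SingularCochain X 3) : SingularCochain X 4) =
      (cup (coboundary X 2 a) b : SingularCochain X 4) +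
        (cup a (coboundary X 1 b) : SingularCochain X 4) := by
  have key : ∀ (A : (Fin 3 → Fin 5) → ℝ) (B : (Fin 2 → Fin 5) → ℝ),
      ∑ i : Fin 5, (-1 : ℝ) ^ (i : ℕ) * (A (fun j => i.succAbove (frontVertices 2 1 j)) *
        B (fun j => i.succAbove (backVertices 2 1 j))) =
      (∑ i : Fin 4, (-1 : ℝ) ^ (i : ℕ) * A (fun j => frontVertices 3 1 (i.succAbove j))) *
        B (fun j => backVertices 3 1 j) +
      A (fun j => frontVertices 2 2 j) *
        ∑ i : Fin 3, (-1 : ℝ) ^ (i : ℕ) * B (fun j => backVertices 2 2 (i.succAbove j)) := by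
    intro A B
    obtain ⟨A', hA⟩ : ∃ A' : Fin 5 → Fin 5 → Fin 5 → ℝ, ∀ g, A g = A' (g 0) (g 1) (g 2) :=
      ⟨fun x y z => A ![x, y, z], fun g => by congr 1; ext j; fin_cases j <;> rfl⟩
    obtain ⟨B', hB⟩ : ∃ B' : Fin 5 → Fin 5 → ℝ, ∀ g, B g = B' (g 0) (g 1) :=
      ⟨fun x y => B ![x, y], fun g => by congr 1; ext j; fin_cases j <;> rfl⟩
    simp only [Fin.sum_univ_five, Fin.sum_univ_four, Fin.sum_univ_three, hA, hB]
    simp [frontVertices, backVertices, Fin.succAbove]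
    ring
  ext σ
  have e := key (fun g => a (SingularSimplex.pull g σ)) (fun g => b (SingularSimplex.pull g σ))
  refine Eq.trans ?_ (e.trans ?_)
  · change ∑ i : Fin 5, (-1 : ℝ) ^ (i : ℕ) *
      (a (SingularSimplex.pull _ (SingularSimplex.pull _ σ)) *
        b (SingularSimplex.pull _ (SingularSimplex.pull _ σ))) = _
    simp only [SingularSimplex.pull_pull]
    rfl
  · change _ = (∑ i : Fin 4, (-1 : ℝ) ^ (i : ℕ) *
      a (SingularSimplex.pull _ (SingularSimplex.pull _ σ))) * _ +
      _ * (∑ i : Fin 3, (-1 : ℝ) ^ (i : ℕ) *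
      b (SingularSimplex.pull _ (SingularSimplex.pull _ σ)))
    simp only [SingularSimplex.pull_pull]
    rfl

theorem cup_add_left {p q : ℕ} (a a' : SingularCochain X p) (b : SingularCochain X q) :
    cup (a + a') b = cup a b + cup a' b := by
  ext σ
  simp [cup_apply, add_mul]

theorem cup_add_right {p q : ℕ} (a : SingularCochain X p) (b b' : SingularCochain X q) :
    cup a (b + b') = cup a b + cup a b' := by
  ext σ
  simp [cup_apply, mul_add]

theorem cup_smul_left {p q : ℕ} (r : ℝ) (a : SingularCochain X p) (b : SingularCochain X q) :
    cup (r • a) b = r • cup a b := by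
  ext σ
  simp [cup_apply, mul_assoc]

theorem cup_smul_right {p q : ℕ} (r : ℝ) (a : SingularCochain X p) (b : SingularCochain X q) :
    cup a (r • b) = r • cup a b := by
  ext σ
  simp [cup_apply, mul_left_comm]

theorem zero_cup {p q : ℕ} (b : SingularCochain X q) : cup (0 : SingularCochain X p) b = 0 := by
  ext σ
  simp [cup_apply]

theorem cup_zero {p q : ℕ} (a : SingularCochain X p) : cup a (0 : SingularCochain X q) = 0 := by
  ext σ
  simp [cup_apply]

theorem cup_mem_cocycles (a b : cocycles X 2) :
    (cup (a : SingularCochain X 2) (b : SingularCochain X 2) : SingularCochain X 4) ∈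
      cocycles X 4 := by
  have ha : coboundary X 2 a = 0 := a.2
  have hb : coboundary X 2 b = 0 := b.2
  change coboundary X 4 _ = 0
  rw [coboundary_cup_two_two, ha, hb, zero_cup, cup_zero]
  exact add_zero _

/-- The cup product of two cocycles of degree two, as a bilinear map to `H⁴(X; ℝ)`. -/
def cupCocycles : cocycles X 2 →ₗ[ℝ] cocycles X 2 →ₗ[ℝ] Cohomology X 4 :=
  LinearMap.mk₂ ℝ
    (fun a b => Submodule.Quotient.mk ⟨cup (a : SingularCochain X 2) (b : SingularCochain X 2),
      cup_mem_cocycles a b⟩)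
    (fun a a' b => congrArg Submodule.Quotient.mk (Subtype.ext
      (cup_add_left (a : SingularCochain X 2) (a' : SingularCochain X 2) (b : SingularCochain X 2))))
    (fun r a b => congrArg Submodule.Quotient.mk (Subtype.ext
      (cup_smul_left r (a : SingularCochain X 2) (b : SingularCochain X 2))))
    (fun a b b' => congrArg Submodule.Quotient.mk (Subtype.ext
      (cup_add_right (a : SingularCochain X 2) (b : SingularCochain X 2) (b' : SingularCochain X 2))))
    (fun r a b => congrArg Submodule.Quotient.mk (Subtype.ext
      (cup_smul_right r (a : SingularCochain X 2) (b : SingularCochain X 2))))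

theorem cupCocycles_eq_zero_left (a b : cocycles X 2)
    (h : (a : SingularCochain X 2) ∈ coboundaries X 2) : cupCocycles a b = 0 := by
  obtain ⟨c, hc⟩ : ∃ c, coboundary X 1 c = (a : SingularCochain X 2) := h
  have hb : coboundary X 2 b = 0 := b.2
  change Submodule.Quotient.mk (⟨cup (a : SingularCochain X 2) (b : SingularCochain X 2),
    cup_mem_cocycles a b⟩ : cocycles X 4) = 0
  refine (Submodule.Quotient.mk_eq_zero ((coboundaries X 4).submoduleOf (cocycles X 4))).2 ?_
  refine ⟨cup c (b : SingularCochain X 2), ?_⟩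
  have e := coboundary_cup_one_two c (b : SingularCochain X 2)
  rw [hc, hb, cup_zero] at e
  exact e.trans (sub_zero _)

theorem cupCocycles_eq_zero_right (a b : cocycles X 2)
    (h : (b : SingularCochain X 2) ∈ coboundaries X 2) : cupCocycles a b = 0 := by
  obtain ⟨c, hc⟩ : ∃ c, coboundary X 1 c = (b : SingularCochain X 2) := h
  have ha : coboundary X 2 a = 0 := a.2
  change Submodule.Quotient.mk (⟨cup (a : SingularCochain X 2) (b : SingularCochain X 2),
    cup_mem_cocycles a b⟩ : cocycles X 4) = 0
  refine (Submodule.Quotient.mk_eq_zero ((coboundaries X 4).submoduleOf (cocycles X 4))).2 ?_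
  refine ⟨cup (a : SingularCochain X 2) c, ?_⟩
  have e := coboundary_cup_two_one (a : SingularCochain X 2) c
  rw [hc, ha, zero_cup] at e
  exact e.trans (zero_add _)

/-- The cup product `H²(X; ℝ) × H²(X; ℝ) → H⁴(X; ℝ)`. -/
def cupProduct : Cohomology X 2 →ₗ[ℝ] Cohomology X 2 →ₗ[ℝ] Cohomology X 4 :=
  Submodule.liftQ _
    { toFun := fun a => Submodule.liftQ _ (cupCocycles a) fun b hb =>
        cupCocycles_eq_zero_right a b hb
      map_add' := fun a a' => by
        refine LinearMap.ext fun b => ?_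
        induction b using Submodule.Quotient.induction_on with
        | H b => exact LinearMap.congr_fun (cupCocycles.map_add a a') b
      map_smul' := fun r a => by
        refine LinearMap.ext fun b => ?_
        induction b using Submodule.Quotient.induction_on with
        | H b => exact LinearMap.congr_fun (cupCocycles.map_smul r a) b } fun a ha => by
    refine LinearMap.ext fun b => ?_
    induction b using Submodule.Quotient.induction_on with
    | H b => exact cupCocycles_eq_zero_left a b ha

/-- The intersection form `Q(a, b) = ⟨a ∪ b, μ⟩` on `H²(X; ℝ)` of a closed `4`-manifold with
fundamental class `μ`. -/
def intersectionForm (μ : Homology X 4) : LinearMap.BilinForm ℝ (Cohomology X 2) :=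
  cupProduct.compr₂ (kronecker μ)

/-- `b₂⁺`: the maximal dimension of a subspace of `H²(X; ℝ)` on which the intersection form is
positive definite. -/
def bPlus (μ : Homology X 4) : ℕ∞ :=
  ⨆ (W : Submodule ℝ (Cohomology X 2)) (_ : ∀ a ∈ W, a ≠ 0 → 0 < intersectionForm μ a a),
    Cardinal.toENat (Module.rank ℝ W)

/-- `b₂⁻`: the maximal dimension of a subspace of `H²(X; ℝ)` on which the intersection form is
negative definite. -/
def bMinus (μ : Homology X 4) : ℕ∞ :=
  ⨆ (W : Submodule ℝ (Cohomology X 2)) (_ : ∀ a ∈ W, a ≠ 0 → intersectionForm μ a a < 0),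
    Cardinal.toENat (Module.rank ℝ W)

end Singular

/-! ## Differential forms and de Rham cohomology in degree two -/

section DeRham

variable (E : Type u) [NormedAddCommGroup E] [NormedSpace ℝ E]
variable (M : Type v) [TopologicalSpace M] [ChartedSpace E M]

/-- Differential `k`-forms on `M`, without any regularity: an alternating `k`-linear form on
each tangent space. -/
def RawForm (k : ℕ) : Type (max u v) :=
  ∀ x : M, TangentSpace 𝓘(ℝ, E) x [⋀^Fin k]→L[ℝ] ℝ

instance (k : ℕ) : AddCommGroup (RawForm E M k) :=
  inferInstanceAs (AddCommGroup (∀ x : M, TangentSpace 𝓘(ℝ, E) x [⋀^Fin k]→L[ℝ] ℝ))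

instance (k : ℕ) : Module ℝ (RawForm E M k) :=
  inferInstanceAs (Module ℝ (∀ x : M, TangentSpace 𝓘(ℝ, E) x [⋀^Fin k]→L[ℝ] ℝ))

variable {E M}

theorem RawForm.add_apply {k : ℕ} (α β : RawForm E M k) (x : M) : (α + β) x = α x + β x := rfl

theorem RawForm.smul_apply {k : ℕ} (r : ℝ) (α : RawForm E M k) (x : M) :
    (r • α) x = r • α x := rfl

theorem RawForm.zero_apply {k : ℕ} (x : M) : (0 : RawForm E M k) x = 0 := rfl

/-- The coordinate expression `(e⁻¹)^* α` of a `k`-form in a chart `e`. -/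
def RawForm.inChart {k : ℕ} (α : RawForm E M k) (e : OpenPartialHomeomorph M E) :
    E → E [⋀^Fin k]→L[ℝ] ℝ :=
  fun y => (α (e.symm y)).compContinuousLinearMap (mfderiv 𝓘(ℝ, E) 𝓘(ℝ, E) e.symm y)

theorem RawForm.inChart_add {k : ℕ} (α β : RawForm E M k)
    (e : OpenPartialHomeomorph M E) : (α + β).inChart e = α.inChart e + β.inChart e := rfl

theorem RawForm.inChart_smul {k : ℕ} (r : ℝ) (α : RawForm E M k)
    (e : OpenPartialHomeomorph M E) : (r • α).inChart e = r • α.inChart e := rfl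

/-- The exterior derivative `dα`, computed at each point in the preferred chart there:
`(dα)_x = e^* d((e⁻¹)^* α)`. -/
def RawForm.d {k : ℕ} (α : RawForm E M k) : RawForm E M (k + 1) :=
  fun x => (extDeriv (α.inChart (chartAt E x)) (chartAt E x x)).compContinuousLinearMap
    (mfderiv 𝓘(ℝ, E) 𝓘(ℝ, E) (chartAt E x) x)

variable (E M)

/-- The space `Ωᵏ(M)` of smooth `k`-forms: those with smooth coordinate expressions. -/
def smoothForms (k : ℕ) : Submodule ℝ (RawForm E M k) where
  carrier := {α | ∀ e ∈ atlas E M, ContDiffOn ℝ ∞ (α.inChart e) e.target}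
  add_mem' ha hb e he := (ha e he).add (hb e he)
  zero_mem' e _ := by
    have h : RawForm.inChart (0 : RawForm E M k) e = 0 := rfl
    rw [h]
    exact contDiffOn_const
  smul_mem' r α hα e he := by
    rw [RawForm.inChart_smul]
    exact (hα e he).const_smul r

variable {E M}

theorem differentiableAt_inChart {k : ℕ} {α : RawForm E M k} (hα : α ∈ smoothForms E M k)
    (x : M) : DifferentiableAt ℝ (α.inChart (chartAt E x)) (chartAt E x x) :=
  (ContDiffOn.contDiffAt (hα (chartAt E x) (chart_mem_atlas E x)) ((chartAt E x).open_target.mem_nhds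
    (mem_chart_target E x))).differentiableAt (by simp)

theorem RawForm.d_add {k : ℕ} {α β : RawForm E M k} (hα : α ∈ smoothForms E M k)
    (hβ : β ∈ smoothForms E M k) : (α + β).d = α.d + β.d := by
  funext x
  simp only [RawForm.d, RawForm.inChart_add, RawForm.add_apply]
  rw [extDeriv_add (differentiableAt_inChart hα x) (differentiableAt_inChart hβ x)]
  rfl

theorem RawForm.d_smul {k : ℕ} (r : ℝ) (α : RawForm E M k) : (r • α).d = r • α.d := by
  funext x
  simp only [RawForm.d, RawForm.inChart_smul, RawForm.smul_apply]
  rw [extDeriv_smul]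
  rfl

variable (E M)

/-- The exterior derivative as a linear map on smooth forms. -/
def exteriorD (k : ℕ) : smoothForms E M k →ₗ[ℝ] RawForm E M (k + 1) where
  toFun α := RawForm.d (α : RawForm E M k)
  map_add' α β := RawForm.d_add α.2 β.2
  map_smul' r _ := RawForm.d_smul r _

/-- The space `𝒵ᵏ` of closed smooth `k`-forms. -/
def closedForms (k : ℕ) : Submodule ℝ (RawForm E M k) where
  carrier := {α | α ∈ smoothForms E M k ∧ α.d = 0}
  add_mem' ha hb := ⟨add_mem ha.1 hb.1, by rw [RawForm.d_add ha.1 hb.1, ha.2, hb.2, add_zero]⟩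
  zero_mem' := ⟨zero_mem _, by simpa using RawForm.d_smul (0 : ℝ) (0 : RawForm E M k)⟩
  smul_mem' r _ hα := ⟨Submodule.smul_mem _ r hα.1, by rw [RawForm.d_smul, hα.2, smul_zero]⟩

/-- The space of exact `(k + 1)`-forms: exterior derivatives of smooth `k`-forms. -/
def exactForms (k : ℕ) : Submodule ℝ (RawForm E M (k + 1)) :=
  LinearMap.range (exteriorD E M k)

/-- The second de Rham cohomology `H²(M; ℝ)`. -/
abbrev DeRhamH2 : Type (max u v) :=
  closedForms E M 2 ⧸ (exactForms E M 1).submoduleOf (closedForms E M 2)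

/-- A (smooth) almost complex structure on `M`: a smooth section `J` of `End(TM)` with
`J² = -1`. -/
structure AlmostComplexStructure [IsManifold 𝓘(ℝ, E) ∞ M] where
  /-- The endomorphism field. -/
  J : Cₛ^∞⟮𝓘(ℝ, E); E →L[ℝ] E,
    fun x : M => TangentSpace 𝓘(ℝ, E) x →L[ℝ] TangentSpace 𝓘(ℝ, E) x⟯
  /-- `J² = -1`. -/
  sq_eq_neg : ∀ (x : M) (v : TangentSpace 𝓘(ℝ, E) x), J x (J x v) = -v

variable {E M}
variable [IsManifold 𝓘(ℝ, E) ∞ M]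

/-- The `2`-forms with `α(J·, J·) = s α(·, ·)`. -/
def eigenForms (𝒥 : AlmostComplexStructure E M) (s : ℝ) : Submodule ℝ (RawForm E M 2) where
  carrier := {α | ∀ (x : M) (v w : TangentSpace 𝓘(ℝ, E) x),
    α x ![𝒥.J x v, 𝒥.J x w] = s * α x ![v, w]}
  add_mem' ha hb x v w := by
    have h1 := ha x v w
    have h2 := hb x v w
    simp only [RawForm.add_apply, ContinuousAlternatingMap.add_apply, h1, h2, mul_add]
  zero_mem' x v w := by simp [RawForm.zero_apply]
  smul_mem' r α hα x v w := by
    have h := hα x v w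
    simp only [RawForm.smul_apply, ContinuousAlternatingMap.smul_apply, h, smul_eq_mul]
    ring

/-- `H_J⁺(M)`: the classes in `H²(M; ℝ)` of closed `J`-invariant `2`-forms. -/
def HPlus (𝒥 : AlmostComplexStructure E M) : Submodule ℝ (DeRhamH2 E M) :=
  ((eigenForms 𝒥 1).submoduleOf (closedForms E M 2)).map (Submodule.mkQ _)

/-- `H_J⁻(M)`: the classes in `H²(M; ℝ)` of closed `J`-anti-invariant `2`-forms. -/
def HMinus (𝒥 : AlmostComplexStructure E M) : Submodule ℝ (DeRhamH2 E M) :=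
  ((eigenForms 𝒥 (-1)).submoduleOf (closedForms E M 2)).map (Submodule.mkQ _)

/-- `h_J⁺(M) = dim H_J⁺(M)`. -/
def hPlus (𝒥 : AlmostComplexStructure E M) : ℕ∞ := Cardinal.toENat (Module.rank ℝ (HPlus 𝒥))

/-- `h_J⁻(M) = dim H_J⁻(M)`. -/
def hMinus (𝒥 : AlmostComplexStructure E M) : ℕ∞ := Cardinal.toENat (Module.rank ℝ (HMinus 𝒥))

/-- `f` is `(J, J')`-holomorphic: it is smooth and `df ∘ J = J' ∘ df`. -/
def IsPseudoholomorphic {F : Type*} [NormedAddCommGroup F] [NormedSpace ℝ F]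
    {N : Type*} [TopologicalSpace N] [ChartedSpace F N] [IsManifold 𝓘(ℝ, F) ∞ N]
    (𝒥 : AlmostComplexStructure E M) (𝒥' : AlmostComplexStructure F N) (f : M → N) : Prop :=
  ContMDiff 𝓘(ℝ, E) 𝓘(ℝ, F) ∞ f ∧
    ∀ (x : M) (v : TangentSpace 𝓘(ℝ, E) x),
      mfderiv 𝓘(ℝ, E) 𝓘(ℝ, F) f x (𝒥.J x v) = 𝒥'.J (f x) (mfderiv 𝓘(ℝ, E) 𝓘(ℝ, F) f x v)

end DeRham

end MappingOrder

end

/-!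
For a map `f` of degree `d`, the pull-back `f^*` on real singular cohomology multiplies the
intersection form by `d` (`intersectionForm_map`). It is therefore injective on every definite
subspace and carries it to a definite subspace, of the same sign if `d > 0` and of the opposite sign
if `d < 0` (`bPlus_le_and_bMinus_le_of_hasDegree`).

For a pseudoholomorphic map `f : M → N`, the pull-back of forms preserves the two types, so it is
enough that `f^*` is injective on second de Rham cohomology (`rank_map_eigenForms_le`): if `α` is
closed on `N` and `f^*α = dβ`, then `α` is exact. The proof transfers `β` to `N` by integration over
`M`. Neither Poincaré duality nor de Rham's theorem is used, and the manifolds may be disconnected.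

* An almost complex structure determines an orientation, and `df` never reverses orientations,
  because a real linear map that commutes with a complex structure has non-negative determinant
  (`det_nonneg_of_commute`). Hence a sign `relSign`, defined at all pairs of points, turns `det df`
  into `|det df|` (`relSign_mul_det`), and densities on `M` suffice.
* The transfer of `β` is the functional on vector densities `X` on `N` that integrates
  `β(adj(df) X)` over `M` with this sign (`transferDens`). It is a current of order zero
  (`exists_transfer_measure`). If `dβ = f^*α`, then Stokes' theorem on `M`, for the form
  `g(f) β ∧ ⋀_{k ≠ i, j} df_k`, shows that its exterior derivative is `α` times the transfer of the
  function `1` (`integ_transferDens_curlField`). That transfer integrates `|det df| γ(f)` for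
  densities `γ` on `N`.
* The transfer of `1` is a locally constant function `c` (`exists_degree`, `degree_eq`), and `c > 0`
  by Sard's theorem because `f` is surjective (`degree_pos`). This is where surjectivity enters.
  The transfer of `β` divided by `c` is therefore a weak primitive of `α`.
* A form with a weak primitive of order zero is exact (`mem_exactForms_of_weak_primitive`). In a
  chart, a homotopy formula with a mollifier writes the primitive as a smooth form plus the
  derivative of a signed measure (`exists_regularization`). Two such measures differ by a smooth
  density (`exists_density_transition`), so the measures can be glued by a partition of unity, and
  subtracting the derivative of the glued measure leaves a smooth primitive (`exists_local_smooth`,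
  `exists_smoothForm_of_local`).
-/


noncomputable section

namespace MappingOrder

/-! ### The intersection form under a map of non-zero degree -/

section Pullback

variable {X : Type u} [TopologicalSpace X] {Y : Type v} [TopologicalSpace Y]

/-- The pullback `f^#` of singular cochains. -/
def cochainMap (f : C(X, Y)) (n : ℕ) : SingularCochain Y n →ₗ[ℝ] SingularCochain X n where
  toFun c σ := c (f.comp σ)
  map_add' _ _ := rfl
  map_smul' _ _ := rfl

theorem coboundary_cochainMap (f : C(X, Y)) (n : ℕ) (c : SingularCochain Y n) :
    coboundary X n (cochainMap f n c) = cochainMap f (n + 1) (coboundary Y n c) := rfl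

theorem evalChain_cochainMap (f : C(X, Y)) {n : ℕ} (c : SingularCochain Y n)
    (z : SingularChain X n) : evalChain (cochainMap f n c) z = evalChain c (chainMap f n z) := by
  suffices h : evalChain (cochainMap f n c) = (evalChain c).comp (chainMap f n) from
    LinearMap.congr_fun h z
  ext σ
  simp [evalChain, chainMap, cochainMap]

theorem cochainMap_mem_cocycles (f : C(X, Y)) {n : ℕ} (c : SingularCochain Y n)
    (hc : c ∈ cocycles Y n) : cochainMap f n c ∈ cocycles X n := by
  have h : coboundary Y n c = 0 := hc
  change coboundary X n (cochainMap f n c) = 0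
  rw [coboundary_cochainMap, h, map_zero]

/-- The induced map `f^* : H^{n+1}(Y; ℝ) → H^{n+1}(X; ℝ)`. -/
def Cohomology.map (f : C(X, Y)) (n : ℕ) : Cohomology Y (n + 1) →ₗ[ℝ] Cohomology X (n + 1) :=
  Submodule.mapQ _ _ ((cochainMap f (n + 1)).restrict (cochainMap_mem_cocycles f)) fun c hc => by
    obtain ⟨b, hb⟩ : (c : SingularCochain Y (n + 1)) ∈ coboundaries Y (n + 1) := hc
    exact ⟨cochainMap f n b, by rw [coboundary_cochainMap, hb]; rfl⟩

theorem intersectionForm_map (f : C(X, Y)) {μ : Homology X 4} {ν : Homology Y 4} {d : ℤ}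
    (h : HasDegree f μ ν d) (a b : Cohomology Y 2) :
    intersectionForm μ (Cohomology.map f 1 a) (Cohomology.map f 1 b) =
      d * intersectionForm ν a b := by
  induction a using Submodule.Quotient.induction_on with
  | H a =>
  induction b using Submodule.Quotient.induction_on with
  | H b =>
  have key : ∀ c : cocycles Y 4, kroneckerAux
      (⟨cochainMap f 4 c, cochainMap_mem_cocycles f _ c.2⟩ : cocycles X 4) μ =
      d * kroneckerAux c ν := by
    intro c
    have e : kroneckerAux (⟨cochainMap f 4 c, cochainMap_mem_cocycles f _ c.2⟩ : cocycles X 4) μ =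
        kroneckerAux c (Homology.map f 4 μ) := by
      induction μ using Submodule.Quotient.induction_on with
      | H z => exact evalChain_cochainMap f _ _
    rw [e, h, map_zsmul, zsmul_eq_mul]
  exact key ⟨cup (a : SingularCochain Y 2) (b : SingularCochain Y 2), cup_mem_cocycles a b⟩

/-- A subspace on which a form satisfies a predicate violated by zero injects under any map that
transports the predicate, and so contributes at most the rank of its image. -/
theorem rank_le_iSup_of_definite {V W : Type*} [AddCommGroup V] [Module ℝ V] [AddCommGroup W]
    [Module ℝ W] (φ : V →ₗ[ℝ] W) (Q : V → ℝ) (R : W → ℝ) (hR : R 0 = 0) (P P' : ℝ → Prop)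
    (h0 : ¬ P' 0) (h : ∀ a, P (Q a) → P' (R (φ a))) :
    (⨆ (U : Submodule ℝ V) (_ : ∀ a ∈ U, a ≠ 0 → P (Q a)), Cardinal.toENat (Module.rank ℝ U)) ≤
      ⨆ (U : Submodule ℝ W) (_ : ∀ a ∈ U, a ≠ 0 → P' (R a)),
        Cardinal.toENat (Module.rank ℝ U) := by
  refine iSup₂_le fun U hU => ?_
  have hinj : Function.Injective (φ.domRestrict U) := by
    refine (injective_iff_map_eq_zero _).2 fun a ha => ?_
    by_contra hne
    have h1 := h a (hU a a.2 fun h => hne (Subtype.ext h))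
    rw [show φ a = 0 from ha, hR] at h1
    exact h0 h1
  have hU' : ∀ a ∈ U.map φ, a ≠ 0 → P' (R a) := by
    rintro _ ⟨a, ha, rfl⟩ hne
    exact h a (hU a ha fun h => hne (by rw [h, map_zero]))
  refine le_trans ?_ (le_iSup₂ (U.map φ) hU')
  have e := (LinearEquiv.ofInjective _ hinj).lift_rank_eq
  rw [LinearMap.range_domRestrict] at e
  exact le_of_eq (by simpa using congrArg Cardinal.toENat e)

theorem bPlus_le_and_bMinus_le_of_hasDegree (f : C(X, Y)) {μ : Homology X 4} {ν : Homology Y 4}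
    {d : ℤ} (h : HasDegree f μ ν d) :
    (0 < d → bPlus ν ≤ bPlus μ ∧ bMinus ν ≤ bMinus μ) ∧
      (d < 0 → bMinus ν ≤ bPlus μ ∧ bPlus ν ≤ bMinus μ) := by
  have hQ := fun a => intersectionForm_map f h a a
  have h0 : intersectionForm μ 0 0 = 0 := by simp
  refine ⟨fun hd => ⟨?_, ?_⟩, fun hd => ⟨?_, ?_⟩⟩
  · have hd' : (0 : ℝ) < d := by exact_mod_cast hd
    exact rank_le_iSup_of_definite (Cohomology.map f 1) (fun a => intersectionForm ν a a)
      (fun a => intersectionForm μ a a) h0 (fun t => 0 < t) (fun t => 0 < t) (lt_irrefl 0)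
      fun a ha => by simpa only [hQ] using mul_pos hd' ha
  · have hd' : (0 : ℝ) < d := by exact_mod_cast hd
    exact rank_le_iSup_of_definite (Cohomology.map f 1) (fun a => intersectionForm ν a a)
      (fun a => intersectionForm μ a a) h0 (fun t => t < 0) (fun t => t < 0) (lt_irrefl 0)
      fun a ha => by simpa only [hQ] using mul_neg_of_pos_of_neg hd' ha
  · have hd' : (d : ℝ) < 0 := by exact_mod_cast hd
    exact rank_le_iSup_of_definite (Cohomology.map f 1) (fun a => intersectionForm ν a a)
      (fun a => intersectionForm μ a a) h0 (fun t => t < 0) (fun t => 0 < t) (lt_irrefl 0)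
      fun a ha => by simpa only [hQ] using mul_pos_of_neg_of_neg hd' ha
  · have hd' : (d : ℝ) < 0 := by exact_mod_cast hd
    exact rank_le_iSup_of_definite (Cohomology.map f 1) (fun a => intersectionForm ν a a)
      (fun a => intersectionForm μ a a) h0 (fun t => 0 < t) (fun t => t < 0) (lt_irrefl 0)
      fun a ha => by simpa only [hQ] using mul_neg_of_neg_of_pos hd' ha

end Pullback

/-! ### Pullback of differential forms -/

section FormPullback

open Filter Topology

section Charts

variable {E M F N : Type*} [TopologicalSpace E] [TopologicalSpace M] [TopologicalSpace F]
  [TopologicalSpace N]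

/-- The expression of a map in charts of source and target. -/
def inCharts (f : M → N) (e : OpenPartialHomeomorph M E) (e' : OpenPartialHomeomorph N F) :
    E → F := fun z => e' (f (e.symm z))

/-- The domain of the expression of a map in two charts. -/
def chartDomain (f : M → N) (e : OpenPartialHomeomorph M E) (e' : OpenPartialHomeomorph N F) :
    Set E := e.target ∩ e.symm ⁻¹' (f ⁻¹' e'.source)

theorem isOpen_chartDomain {f : M → N} (hf : Continuous f) (e : OpenPartialHomeomorph M E)
    (e' : OpenPartialHomeomorph N F) : IsOpen (chartDomain f e e') :=
  e.symm.isOpen_inter_preimage (e'.open_source.preimage hf)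

end Charts

variable {E : Type*} [NormedAddCommGroup E] [NormedSpace ℝ E]
variable {F : Type*} [NormedAddCommGroup F] [NormedSpace ℝ F]

theorem contDiff_alternating_compContinuousLinearMap (k : ℕ) :
    ContDiff ℝ ∞ fun p : (F [⋀^Fin k]→L[ℝ] ℝ) × (E →L[ℝ] F) =>
      p.1.compContinuousLinearMap p.2 := by
  -- A scaled alternatization is a continuous left inverse of the inclusion into multilinear maps.
  let A : ContinuousMultilinearMap ℝ (fun _ : Fin k => E) ℝ →L[ℝ] E [⋀^Fin k]→L[ℝ] ℝ :=
    LinearMap.mkContinuous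
      { toFun := fun f => (k.factorial : ℝ)⁻¹ • ContinuousMultilinearMap.alternatization f
        map_add' := by intros; simp
        map_smul' := fun r f => by
          ext v
          simp only [ContinuousAlternatingMap.smul_apply, 
            ContinuousMultilinearMap.alternatization_apply_apply, smul_apply, RingHom.id_apply, smul_eq_mul, Finset.mul_sum]
          refine Finset.sum_congr rfl fun σ _ => ?_
          rw [Units.smul_def, Units.smul_def, zsmul_eq_mul, zsmul_eq_mul]
          ring } 1 (by
        intro f
        refine ContinuousAlternatingMap.opNorm_le_bound _ (by positivity) fun v => ?_
        change ‖((k.factorial : ℝ)⁻¹ • ContinuousMultilinearMap.alternatization f) v‖ ≤ _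
        rw [ContinuousAlternatingMap.smul_apply,
          ContinuousMultilinearMap.alternatization_apply_apply, norm_smul]
        have h : ‖∑ σ : Equiv.Perm (Fin k), Equiv.Perm.sign σ • f (v ∘ σ)‖ ≤
            ∑ _σ : Equiv.Perm (Fin k), ‖f‖ * ∏ i, ‖v i‖ := by
          refine norm_sum_le_of_le _ fun σ _ => ?_
          have h1 : ‖Equiv.Perm.sign σ • f (v ∘ σ)‖ = ‖f (v ∘ σ)‖ := by
            rcases Int.units_eq_one_or (Equiv.Perm.sign σ) with h | h <;> simp [h]
          rw [h1]
          refine (f.le_opNorm _).trans (le_of_eq ?_)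
          congr 1
          exact Equiv.prod_comp σ fun i => ‖v i‖
        rw [Finset.sum_const, Finset.card_univ, Fintype.card_perm, Fintype.card_fin,
          nsmul_eq_mul] at h
        have hk : (0 : ℝ) < k.factorial := by positivity
        rw [norm_inv, Real.norm_of_nonneg hk.le, one_mul, inv_mul_le_iff₀ hk]
        exact h)
  have hA : ∀ g : E [⋀^Fin k]→L[ℝ] ℝ, A g.toContinuousMultilinearMap = g := by
    intro g
    ext v
    change ((k.factorial : ℝ)⁻¹ •
      ContinuousMultilinearMap.alternatization g.toContinuousMultilinearMap) v = g v
    rw [ContinuousAlternatingMap.smul_apply,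
          ContinuousMultilinearMap.alternatization_apply_apply]
    have h : ∀ σ : Equiv.Perm (Fin k),
        Equiv.Perm.sign σ • g.toContinuousMultilinearMap (v ∘ σ) = g v := by
      intro σ
      have := g.toAlternatingMap.map_perm v σ
      change Equiv.Perm.sign σ • g (v ∘ σ) = g v
      rw [show g (v ∘ σ) = _ from this, smul_smul, Int.units_mul_self, one_smul]
      rfl
    rw [Finset.sum_congr rfl fun σ _ => h σ, Finset.sum_const, Finset.card_univ,
      Fintype.card_perm, Fintype.card_fin, nsmul_eq_mul, smul_eq_mul, inv_mul_cancel_left₀]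
    positivity
  have h1 := (ContinuousMultilinearMap.analyticOnNhd_uncurry_compContinuousLinearMap (𝕜 := ℝ)
    (Em := fun _ : Fin k => F) (Fm := fun _ : Fin k => E) (G := ℝ)).contDiffOn
    uniqueDiffOn_univ (n := ∞)
  have h2 : ContDiff ℝ ∞ fun p : (F [⋀^Fin k]→L[ℝ] ℝ) × (E →L[ℝ] F) =>
      ((fun _ : Fin k => p.2), (ContinuousAlternatingMap.toContinuousMultilinearMapCLM ℝ p.1)) := by
    fun_prop
  have h3 := A.contDiff.comp ((contDiffOn_univ.1 h1).comp h2)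
  exact (funext fun p => (hA _).symm :
    (fun p : (F [⋀^Fin k]→L[ℝ] ℝ) × (E →L[ℝ] F) => p.1.compContinuousLinearMap p.2) = _) ▸ h3

variable {M : Type*} [TopologicalSpace M] [ChartedSpace E M]
variable {N : Type*} [TopologicalSpace N] [ChartedSpace F N]

/-- The derivative at `x` of a map between manifolds, as a map between the model spaces. -/
def rawDeriv (f : M → N) (x : M) : E →L[ℝ] F := mfderiv 𝓘(ℝ, E) 𝓘(ℝ, F) f x

/-- The value of a form at a point, as a form on the model space. -/
def RawForm.val {k : ℕ} (α : RawForm E M k) : M → E [⋀^Fin k]→L[ℝ] ℝ := α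

/-- The pullback `f^* α` of a differential form. -/
def RawForm.pullback (f : M → N) {k : ℕ} : RawForm F N k →ₗ[ℝ] RawForm E M k where
  toFun α := fun x => (α.val (f x)).compContinuousLinearMap (rawDeriv (E := E) (F := F) f x)
  map_add' _ _ := rfl
  map_smul' _ _ := rfl

theorem RawForm.pullback_val (f : M → N) {k : ℕ} (α : RawForm F N k) (x : M) :
    (RawForm.pullback f α).val x =
      (α.val (f x)).compContinuousLinearMap (rawDeriv (E := E) (F := F) f x) := rfl

theorem RawForm.inChart_eq {k : ℕ} (α : RawForm E M k) (e : OpenPartialHomeomorph M E) (z : E) :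
    α.inChart e z = (α.val (e.symm z)).compContinuousLinearMap (rawDeriv (E := E) e.symm z) := rfl

theorem rawDeriv_id (x : M) : rawDeriv (E := E) (F := E) (id : M → M) x = .id ℝ E := mfderiv_id

theorem RawForm.pullback_id {k : ℕ} (α : RawForm E M k) :
    RawForm.pullback (id : M → M) α = α := by
  funext x
  change (RawForm.pullback (id : M → M) α : RawForm E M k).val x = α.val x
  rw [RawForm.pullback_val, rawDeriv_id]
  rfl

variable [IsManifold 𝓘(ℝ, E) ∞ M] [IsManifold 𝓘(ℝ, F) ∞ N]

theorem hasMFDerivAt_chart {e : OpenPartialHomeomorph M E} (he : e ∈ atlas E M) {x : M}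
    (hx : x ∈ e.source) :
    HasMFDerivAt 𝓘(ℝ, E) 𝓘(ℝ, E) e x (rawDeriv (E := E) (F := E) e x) :=
  (mdifferentiableAt_atlas he hx).hasMFDerivAt

theorem hasMFDerivAt_chart_symm {e : OpenPartialHomeomorph M E} (he : e ∈ atlas E M) {z : E}
    (hz : z ∈ e.target) :
    HasMFDerivAt 𝓘(ℝ, E) 𝓘(ℝ, E) e.symm z (rawDeriv (E := E) (F := E) e.symm z) :=
  (mdifferentiableAt_atlas_symm he hz).hasMFDerivAt

/-- Two smooth maps that compose to the same germ have the same composite derivative. -/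
theorem comp_eq_comp_of_hasMFDerivAt
    {E₁ E₂ E₃ E₄ : Type*} [NormedAddCommGroup E₁] [NormedSpace ℝ E₁] [NormedAddCommGroup E₂]
    [NormedSpace ℝ E₂] [NormedAddCommGroup E₃] [NormedSpace ℝ E₃] [NormedAddCommGroup E₄]
    [NormedSpace ℝ E₄]
    {M₁ M₂ M₃ M₄ : Type*} [TopologicalSpace M₁] [ChartedSpace E₁ M₁] [TopologicalSpace M₂]
    [ChartedSpace E₂ M₂] [TopologicalSpace M₃] [ChartedSpace E₃ M₃] [TopologicalSpace M₄]
    [ChartedSpace E₄ M₄]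
    {a : M₁ → M₂} {b : M₂ → M₃} {c : M₁ → M₄} {d : M₄ → M₃} {x : M₁}
    {a' : E₁ →L[ℝ] E₂} {b' : E₂ →L[ℝ] E₃} {c' : E₁ →L[ℝ] E₄} {d' : E₄ →L[ℝ] E₃}
    (ha : HasMFDerivAt 𝓘(ℝ, E₁) 𝓘(ℝ, E₂) a x a')
    (hb : HasMFDerivAt 𝓘(ℝ, E₂) 𝓘(ℝ, E₃) b (a x) b')
    (hc : HasMFDerivAt 𝓘(ℝ, E₁) 𝓘(ℝ, E₄) c x c')
    (hd : HasMFDerivAt 𝓘(ℝ, E₄) 𝓘(ℝ, E₃) d (c x) d')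
    (h : b ∘ a =ᶠ[𝓝 x] d ∘ c) : b'.comp a' = d'.comp c' :=
  hasMFDerivAt_unique (HasMFDerivAt.comp x hb ha)
    ((HasMFDerivAt.comp x hd hc).congr_of_eventuallyEq h)

theorem rawDeriv_symm_comp {e : OpenPartialHomeomorph M E} (he : e ∈ atlas E M) {x : M}
    (hx : x ∈ e.source) :
    (rawDeriv (E := E) (F := E) e.symm (e x)).comp (rawDeriv (E := E) (F := E) e x) = .id ℝ E := by
  have h := comp_eq_comp_of_hasMFDerivAt (hasMFDerivAt_chart he hx)
    (hasMFDerivAt_chart_symm he (e.map_source hx)) (hasMFDerivAt_id (I := 𝓘(ℝ, E)) x)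
    (hasMFDerivAt_id (I := 𝓘(ℝ, E)) _)
    (by filter_upwards [e.open_source.mem_nhds hx] with y hy using e.left_inv hy)
  exact h

theorem rawDeriv_comp_symm {e : OpenPartialHomeomorph M E} (he : e ∈ atlas E M) {z : E}
    (hz : z ∈ e.target) :
    (rawDeriv (E := E) (F := E) e (e.symm z)).comp (rawDeriv (E := E) (F := E) e.symm z) =
      .id ℝ E := by
  have h := comp_eq_comp_of_hasMFDerivAt (hasMFDerivAt_chart_symm he hz)
    (hasMFDerivAt_chart he (e.map_target hz)) (hasMFDerivAt_id (I := 𝓘(ℝ, E)) z)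
    (hasMFDerivAt_id (I := 𝓘(ℝ, E)) _)
    (by filter_upwards [e.open_target.mem_nhds hz] with y hy using e.right_inv hy)
  exact h

theorem contDiffOn_inCharts {f : M → N} (hf : ContMDiff 𝓘(ℝ, E) 𝓘(ℝ, F) ∞ f)
    {e : OpenPartialHomeomorph M E} (he : e ∈ atlas E M)
    {e' : OpenPartialHomeomorph N F} (he' : e' ∈ atlas F N) :
    ContDiffOn ℝ ∞ (inCharts f e e') (chartDomain f e e') := by
  rw [← contMDiffOn_iff_contDiffOn]
  have h1 : ContMDiffOn 𝓘(ℝ, E) 𝓘(ℝ, E) ∞ e.symm e.target :=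
    contMDiffOn_symm_of_mem_maximalAtlas (IsManifold.subset_maximalAtlas he)
  have h2 : ContMDiffOn 𝓘(ℝ, F) 𝓘(ℝ, F) ∞ e' e'.source :=
    contMDiffOn_of_mem_maximalAtlas (IsManifold.subset_maximalAtlas he')
  exact h2.comp (hf.comp_contMDiffOn (h1.mono Set.inter_subset_left)) fun z hz => hz.2

theorem hasFDerivAt_inCharts {f : M → N} (hf : ContMDiff 𝓘(ℝ, E) 𝓘(ℝ, F) ∞ f)
    {e : OpenPartialHomeomorph M E} (he : e ∈ atlas E M)
    {e' : OpenPartialHomeomorph N F} (he' : e' ∈ atlas F N) {z : E}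
    (hz : z ∈ chartDomain f e e') :
    HasFDerivAt (inCharts f e e') (((rawDeriv (E := F) (F := F) e' (f (e.symm z))).comp
      (rawDeriv (E := E) (F := F) f (e.symm z))).comp (rawDeriv (E := E) (F := E) e.symm z)) z := by
  have h0 : HasMFDerivAt 𝓘(ℝ, E) 𝓘(ℝ, F) f (e.symm z) (rawDeriv (E := E) (F := F) f (e.symm z)) :=
    (hf.mdifferentiable (by simp) _).hasMFDerivAt
  exact ((HasMFDerivAt.comp (e.symm z) (hasMFDerivAt_chart he' hz.2) h0).comp z
    (hasMFDerivAt_chart_symm he hz.1)).hasFDerivAt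

theorem fderiv_inCharts {f : M → N} (hf : ContMDiff 𝓘(ℝ, E) 𝓘(ℝ, F) ∞ f)
    {e : OpenPartialHomeomorph M E} (he : e ∈ atlas E M)
    {e' : OpenPartialHomeomorph N F} (he' : e' ∈ atlas F N) {z : E}
    (hz : z ∈ chartDomain f e e') :
    fderiv ℝ (inCharts f e e') z = ((rawDeriv (E := F) (F := F) e' (f (e.symm z))).comp
      (rawDeriv (E := E) (F := F) f (e.symm z))).comp (rawDeriv (E := E) (F := E) e.symm z) :=
  (hasFDerivAt_inCharts hf he he' hz).fderiv

theorem RawForm.inChart_pullback {f : M → N} (hf : ContMDiff 𝓘(ℝ, E) 𝓘(ℝ, F) ∞ f)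
    {e : OpenPartialHomeomorph M E} (he : e ∈ atlas E M)
    {e' : OpenPartialHomeomorph N F} (he' : e' ∈ atlas F N) {k : ℕ} (α : RawForm F N k) {z : E}
    (hz : z ∈ chartDomain f e e') :
    (RawForm.pullback f α : RawForm E M k).inChart e z =
      (α.inChart e' (inCharts f e e' z)).compContinuousLinearMap
        (fderiv ℝ (inCharts f e e') z) := by
  rw [fderiv_inCharts hf he he' hz, RawForm.inChart_eq, RawForm.inChart_eq, RawForm.pullback_val]
  have h1 : e'.symm (inCharts f e e' z) = f (e.symm z) := e'.left_inv hz.2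
  have h2 := rawDeriv_symm_comp he' hz.2
  rw [h1]
  ext v
  simp only [ContinuousAlternatingMap.compContinuousLinearMap_apply]
  congr 1
  funext i
  exact (DFunLike.congr_fun h2 (rawDeriv (E := E) (F := F) f (e.symm z)
    (rawDeriv (E := E) (F := E) e.symm z (v i)))).symm

theorem RawForm.inChart_pullback_eventuallyEq {f : M → N} (hf : ContMDiff 𝓘(ℝ, E) 𝓘(ℝ, F) ∞ f)
    {e : OpenPartialHomeomorph M E} (he : e ∈ atlas E M)
    {e' : OpenPartialHomeomorph N F} (he' : e' ∈ atlas F N) {k : ℕ} (α : RawForm F N k) {z : E}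
    (hz : z ∈ chartDomain f e e') :
    (RawForm.pullback f α : RawForm E M k).inChart e =ᶠ[𝓝 z] fun y =>
      (α.inChart e' (inCharts f e e' y)).compContinuousLinearMap
        (fderiv ℝ (inCharts f e e') y) := by
  filter_upwards [(isOpen_chartDomain hf.continuous e e').mem_nhds hz] with y hy
  exact RawForm.inChart_pullback hf he he' α hy

theorem RawForm.pullback_mem_smoothForms {f : M → N} (hf : ContMDiff 𝓘(ℝ, E) 𝓘(ℝ, F) ∞ f)
    {k : ℕ} {α : RawForm F N k} (hα : α ∈ smoothForms F N k) :
    RawForm.pullback f α ∈ smoothForms E M k := by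
  intro e he z hz
  have he' := chart_mem_atlas F (f (e.symm z))
  have hz' : z ∈ chartDomain f e (chartAt F (f (e.symm z))) := ⟨hz, mem_chart_source _ _⟩
  refine ContDiffAt.contDiffWithinAt
    (ContDiffAt.congr_of_eventuallyEq ?_ (RawForm.inChart_pullback_eventuallyEq hf he he' α hz'))
  have hopen := isOpen_chartDomain hf.continuous e (chartAt F (f (e.symm z)))
  have h1 : ContDiffAt ℝ ∞ (inCharts f e (chartAt F (f (e.symm z)))) z :=
    (contDiffOn_inCharts hf he he').contDiffAt (hopen.mem_nhds hz')
  have h2 : ContDiffAt ℝ ∞ (α.inChart (chartAt F (f (e.symm z))))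
      (inCharts f e (chartAt F (f (e.symm z))) z) :=
    (hα _ he').contDiffAt ((chartAt F _).open_target.mem_nhds ((chartAt F _).map_source hz'.2))
  exact (contDiff_alternating_compContinuousLinearMap k).contDiffAt.comp z
    ((h2.comp z h1).prodMk (h1.fderiv_right (m := ∞) (by simp)))

theorem RawForm.extDeriv_inChart_pullback {f : M → N} (hf : ContMDiff 𝓘(ℝ, E) 𝓘(ℝ, F) ∞ f)
    {e : OpenPartialHomeomorph M E} (he : e ∈ atlas E M)
    {e' : OpenPartialHomeomorph N F} (he' : e' ∈ atlas F N) {k : ℕ} {α : RawForm F N k}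
    (hα : α ∈ smoothForms F N k) {z : E} (hz : z ∈ chartDomain f e e') :
    extDeriv ((RawForm.pullback f α : RawForm E M k).inChart e) z =
      (extDeriv (α.inChart e') (inCharts f e e' z)).compContinuousLinearMap
        (fderiv ℝ (inCharts f e e') z) := by
  rw [(RawForm.inChart_pullback_eventuallyEq hf he he' α hz).extDeriv_eq]
  have h1 : ContDiffAt ℝ ∞ (inCharts f e e') z :=
    (contDiffOn_inCharts hf he he').contDiffAt
      ((isOpen_chartDomain hf.continuous e e').mem_nhds hz)
  have h2 : ContDiffAt ℝ ∞ (α.inChart e') (inCharts f e e' z) :=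
    (hα _ he').contDiffAt (e'.open_target.mem_nhds (e'.map_source hz.2))
  exact extDeriv_pullback (h2.differentiableAt (by simp)) h1
    (by simpa using WithTop.coe_le_coe.2 (le_top (a := (2 : ℕ∞))))

/-- The exterior derivative is computed by every chart of the atlas, not only by the preferred
chart at the point. -/
theorem RawForm.inChart_d {e : OpenPartialHomeomorph M E} (he : e ∈ atlas E M) {k : ℕ}
    {α : RawForm E M k} (hα : α ∈ smoothForms E M k) {z : E} (hz : z ∈ e.target) :
    α.d.inChart e z = extDeriv (α.inChart e) z := by
  have he' := chart_mem_atlas E (e.symm z)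
  have hz' : z ∈ chartDomain (id : M → M) e (chartAt E (e.symm z)) :=
    ⟨hz, mem_chart_source _ _⟩
  have h := RawForm.extDeriv_inChart_pullback contMDiff_id he he' hα hz'
  rw [RawForm.pullback_id, fderiv_inCharts contMDiff_id he he' hz', rawDeriv_id] at h
  rw [h]
  rfl

theorem RawForm.d_pullback {f : M → N} (hf : ContMDiff 𝓘(ℝ, E) 𝓘(ℝ, F) ∞ f)
    {k : ℕ} {α : RawForm F N k} (hα : α ∈ smoothForms F N k) :
    (RawForm.pullback f α : RawForm E M k).d = RawForm.pullback f α.d := by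
  funext x
  have he := chart_mem_atlas E x
  have he' := chart_mem_atlas F (f x)
  have hx : (chartAt E x).symm (chartAt E x x) = x := (chartAt E x).left_inv (mem_chart_source E x)
  have hz : chartAt E x x ∈ chartDomain f (chartAt E x) (chartAt F (f x)) :=
    ⟨mem_chart_target E x, by
      change f ((chartAt E x).symm (chartAt E x x)) ∈ (chartAt F (f x)).source
      rw [hx]; exact mem_chart_source _ _⟩
  have h := RawForm.extDeriv_inChart_pullback hf he he' hα hz
  rw [fderiv_inCharts hf he he' hz] at h
  have h2 := rawDeriv_symm_comp he (mem_chart_source E x)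
  change (extDeriv ((RawForm.pullback f α : RawForm E M k).inChart (chartAt E x))
    (chartAt E x x)).compContinuousLinearMap (rawDeriv (E := E) (F := E) (chartAt E x) x) =
    ((extDeriv (α.inChart (chartAt F (f x))) (chartAt F (f x) (f x))).compContinuousLinearMap
      (rawDeriv (E := F) (F := F) (chartAt F (f x)) (f x))).compContinuousLinearMap
      (rawDeriv (E := E) (F := F) f x)
  rw [h, inCharts, hx]
  ext v
  simp only [ContinuousAlternatingMap.compContinuousLinearMap_apply]
  congr 1
  funext i
  exact congrArg (fun w => rawDeriv (E := F) (F := F) (chartAt F (f x)) (f x)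
    (rawDeriv (E := E) (F := F) f x w)) (DFunLike.congr_fun h2 (v i))

theorem RawForm.pullback_mem_closedForms {f : M → N} (hf : ContMDiff 𝓘(ℝ, E) 𝓘(ℝ, F) ∞ f)
    {k : ℕ} (α : RawForm F N k) (hα : α ∈ closedForms F N k) :
    RawForm.pullback f α ∈ closedForms E M k :=
  ⟨RawForm.pullback_mem_smoothForms hf hα.1, by rw [RawForm.d_pullback hf hα.1, hα.2, map_zero]⟩

/-- The induced map on second de Rham cohomology. -/
def DeRhamH2.map {f : M → N} (hf : ContMDiff 𝓘(ℝ, E) 𝓘(ℝ, F) ∞ f) :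
    DeRhamH2 F N →ₗ[ℝ] DeRhamH2 E M :=
  Submodule.mapQ _ _ ((RawForm.pullback f).restrict (RawForm.pullback_mem_closedForms hf))
    fun α hα => by
      obtain ⟨b, hb⟩ : (α : RawForm F N 2) ∈ exactForms F N 1 := hα
      refine ⟨⟨RawForm.pullback f (b : RawForm F N 1),
        RawForm.pullback_mem_smoothForms hf b.2⟩, ?_⟩
      have h := RawForm.d_pullback (E := E) (M := M) hf b.2
      exact h.trans (congrArg (RawForm.pullback f) hb)

theorem RawForm.pullback_mem_eigenForms {𝒥 : AlmostComplexStructure E M}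
    {𝒥' : AlmostComplexStructure F N} {f : M → N} (hf : IsPseudoholomorphic 𝒥 𝒥' f) {s : ℝ}
    {α : RawForm F N 2} (hα : α ∈ eigenForms 𝒥' s) : RawForm.pullback f α ∈ eigenForms 𝒥 s := by
  intro x v w
  have h := hα (f x) (mfderiv 𝓘(ℝ, E) 𝓘(ℝ, F) f x v) (mfderiv 𝓘(ℝ, E) 𝓘(ℝ, F) f x w)
  rw [← hf.2 x v, ← hf.2 x w] at h
  have e : ∀ v w : TangentSpace 𝓘(ℝ, E) x, (RawForm.pullback f α : RawForm E M 2) x ![v, w] =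
      α (f x) ![mfderiv 𝓘(ℝ, E) 𝓘(ℝ, F) f x v, mfderiv 𝓘(ℝ, E) 𝓘(ℝ, F) f x w] := by
    intro v w
    change α (f x) (_ ∘ ![v, w]) = _
    congr 1
    funext i
    fin_cases i <;> rfl
  rw [e, e, h]

/-- If pulling back along a pseudoholomorphic map detects exactness, it embeds the
`±`-cohomology. -/
theorem rank_map_eigenForms_le {𝒥 : AlmostComplexStructure E M}
    {𝒥' : AlmostComplexStructure F N} {f : M → N} (hf : IsPseudoholomorphic 𝒥 𝒥' f)
    (hinj : ∀ α ∈ closedForms F N 2, ∀ β ∈ smoothForms E M 1,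
      RawForm.d β = RawForm.pullback f α → α ∈ exactForms F N 1) (s : ℝ) :
    Cardinal.toENat (Module.rank ℝ (((eigenForms 𝒥' s).submoduleOf (closedForms F N 2)).map
      (Submodule.mkQ ((exactForms F N 1).submoduleOf (closedForms F N 2))))) ≤
    Cardinal.toENat (Module.rank ℝ (((eigenForms 𝒥 s).submoduleOf (closedForms E M 2)).map
      (Submodule.mkQ ((exactForms E M 1).submoduleOf (closedForms E M 2))))) := by
  have hinj' : Function.Injective (DeRhamH2.map (E := E) hf.1) := by
    refine (injective_iff_map_eq_zero _).2 fun a ha => ?_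
    induction a using Submodule.Quotient.induction_on with
    | H α =>
      obtain ⟨β, hβ⟩ := (Submodule.Quotient.mk_eq_zero _).1 ha
      exact (Submodule.Quotient.mk_eq_zero _).2 (hinj α α.2 β β.2 hβ)
  have hmap : ∀ a ∈ ((eigenForms 𝒥' s).submoduleOf (closedForms F N 2)).map
      (Submodule.mkQ ((exactForms F N 1).submoduleOf (closedForms F N 2))),
      DeRhamH2.map hf.1 a ∈ ((eigenForms 𝒥 s).submoduleOf (closedForms E M 2)).map
      (Submodule.mkQ ((exactForms E M 1).submoduleOf (closedForms E M 2))) := by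
    rintro _ ⟨α, hα, rfl⟩
    exact ⟨⟨RawForm.pullback f α, RawForm.pullback_mem_closedForms hf.1 _ α.2⟩,
      RawForm.pullback_mem_eigenForms hf hα, rfl⟩
  have h := LinearMap.lift_rank_le_of_injective ((DeRhamH2.map (E := E) hf.1).restrict hmap)
    fun a b hab => Subtype.ext (hinj' (congrArg Subtype.val hab))
  simpa using Cardinal.toENat.monotone' h

end FormPullback

/-! ### Linear complex structures and orientation signs -/

section ComplexStructure

/-- The complex vector space structure defined by `J² = -1`. -/
abbrev complexModule {V : Type*} [AddCommGroup V] [Module ℝ V] (J : V →ₗ[ℝ] V)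
    (hJ : ∀ v, J (J v) = -v) : Module ℂ V :=
  Module.compHom V (Complex.lift ⟨(J : Module.End ℝ V), LinearMap.ext hJ⟩).toRingHom

theorem complexModule_smul {V : Type*} [AddCommGroup V] [Module ℝ V] (J : V →ₗ[ℝ] V)
    (hJ : ∀ v, J (J v) = -v) (z : ℂ) (v : V) :
    let _ := complexModule J hJ
    z • v = z.re • v + z.im • J v := by
  change (Complex.lift ⟨(J : Module.End ℝ V), LinearMap.ext hJ⟩ z) v = _
  simp [Complex.lift, Complex.liftAux_apply, Module.algebraMap_end_apply]

theorem complexModule_isScalarTower {V : Type*} [AddCommGroup V] [Module ℝ V] (J : V →ₗ[ℝ] V)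
    (hJ : ∀ v, J (J v) = -v) :
    let _ := complexModule J hJ
    IsScalarTower ℝ ℂ V := by
  let _ := complexModule J hJ
  refine ⟨fun r z v => ?_⟩
  rw [complexModule_smul, complexModule_smul]
  simp [smul_smul]

/-- A real linear map that commutes with a complex structure has non-negative determinant: it is
the square of the modulus of the complex determinant. -/
theorem det_nonneg_of_commute {V : Type*} [AddCommGroup V] [Module ℝ V] [FiniteDimensional ℝ V]
    (J A : V →ₗ[ℝ] V) (hJ : ∀ v, J (J v) = -v) (h : ∀ v, A (J v) = J (A v)) :
    0 ≤ LinearMap.det A := by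
  let _ := complexModule J hJ
  have := complexModule_isScalarTower J hJ
  have : FiniteDimensional ℂ V := FiniteDimensional.right ℝ ℂ V
  let A' : V →ₗ[ℂ] V :=
    { A with
      map_smul' := fun z v => by
        change A (z • v) = z • A v
        rw [complexModule_smul, complexModule_smul, map_add, map_smul, map_smul, h] }
  have e : A = A'.restrictScalars ℝ := rfl
  rw [e, LinearMap.det_restrictScalars]
  change 0 ≤ Algebra.norm ℝ (LinearMap.det A')
  rw [Algebra.norm_complex_apply]
  exact Complex.normSq_nonneg _

/-- Two complex structures on real vector spaces of the same dimension are conjugate. -/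
theorem exists_intertwiner {V W : Type*} [AddCommGroup V] [Module ℝ V] [FiniteDimensional ℝ V]
    [AddCommGroup W] [Module ℝ W] [FiniteDimensional ℝ W]
    (h : Module.finrank ℝ V = Module.finrank ℝ W) (J : V →ₗ[ℝ] V) (hJ : ∀ v, J (J v) = -v)
    (J' : W →ₗ[ℝ] W) (hJ' : ∀ v, J' (J' v) = -v) :
    ∃ P : V ≃ₗ[ℝ] W, ∀ v, P (J v) = J' (P v) := by
  let _ := complexModule J hJ
  have := complexModule_isScalarTower J hJ
  have : FiniteDimensional ℂ V := FiniteDimensional.right ℝ ℂ V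
  let _ := complexModule J' hJ'
  have := complexModule_isScalarTower J' hJ'
  have : FiniteDimensional ℂ W := FiniteDimensional.right ℝ ℂ W
  have h1 : Module.finrank ℂ V = Module.finrank ℂ W := by
    have a := Module.finrank_mul_finrank ℝ ℂ V
    have b := Module.finrank_mul_finrank ℝ ℂ W
    rw [Complex.finrank_real_complex] at a b
    omega
  let P := LinearEquiv.ofFinrankEq V W h1
  refine ⟨P.restrictScalars ℝ, fun v => ?_⟩
  have e := P.map_smul Complex.I v
  rw [complexModule_smul, complexModule_smul] at e
  simpa using e

variable {E : Type*} [NormedAddCommGroup E] [NormedSpace ℝ E] [FiniteDimensional ℝ E]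

/-- A complex structure on `E`. -/
def IsComplexStructure (J : E →L[ℝ] E) : Prop := ∀ v, J (J v) = -v

/-- The sign that compares the orientations of `E` defined by two complex structures: the sign of
the determinant of an isomorphism that intertwines them, which always exists; the value `1` in the
other case is a convention. -/
def relSign (J J' : E →L[ℝ] E) : ℝ :=
  open Classical in
  if h : ∃ P : E →L[ℝ] E, P.det ≠ 0 ∧ ∀ v, P (J v) = J' (P v) then
    SignType.sign (Classical.choose h).det else 1

theorem exists_isUnit_intertwiner {J J' : E →L[ℝ] E} (hJ : IsComplexStructure J)
    (hJ' : IsComplexStructure J') : ∃ P : E →L[ℝ] E, P.det ≠ 0 ∧ ∀ v, P (J v) = J' (P v) := by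
  obtain ⟨P, hP⟩ := exists_intertwiner rfl (J : E →ₗ[ℝ] E) hJ (J' : E →ₗ[ℝ] E) hJ'
  exact ⟨P.toContinuousLinearEquiv, P.isUnit_det'.ne_zero, hP⟩

omit [FiniteDimensional ℝ E] in
theorem ContinuousLinearMap.det_comp (A B : E →L[ℝ] E) : (A.comp B).det = A.det * B.det :=
  LinearMap.det_comp _ _

/-- Intertwiners of the same pair of complex structures have determinants of the same sign. -/
theorem det_mul_det_nonneg {J J' : E →L[ℝ] E} (hJ : IsComplexStructure J)
    {A B : E →L[ℝ] E} (hA : ∀ v, A (J v) = J' (A v)) (hB : ∀ v, B (J v) = J' (B v)) :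
    0 ≤ A.det * B.det := by
  rcases eq_or_ne B.det 0 with h0 | h0
  · rw [h0, mul_zero]
  · let B' := B.toContinuousLinearEquivOfDetNeZero h0
    have hB' : ∀ v, B (B'.symm v) = v := B'.apply_symm_apply
    have hB'' : ∀ v, B'.symm (B v) = v := B'.symm_apply_apply
    have hc : ∀ v, B'.symm (A (J v)) = J (B'.symm (A v)) := by
      intro v
      rw [hA, ← hB'' (J (B'.symm (A v))), hB, hB']
    have h1 := det_nonneg_of_commute (J : E →ₗ[ℝ] E)
      (((B'.symm : E →L[ℝ] E).comp A : E →L[ℝ] E) : E →ₗ[ℝ] E) hJ hc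
    have h2 : A.det = B.det * ((B'.symm : E →L[ℝ] E).comp A).det := by
      rw [← ContinuousLinearMap.det_comp]
      congr 1
      ext v
      exact (hB' _).symm
    rw [h2, mul_right_comm]
    exact mul_nonneg (mul_self_nonneg _) h1

theorem relSign_mul_det {J J' : E →L[ℝ] E} (hJ : IsComplexStructure J)
    (hJ' : IsComplexStructure J') {A : E →L[ℝ] E} (hA : ∀ v, A (J v) = J' (A v)) :
    relSign J J' * A.det = |A.det| := by
  have hex := exists_isUnit_intertwiner hJ hJ'
  rw [relSign, dif_pos hex]
  obtain ⟨h0, hP⟩ := Classical.choose_spec hex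
  have h := det_mul_det_nonneg hJ hA hP
  rcases lt_or_gt_of_ne h0 with h1 | h1
  · rw [sign_neg h1, abs_of_nonpos (nonpos_of_mul_nonneg_left h h1)]
    simp
  · rw [sign_pos h1, abs_of_nonneg (nonneg_of_mul_nonneg_left h h1)]
    simp

theorem relSign_eq_of_det_pos {J₁ J₁' J₂ J₂' : E →L[ℝ] E} (hJ₁ : IsComplexStructure J₁)
    (hJ₁' : IsComplexStructure J₁') (hJ₂ : IsComplexStructure J₂) (hJ₂' : IsComplexStructure J₂')
    {P Q : E →L[ℝ] E} (hP : ∀ v, P (J₁ v) = J₂ (P v)) (hQ : ∀ v, Q (J₂' v) = J₁' (Q v))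
    (hPQ : 0 < Q.det * P.det) : relSign J₁ J₁' = relSign J₂ J₂' := by
  obtain ⟨A, h0, hA⟩ := exists_isUnit_intertwiner hJ₂ hJ₂'
  have h1 := relSign_mul_det hJ₂ hJ₂' hA
  have h2 := relSign_mul_det hJ₁ hJ₁' (A := Q.comp (A.comp P)) fun v => by
    simp [hP, hA, hQ]
  rw [ContinuousLinearMap.det_comp, ContinuousLinearMap.det_comp,
    show Q.det * (A.det * P.det) = A.det * (Q.det * P.det) by ring, abs_mul, abs_of_pos hPQ,
    ← mul_assoc] at h2
  exact mul_right_cancel₀ h0 ((mul_right_cancel₀ hPQ.ne' h2).trans h1.symm)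

/-- Pulling back along isomorphisms changes the relative sign by the signs of the determinants;
the rule is stated after clearing the determinants. -/
theorem relSign_mul_abs_det {J₁ J₁' J₂ J₂' : E →L[ℝ] E} (hJ₁ : IsComplexStructure J₁)
    (hJ₁' : IsComplexStructure J₁') (hJ₂ : IsComplexStructure J₂) (hJ₂' : IsComplexStructure J₂')
    {P Q : E →L[ℝ] E} (hP : ∀ v, P (J₁ v) = J₂ (P v)) (hQ : ∀ v, Q (J₂' v) = J₁' (Q v)) :
    relSign J₂ J₂' * |Q.det| * |P.det| = relSign J₁ J₁' * (Q.det * P.det) := by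
  obtain ⟨A, h0, hA⟩ := exists_isUnit_intertwiner hJ₂ hJ₂'
  have h1 := relSign_mul_det hJ₂ hJ₂' hA
  have h2 := relSign_mul_det hJ₁ hJ₁' (A := Q.comp (A.comp P)) fun v => by
    simp [hP, hA, hQ]
  rw [ContinuousLinearMap.det_comp, ContinuousLinearMap.det_comp, abs_mul, abs_mul, ← h1] at h2
  refine mul_right_cancel₀ h0 ?_
  linear_combination -h2

open Filter Topology in
/-- The relative sign is locally constant on complex structures. -/
theorem eventually_relSign_eq {X : Type*} {l : Filter X} {a b : X → E →L[ℝ] E} {J J' : E →L[ℝ] E}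
    (ha : Tendsto a l (𝓝 J)) (hb : Tendsto b l (𝓝 J')) (hJ : IsComplexStructure J)
    (hJ' : IsComplexStructure J') (ha' : ∀ᶠ x in l, IsComplexStructure (a x))
    (hb' : ∀ᶠ x in l, IsComplexStructure (b x)) :
    ∀ᶠ x in l, relSign (a x) (b x) = relSign J J' := by
  -- `(1 - J₂ J₁) / 2` intertwines `J₁` with `J₂` and is close to `1` when they are close.
  let P : (E →L[ℝ] E) → (E →L[ℝ] E) → E →L[ℝ] E := fun J₁ J₂ => .id ℝ E - J₂.comp J₁
  have hP : ∀ J₁ J₂ : E →L[ℝ] E, IsComplexStructure J₁ → IsComplexStructure J₂ →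
      ∀ v, P J₁ J₂ (J₁ v) = J₂ (P J₁ J₂ v) := by
    intro J₁ J₂ h1 h2 v
    simp only [P, sub_apply, ContinuousLinearMap.comp_apply,
      ContinuousLinearMap.id_apply, h1 v, map_sub, map_neg, h2 (J₁ v)]
    abel
  have hPJ : ∀ J₁ : E →L[ℝ] E, IsComplexStructure J₁ → (P J₁ J₁).det ≠ 0 := by
    intro J₁ h1
    have e : P J₁ J₁ = (2 : ℝ) • .id ℝ E := by
      ext v
      change v - J₁ (J₁ v) = (2 : ℝ) • v
      rw [h1 v, two_smul, sub_neg_eq_add]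
    rw [e, ContinuousLinearMap.det]
    simp
  have hpos : ∀ J₁ : E →L[ℝ] E, IsComplexStructure J₁ → 0 < (P J₁ J₁).det := by
    intro J₁ h1
    refine lt_of_le_of_ne ?_ (hPJ J₁ h1).symm
    exact det_nonneg_of_commute (J₁ : E →ₗ[ℝ] E) (P J₁ J₁ : E →ₗ[ℝ] E) h1 (hP J₁ J₁ h1 h1)
  have hcont : Continuous fun p : (E →L[ℝ] E) × (E →L[ℝ] E) => (P p.1 p.2).det := by
    refine ContinuousLinearMap.continuous_det.comp ?_
    exact continuous_const.sub (continuous_snd.clm_comp continuous_fst)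
  have h1 : ∀ᶠ x in l, 0 < (P (a x) J).det :=
    ((hcont.tendsto (J, J)).comp (ha.prodMk_nhds tendsto_const_nhds)).eventually
      (lt_mem_nhds (hpos J hJ))
  have h2 : ∀ᶠ x in l, 0 < (P J' (b x)).det :=
    ((hcont.tendsto (J', J')).comp (tendsto_const_nhds.prodMk_nhds hb)).eventually
      (lt_mem_nhds (hpos J' hJ'))
  filter_upwards [h1, h2, ha', hb'] with x h1 h2 ha' hb'
  exact relSign_eq_of_det_pos ha' hb' hJ hJ' (hP _ _ ha' hJ) (hP _ _ hJ' hb') (mul_pos h2 h1)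

end ComplexStructure

/-! ### Jacobian determinants as null Lagrangians -/

section NullLagrangian

open MeasureTheory Filter Topology

/-- The model space `ℝᵐ`. -/
abbrev Euc (m : ℕ) : Type := EuclideanSpace ℝ (Fin m)

variable {m : ℕ}

/-- The standard basis vectors. -/
def bv (k : Fin m) : Euc m := EuclideanSpace.single k (1 : ℝ)

theorem bv_apply (k l : Fin m) : bv k l = if l = k then (1 : ℝ) else 0 := by
  simp [bv]

theorem sum_smul_bv (v : Euc m) : ∑ k, v k • bv k = v := by
  ext l
  simp [bv_apply]

/-- The determinant as a function of the rows of a matrix. -/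
def rowDet (m : ℕ) : ContinuousMultilinearMap ℝ (fun _ : Fin m => Fin m → ℝ) ℝ where
  toMultilinearMap := (Matrix.detRowAlternating (R := ℝ) (n := Fin m)).toMultilinearMap
  cont := Continuous.matrix_det (A := fun x : Matrix (Fin m) (Fin m) ℝ => x) continuous_id

theorem rowDet_apply (B : Fin m → Fin m → ℝ) : rowDet m B = Matrix.det (Matrix.of B) := rfl

theorem rowDet_eq_zero {B : Fin m → Fin m → ℝ} {i j : Fin m} (hij : i ≠ j) (h : B i = B j) :
    rowDet m B = 0 := Matrix.det_zero_of_row_eq hij h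

theorem rowDet_update_update_self {i j : Fin m} (hij : i ≠ j) (B : Fin m → Fin m → ℝ)
    (x : Fin m → ℝ) : rowDet m (Function.update (Function.update B i x) j x) = 0 :=
  rowDet_eq_zero hij (by simp [Function.update_of_ne hij])

theorem rowDet_update_update_swap {i j : Fin m} (hij : i ≠ j) (B : Fin m → Fin m → ℝ)
    (x y : Fin m → ℝ) : rowDet m (Function.update (Function.update B i x) j y) =
      -rowDet m (Function.update (Function.update B i y) j x) := by
  have h := rowDet_update_update_self hij B (x + y)
  rw [ContinuousMultilinearMap.map_update_add, Function.update_comm hij,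
    ContinuousMultilinearMap.map_update_add, Function.update_comm hij,
    ContinuousMultilinearMap.map_update_add] at h
  rw [Function.update_comm hij.symm, Function.update_comm hij.symm,
    Function.update_comm hij.symm, Function.update_comm hij.symm,
    rowDet_update_update_self hij, rowDet_update_update_self hij] at h
  linarith

theorem rowDet_update_eq_sum (B : Fin m → Fin m → ℝ) (i : Fin m) (x : Fin m → ℝ) :
    rowDet m (Function.update B i x) =
      ∑ k, x k * rowDet m (Function.update B i (Pi.single k 1)) := by
  have h : x = ∑ k, x k • (Pi.single k 1 : Fin m → ℝ) := by
    ext l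
    simp [Pi.single_apply]
  change (rowDet m).toContinuousLinearMap B i x = _
  conv_lhs => rw [h, map_sum]
  refine Finset.sum_congr rfl fun k _ => ?_
  rw [map_smul, smul_eq_mul]
  rfl

/-- The rows of the Jacobian matrix of a map. -/
def jacRows (σ : Euc m → Euc m) (z : Euc m) : Fin m → Fin m → ℝ := fun p k =>
  fderiv ℝ σ z (bv k) p

/-- The components of the gradient of a function. -/
def gradRow (u : Euc m → ℝ) (z : Euc m) : Fin m → ℝ := fun k => fderiv ℝ u z (bv k)

theorem rowDet_jacRows (σ : Euc m → Euc m) (z : Euc m) :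
    rowDet m (jacRows σ z) = (fderiv ℝ σ z).det := by
  rw [ContinuousLinearMap.det, ← LinearMap.det_toMatrix (EuclideanSpace.basisFun (Fin m) ℝ).toBasis,
    rowDet_apply]
  congr 1

theorem contDiffOn_jacRows {σ : Euc m → Euc m} {U : Set (Euc m)} (hU : IsOpen U)
    (hσ : ContDiffOn ℝ ∞ σ U) : ContDiffOn ℝ ∞ (jacRows σ) U := by
  have h : ContDiffOn ℝ ∞ (fderiv ℝ σ) U := hσ.fderiv_of_isOpen hU (by simp)
  refine contDiffOn_pi.2 fun p => contDiffOn_pi.2 fun k => ?_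
  exact (EuclideanSpace.proj (𝕜 := ℝ) p).contDiff.comp_contDiffOn (h.clm_apply contDiffOn_const)

/-- Piola's identity: the rows of the cofactor matrix of a Jacobian are divergence free. -/
theorem sum_fderiv_cofactor_eq_zero {σ : Euc m → Euc m} {z : Euc m} (hσ : ContDiffAt ℝ ∞ σ z)
    (i : Fin m) :
    ∑ k, fderiv ℝ (fun y => rowDet m (Function.update (jacRows σ y) i (Pi.single k 1))) z (bv k)
      = 0 := by
  have hd : DifferentiableAt ℝ (fderiv ℝ σ) z :=
    (hσ.fderiv_right (m := ∞) (by simp)).differentiableAt (by simp)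
  have hsymm : ∀ k l, fderiv ℝ (fderiv ℝ σ) z (bv k) (bv l) =
      fderiv ℝ (fderiv ℝ σ) z (bv l) (bv k) := fun k l =>
    (hσ.isSymmSndFDerivAt (by simpa using WithTop.coe_le_coe.2 (le_top (a := (2 : ℕ∞))))) _ _
  have hrow : ∀ j l, HasFDerivAt (fun y => jacRows σ y j l)
      ((EuclideanSpace.proj (𝕜 := ℝ) j).comp
        ((ContinuousLinearMap.apply ℝ (Euc m) (bv l)).comp (fderiv ℝ (fderiv ℝ σ) z))) z := by
    intro j l
    exact (EuclideanSpace.proj (𝕜 := ℝ) j).hasFDerivAt.comp z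
      ((ContinuousLinearMap.apply ℝ (Euc m) (bv l)).hasFDerivAt.comp z hd.hasFDerivAt)
  have hupd : ∀ k, HasFDerivAt (fun y => Function.update (jacRows σ y) i (Pi.single k 1))
      (ContinuousLinearMap.pi fun j => if j = i then 0 else ContinuousLinearMap.pi fun l =>
        (EuclideanSpace.proj (𝕜 := ℝ) j).comp
          ((ContinuousLinearMap.apply ℝ (Euc m) (bv l)).comp (fderiv ℝ (fderiv ℝ σ) z))) z := by
    intro k
    refine hasFDerivAt_pi.2 fun j => ?_
    by_cases hj : j = i
    · subst hj
      simpa using hasFDerivAt_const (𝕜 := ℝ) (Pi.single k (1 : ℝ) : Fin m → ℝ) z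
    · simp only [Function.update_of_ne hj, if_neg hj]
      exact hasFDerivAt_pi.2 fun l => hrow j l
  have hder : ∀ k, fderiv ℝ (fun y => rowDet m (Function.update (jacRows σ y) i (Pi.single k 1)))
      z (bv k) = ∑ j ∈ Finset.univ.erase i, ∑ l, fderiv ℝ (fderiv ℝ σ) z (bv k) (bv l) j *
        rowDet m (Function.update (Function.update (jacRows σ z) i (Pi.single k 1)) j
          (Pi.single l 1)) := by
    intro k
    have h := ((rowDet m).hasFDerivAt (Function.update (jacRows σ z) i (Pi.single k 1))).comp z
      (hupd k)
    rw [show (fun y => rowDet m (Function.update (jacRows σ y) i (Pi.single k 1))) =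
      rowDet m ∘ fun y => Function.update (jacRows σ y) i (Pi.single k 1) from rfl, h.fderiv,
      ContinuousLinearMap.comp_apply, ContinuousMultilinearMap.linearDeriv_apply,
      ← Finset.add_sum_erase _ _ (Finset.mem_univ i)]
    have h0 : ∀ B : Fin m → Fin m → ℝ, rowDet m (Function.update B i 0) = 0 := fun B =>
      ContinuousMultilinearMap.map_coord_zero _ i (by simp)
    simp only [ContinuousLinearMap.coe_pi', if_true, zero_apply, h0, zero_add]
    refine Finset.sum_congr rfl fun j hj => ?_
    simp only [if_neg (Finset.ne_of_mem_erase hj)]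
    rw [rowDet_update_eq_sum]
    rfl
  simp_rw [hder]
  rw [Finset.sum_comm]
  refine Finset.sum_eq_zero fun j hj => ?_
  have hij : i ≠ j := (Finset.ne_of_mem_erase hj).symm
  -- A symmetric array is summed against an antisymmetric one.
  have hanti : ∑ k, ∑ l, fderiv ℝ (fderiv ℝ σ) z (bv k) (bv l) j *
      rowDet m (Function.update (Function.update (jacRows σ z) i (Pi.single k 1)) j
        (Pi.single l 1)) = -∑ k, ∑ l, fderiv ℝ (fderiv ℝ σ) z (bv k) (bv l) j *
      rowDet m (Function.update (Function.update (jacRows σ z) i (Pi.single k 1)) j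
        (Pi.single l 1)) := by
    conv_lhs => rw [Finset.sum_comm]
    simp_rw [← Finset.sum_neg_distrib]
    refine Finset.sum_congr rfl fun k _ => Finset.sum_congr rfl fun l _ => ?_
    rw [hsymm l k, rowDet_update_update_swap hij, mul_neg]
  linarith

theorem contDiff_mul_of_tsupport_subset {E : Type*} [NormedAddCommGroup E] [NormedSpace ℝ E]
    {u g : E → ℝ} {U : Set E} (hU : IsOpen U)
    (hu : ContDiff ℝ ∞ u) (hs : tsupport u ⊆ U) (hg : ContDiffOn ℝ ∞ g U) :
    ContDiff ℝ ∞ fun z => u z * g z := by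
  refine contDiff_iff_contDiffAt.2 fun z => ?_
  by_cases hz : z ∈ U
  · exact hu.contDiffAt.mul (hg.contDiffAt (hU.mem_nhds hz))
  · have h : (fun z => u z * g z) =ᶠ[𝓝 z] fun _ => 0 := by
      filter_upwards [notMem_tsupport_iff_eventuallyEq.1 fun h => hz (hs h)] with y hy
      simp [hy]
    exact contDiffAt_const.congr_of_eventuallyEq h

theorem integral_fderiv_eq_zero {E : Type*} [NormedAddCommGroup E] [NormedSpace ℝ E]
    [FiniteDimensional ℝ E] [MeasurableSpace E] [BorelSpace E] (μ : Measure E)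
    [μ.IsAddHaarMeasure] {f : E → ℝ} (hf : ContDiff ℝ 1 f)
    (hc : HasCompactSupport f) (v : E) : ∫ x, fderiv ℝ f x v ∂μ = 0 := by
  have h1 : Integrable (fun x => fderiv ℝ f x v) μ :=
    ((hf.continuous_fderiv_apply one_ne_zero).comp
      (continuous_id.prodMk continuous_const)).integrable_of_hasCompactSupport
      (hc.fderiv_apply ℝ v)
  have h := integral_mul_fderiv_eq_neg_fderiv_mul_of_integrable (μ := μ) (f := fun _ : E => (1 : ℝ))
    (g := f) (v := v) (by simp) (by simpa using h1)
    (by simpa using hf.continuous.integrable_of_hasCompactSupport hc)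
    (fun _ _ => differentiableAt_const _) (fun _ _ => (hf.differentiable one_ne_zero) _)
  simpa using h

theorem integrable_fderiv {E : Type*} [NormedAddCommGroup E] [NormedSpace ℝ E]
    [MeasurableSpace E] [BorelSpace E] (μ : Measure E)
    [IsFiniteMeasureOnCompacts μ] {f : E → ℝ} (hf : ContDiff ℝ 1 f)
    (hc : HasCompactSupport f) (v : E) : Integrable (fun x => fderiv ℝ f x v) μ :=
  ((hf.continuous_fderiv_apply one_ne_zero).comp
    (continuous_id.prodMk continuous_const)).integrable_of_hasCompactSupport
    (hc.fderiv_apply ℝ v)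

theorem gradRow_eq_zero {u : Euc m → ℝ} {z : Euc m} (hz : z ∉ tsupport u) : gradRow u z = 0 := by
  have h : fderiv ℝ u z = 0 := by
    rw [(notMem_tsupport_iff_eventuallyEq.1 hz).fderiv_eq]
    exact fderiv_const_apply (0 : ℝ)
  ext k
  simp [gradRow, h]

/-- The divergence of a multiple of a row of the cofactor matrix of a Jacobian. -/
theorem sum_fderiv_mul_cofactor {σ : Euc m → Euc m} {u : Euc m → ℝ} {z : Euc m}
    (hσ : ContDiffAt ℝ ∞ σ z) (hu : DifferentiableAt ℝ u z) (i : Fin m) :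
    ∑ k, fderiv ℝ (fun y => u y * rowDet m (Function.update (jacRows σ y) i (Pi.single k 1))) z
      (bv k) = rowDet m (Function.update (jacRows σ z) i (gradRow u z)) := by
  have hd : ∀ k, DifferentiableAt ℝ
      (fun y => rowDet m (Function.update (jacRows σ y) i (Pi.single k 1))) z := by
    intro k
    have hj : DifferentiableAt ℝ (jacRows σ) z := by
      refine differentiableAt_pi.2 fun p => differentiableAt_pi.2 fun k => ?_
      exact ((EuclideanSpace.proj (𝕜 := ℝ) p).differentiableAt).comp z
        (((hσ.fderiv_right (m := ∞) (by simp)).differentiableAt (by simp)).clm_apply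
          (differentiableAt_const _))
    refine ((rowDet m).hasFDerivAt _).differentiableAt.comp z (differentiableAt_pi.2 fun j => ?_)
    by_cases h : j = i
    · subst h; simp
    · simpa [Function.update_of_ne h] using differentiableAt_pi.1 hj j
  have h1 : ∀ k, fderiv ℝ
      (fun y => u y * rowDet m (Function.update (jacRows σ y) i (Pi.single k 1))) z (bv k) =
      u z * fderiv ℝ (fun y => rowDet m (Function.update (jacRows σ y) i (Pi.single k 1))) z (bv k)
        + gradRow u z k * rowDet m (Function.update (jacRows σ z) i (Pi.single k 1)) := by
    intro k
    rw [fderiv_fun_mul hu (hd k)]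
    simp [gradRow, mul_comm]
  simp_rw [h1]
  rw [Finset.sum_add_distrib, ← Finset.mul_sum, sum_fderiv_cofactor_eq_zero hσ, mul_zero, zero_add,
    ← rowDet_update_eq_sum]

/-- A Jacobian determinant integrates to zero if one component of the map has compact support. -/
theorem integral_rowDet_update_gradRow {σ : Euc m → Euc m} {u : Euc m → ℝ} {U : Set (Euc m)}
    (hU : IsOpen U) (hσ : ContDiffOn ℝ ∞ σ U) (hu : ContDiff ℝ ∞ u) (hc : HasCompactSupport u)
    (hs : tsupport u ⊆ U) (i : Fin m) :
    Integrable (fun z => rowDet m (Function.update (jacRows σ z) i (gradRow u z))) ∧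
      ∫ z, rowDet m (Function.update (jacRows σ z) i (gradRow u z)) = 0 := by
  set Y : Fin m → Euc m → ℝ := fun k y =>
    u y * rowDet m (Function.update (jacRows σ y) i (Pi.single k 1)) with hY
  have hYs : ∀ k, ContDiff ℝ ∞ (Y k) := by
    intro k
    refine contDiff_mul_of_tsupport_subset hU hu hs ?_
    refine (rowDet m).contDiff.comp_contDiffOn (contDiffOn_pi.2 fun j => ?_)
    by_cases h : j = i
    · subst h; simpa using contDiffOn_const
    · simpa [Function.update_of_ne h] using contDiffOn_pi.1 (contDiffOn_jacRows hU hσ) j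
  have hYc : ∀ k, HasCompactSupport (Y k) := fun k => hc.mul_right
  have hsum : (fun z => rowDet m (Function.update (jacRows σ z) i (gradRow u z))) =
      fun z => ∑ k, fderiv ℝ (Y k) z (bv k) := by
    funext z
    by_cases hz : z ∈ U
    · exact (sum_fderiv_mul_cofactor (hσ.contDiffAt (hU.mem_nhds hz))
        (hu.differentiable (by simp) z) i).symm
    · have hz' : z ∉ tsupport u := fun h => hz (hs h)
      rw [gradRow_eq_zero hz', ContinuousMultilinearMap.map_coord_zero _ i (by simp)]
      refine (Finset.sum_eq_zero fun k _ => ?_).symm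
      have h : Y k =ᶠ[𝓝 z] fun _ => 0 := by
        filter_upwards [notMem_tsupport_iff_eventuallyEq.1 hz'] with y hy
        simp [Y, hy]
      rw [h.fderiv_eq, fderiv_const_apply]
      rfl
  have h1 : ∀ k, ContDiff ℝ 1 (Y k) := fun k => (hYs k).of_le (by simp)
  rw [hsum]
  refine ⟨integrable_finsetSum _ fun k _ => integrable_fderiv _ (h1 k) (hYc k) _, ?_⟩
  rw [integral_finsetSum _ fun k _ => integrable_fderiv _ (h1 k) (hYc k) _]
  exact Finset.sum_eq_zero fun k _ => integral_fderiv_eq_zero _ (h1 k) (hYc k) _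

theorem rowDet_update_update_eq_sum {i j : Fin m} (hij : i ≠ j) (B : Fin m → Fin m → ℝ)
    (x y : Fin m → ℝ) : rowDet m (Function.update (Function.update B i x) j y) =
      ∑ l, ∑ k, x l * y k * rowDet m (Function.update (Function.update B i (Pi.single l 1)) j
        (Pi.single k 1)) := by
  rw [Function.update_comm hij, rowDet_update_eq_sum]
  refine Finset.sum_congr rfl fun l _ => ?_
  rw [Function.update_comm hij.symm, rowDet_update_eq_sum, Finset.mul_sum]
  exact Finset.sum_congr rfl fun k _ => by ring

/-- If the antisymmetric part of the array `b` is the pullback along the rows `B` of an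
antisymmetric array `a`, then wedging `b` with the rows of `B` other than `i` and `j` gives the
multiple `a i j` of the determinant of `B`. -/
theorem sum_mul_rowDet_update_update {i j : Fin m} (hij : i ≠ j) (B : Fin m → Fin m → ℝ)
    (b a : Fin m → Fin m → ℝ) (ha : ∀ p q, a p q = -a q p)
    (hb : ∀ l k, b l k - b k l = ∑ p, ∑ q, a p q * B p l * B q k) :
    ∑ l, ∑ k, b l k * rowDet m (Function.update (Function.update B i (Pi.single l 1)) j
      (Pi.single k 1)) = a i j * rowDet m B := by
  set Q : Fin m → Fin m → ℝ := fun l k =>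
    rowDet m (Function.update (Function.update B i (Pi.single l 1)) j (Pi.single k 1)) with hQ
  have hanti : ∀ l k, Q l k = -Q k l := fun l k => rowDet_update_update_swap hij _ _ _
  have h1 : ∑ l, ∑ k, b l k * Q l k = -∑ l, ∑ k, b k l * Q l k := by
    rw [Finset.sum_comm]
    simp_rw [← Finset.sum_neg_distrib]
    refine Finset.sum_congr rfl fun l _ => Finset.sum_congr rfl fun k _ => ?_
    rw [hanti k l, mul_neg]
  have h2 : ∑ l, ∑ k, (b l k - b k l) * Q l k = 2 * ∑ l, ∑ k, b l k * Q l k := by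
    simp_rw [sub_mul, Finset.sum_sub_distrib]
    linarith
  have h3 : ∑ l, ∑ k, (b l k - b k l) * Q l k =
      ∑ p, ∑ q, a p q * rowDet m (Function.update (Function.update B i (B p)) j (B q)) := by
    have e : ∀ p q, a p q * rowDet m (Function.update (Function.update B i (B p)) j (B q)) =
        ∑ l, ∑ k, a p q * B p l * B q k * Q l k := by
      intro p q
      rw [rowDet_update_update_eq_sum hij, Finset.mul_sum]
      refine Finset.sum_congr rfl fun l _ => ?_
      rw [Finset.mul_sum]
      exact Finset.sum_congr rfl fun k _ => by ring
    simp_rw [e, hb, Finset.sum_mul]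
    calc _ = ∑ l, ∑ p, ∑ k, ∑ q, a p q * B p l * B q k * Q l k :=
          Finset.sum_congr rfl fun l _ => Finset.sum_comm
      _ = ∑ p, ∑ l, ∑ k, ∑ q, a p q * B p l * B q k * Q l k := Finset.sum_comm
      _ = ∑ p, ∑ l, ∑ q, ∑ k, a p q * B p l * B q k * Q l k :=
          Finset.sum_congr rfl fun p _ => Finset.sum_congr rfl fun l _ => Finset.sum_comm
      _ = _ := Finset.sum_congr rfl fun p _ => Finset.sum_comm
  have hself : Function.update (Function.update B i (B i)) j (B j) = B := by
    rw [Function.update_eq_self, Function.update_eq_self]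
  -- Only the pairs `(i, j)` and `(j, i)` contribute: otherwise two rows coincide.
  have h4 : ∑ p, ∑ q, a p q * rowDet m (Function.update (Function.update B i (B p)) j (B q)) =
      2 * (a i j * rowDet m B) := by
    have hz : ∀ p q, (p, q) ≠ (i, j) → (p, q) ≠ (j, i) →
        a p q * rowDet m (Function.update (Function.update B i (B p)) j (B q)) = 0 := by
      intro p q h1 h2
      by_cases hpq : p = q
      · subst hpq
        rw [rowDet_update_update_self hij, mul_zero]
      · by_cases hp : p = i
        · have hq : q ≠ j := fun h => h1 (by rw [hp, h])
          have hq' : q ≠ i := fun h => hpq (by rw [hp, h])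
          rw [rowDet_eq_zero hq, mul_zero]
          simp [Function.update_of_ne hq, Function.update_of_ne hq']
        · by_cases hp' : p = j
          · have hq : q ≠ i := fun h => h2 (by rw [hp', h])
            have hq' : q ≠ j := fun h => hpq (by rw [hp', h])
            rw [rowDet_eq_zero hq', mul_zero]
            simp [Function.update_of_ne hq, Function.update_of_ne hq']
          · rw [rowDet_eq_zero hp, mul_zero]
            simp [Function.update_of_ne hp, Function.update_of_ne hp', Function.update_of_ne hij]
    rw [← Finset.sum_product', Finset.univ_product_univ, ← Finset.sum_subset
      (Finset.subset_univ {(i, j), (j, i)})]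
    · rw [Finset.sum_pair (by simp [hij])]
      simp only [hself]
      rw [rowDet_update_update_swap hij, hself, ha j i]
      ring
    · rintro ⟨p, q⟩ _ h
      simp only [Finset.mem_insert, Finset.mem_singleton, not_or] at h
      exact hz p q h.1 h.2
  linarith

/-- Stokes' theorem for the form `u β ∧ ⋀_{p ≠ i, j} dσ_p` with `dβ = σ^* a`. -/
theorem integral_rowDet_update_update {σ : Euc m → Euc m} {u : Euc m → ℝ} {U : Set (Euc m)}
    (hU : IsOpen U) (hσ : ContDiffOn ℝ ∞ σ U) (hu : ContDiff ℝ ∞ u) (hc : HasCompactSupport u)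
    (hs : tsupport u ⊆ U) {i j : Fin m} (hij : i ≠ j) (β : Fin m → Euc m → ℝ)
    (hβ : ∀ k, ContDiffOn ℝ ∞ (β k) U) (a : Fin m → Fin m → Euc m → ℝ)
    (ha : ∀ p q z, a p q z = -a q p z)
    (hd : ∀ z ∈ U, ∀ l k, fderiv ℝ (β k) z (bv l) - fderiv ℝ (β l) z (bv k) =
      ∑ p, ∑ q, a p q z * jacRows σ z p l * jacRows σ z q k) :
    ∫ z, (rowDet m (Function.update (Function.update (jacRows σ z) i (gradRow u z)) j
      (fun k => β k z)) + u z * a i j z * rowDet m (jacRows σ z)) = 0 := by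
  -- Replace the component `j` of `σ` by each coordinate function in turn.
  set τ : Fin m → Euc m → Euc m := fun k z => σ z + (z k - σ z j) • bv j with hτ
  have hτs : ∀ k, ContDiffOn ℝ ∞ (τ k) U := by
    intro k
    have h1 : ContDiffOn ℝ ∞ (fun z : Euc m => z k) U :=
      (EuclideanSpace.proj (𝕜 := ℝ) k).contDiff.contDiffOn
    have h2 : ContDiffOn ℝ ∞ (fun z : Euc m => σ z j) U :=
      (EuclideanSpace.proj (𝕜 := ℝ) j).contDiff.comp_contDiffOn hσ
    exact hσ.add ((h1.sub h2).smul contDiffOn_const)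
  have hτj : ∀ k, ∀ z ∈ U, jacRows (τ k) z = Function.update (jacRows σ z) j (Pi.single k 1) := by
    intro k z hz
    have h0 : HasFDerivAt σ (fderiv ℝ σ z) z :=
      ((hσ.contDiffAt (hU.mem_nhds hz)).differentiableAt (by simp)).hasFDerivAt
    have h1 : HasFDerivAt (fun z : Euc m => z k) (EuclideanSpace.proj (𝕜 := ℝ) k) z :=
      (EuclideanSpace.proj (𝕜 := ℝ) k : Euc m →L[ℝ] ℝ).hasFDerivAt
    have h2 : HasFDerivAt (fun z : Euc m => σ z j)
        ((EuclideanSpace.proj (𝕜 := ℝ) j : Euc m →L[ℝ] ℝ).comp (fderiv ℝ σ z)) z :=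
      (EuclideanSpace.proj (𝕜 := ℝ) j : Euc m →L[ℝ] ℝ).hasFDerivAt.comp z h0
    have h3 := h0.add ((h1.sub h2).smul_const (bv j))
    funext p l
    have h4 : jacRows (τ k) z p l = _ := congrArg (fun L : Euc m →L[ℝ] Euc m => L (bv l) p) h3.fderiv
    rw [h4]
    by_cases hp : p = j
    · subst hp
      simp [bv_apply, Pi.single_apply, eq_comm]
    · simp [bv_apply, hp, jacRows]
  have hβu : ∀ k, ContDiff ℝ ∞ fun z => u z * β k z := fun k =>
    contDiff_mul_of_tsupport_subset hU hu hs (hβ k)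
  have hcu : ∀ k, HasCompactSupport fun z => u z * β k z := fun k => hc.mul_right
  have hsu : ∀ k, tsupport (fun z => u z * β k z) ⊆ tsupport u := fun k =>
    tsupport_mul_subset_left
  have key := fun k => integral_rowDet_update_gradRow hU (hτs k) (hβu k) (hcu k)
    ((hsu k).trans hs) i
  have hsum : (fun z => rowDet m (Function.update (Function.update (jacRows σ z) i (gradRow u z)) j
      (fun k => β k z)) + u z * a i j z * rowDet m (jacRows σ z)) =
      fun z => ∑ k, rowDet m (Function.update (jacRows (τ k) z) i
        (gradRow (fun y => u y * β k y) z)) := by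
    funext z
    by_cases hz : z ∈ U
    · have hg : ∀ k, gradRow (fun y => u y * β k y) z =
          β k z • gradRow u z + u z • gradRow (β k) z := by
        intro k
        ext l
        rw [gradRow, fderiv_fun_mul (hu.differentiable (by simp) z)
          (((hβ k).contDiffAt (hU.mem_nhds hz)).differentiableAt (by simp))]
        simp [gradRow, add_comm]
      have h1 : ∀ k, rowDet m (Function.update (jacRows (τ k) z) i
          (gradRow (fun y => u y * β k y) z)) =
          β k z * rowDet m (Function.update (Function.update (jacRows σ z) i (gradRow u z)) j
            (Pi.single k 1)) + u z * ∑ l, gradRow (β k) z l *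
          rowDet m (Function.update (Function.update (jacRows σ z) i (Pi.single l 1)) j
            (Pi.single k 1)) := by
        intro k
        rw [hτj k z hz, hg, ContinuousMultilinearMap.map_update_add,
          ContinuousMultilinearMap.map_update_smul, ContinuousMultilinearMap.map_update_smul,
          Function.update_comm hij.symm, smul_eq_mul, smul_eq_mul]
        congr 2
        rw [rowDet_update_eq_sum]
        refine Finset.sum_congr rfl fun l _ => ?_
        rw [Function.update_comm hij.symm]
      simp_rw [h1]
      rw [Finset.sum_add_distrib, ← rowDet_update_eq_sum, ← Finset.mul_sum, Finset.sum_comm,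
        mul_assoc]
      congr 2
      exact (sum_mul_rowDet_update_update hij (jacRows σ z) (fun l k => gradRow (β k) z l)
        (fun p q => a p q z) (fun p q => ha p q z) (hd z hz)).symm
    · have hz' : z ∉ tsupport u := fun h => hz (hs h)
      have h1 : ∀ k, rowDet m (Function.update (jacRows (τ k) z) i
          (gradRow (fun y => u y * β k y) z)) = 0 := fun k => by
        rw [gradRow_eq_zero fun h => hz' (hsu k h)]
        exact ContinuousMultilinearMap.map_coord_zero _ i (by simp)
      rw [gradRow_eq_zero hz', ContinuousMultilinearMap.map_coord_zero _ i
        (by simp [Function.update_of_ne hij]), image_eq_zero_of_notMem_tsupport hz']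
      simp [h1]
  rw [hsum, integral_finsetSum _ fun k _ => (key k).1]
  exact Finset.sum_eq_zero fun k _ => (key k).2

end NullLagrangian

/-! ### Functionals of order zero and their regularization -/

section Regularization

open MeasureTheory Filter Topology Set

variable {m : ℕ}

/-- Smooth test functions with compact support in `U`. -/
structure IsTest (g : Euc m → ℝ) (U : Set (Euc m)) : Prop where
  contDiff : ContDiff ℝ ∞ g
  hasCompactSupport : HasCompactSupport g
  tsupport_subset : tsupport g ⊆ U

theorem IsTest.mono {g : Euc m → ℝ} {U V : Set (Euc m)} (h : IsTest g U) (hUV : U ⊆ V) :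
    IsTest g V := ⟨h.1, h.2, h.3.trans hUV⟩

theorem IsTest.continuous {g : Euc m → ℝ} {U : Set (Euc m)} (h : IsTest g U) : Continuous g :=
  h.1.continuous

theorem IsTest.eq_zero {g : Euc m → ℝ} {U : Set (Euc m)} (h : IsTest g U) {z : Euc m}
    (hz : z ∉ U) : g z = 0 :=
  image_eq_zero_of_notMem_tsupport fun h' => hz (h.3 h')

theorem IsTest.fderiv {g : Euc m → ℝ} {U : Set (Euc m)} (h : IsTest g U) (v : Euc m) :
    IsTest (fun z => fderiv ℝ g z v) U :=
  ⟨(h.1.fderiv_right (m := ∞) (by simp)).clm_apply contDiff_const, h.2.fderiv_apply ℝ v,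
    (tsupport_fderiv_apply_subset ℝ v).trans h.3⟩

theorem IsTest.mul_left {g f : Euc m → ℝ} {U : Set (Euc m)} (hU : IsOpen U) (h : IsTest g U)
    (hf : ContDiffOn ℝ ∞ f U) : IsTest (fun z => g z * f z) U :=
  ⟨contDiff_mul_of_tsupport_subset hU h.1 h.3 hf, h.2.mul_right,
    tsupport_mul_subset_left.trans h.3⟩

theorem IsTest.integrable {g : Euc m → ℝ} {U : Set (Euc m)} (h : IsTest g U)
    (μ : Measure (Euc m)) [IsFiniteMeasureOnCompacts μ] : Integrable g μ :=
  h.continuous.integrable_of_hasCompactSupport h.2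

/-- The divergence of a vector field, given by its components. -/
def divg (X : Fin m → Euc m → ℝ) (z : Euc m) : ℝ := ∑ i, fderiv ℝ (X i) z (bv i)

/-- A finite signed measure on `ℝᵐ`, presented as a difference of two finite measures. -/
structure FinSigned (m : ℕ) where
  /-- The measure counted positively. -/
  pos : Measure (Euc m)
  /-- The measure counted negatively. -/
  neg : Measure (Euc m)
  [finitePos : IsFiniteMeasure pos]
  [finiteNeg : IsFiniteMeasure neg]

attribute [instance] FinSigned.finitePos FinSigned.finiteNeg

/-- The integral of a function against a finite signed measure. -/
def FinSigned.int (κ : FinSigned m) (g : Euc m → ℝ) : ℝ := ∫ y, g y ∂κ.pos - ∫ y, g y ∂κ.neg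

/-- Functions that are continuous with compact support. -/
def IsCc {X : Type*} [TopologicalSpace X] (g : X → ℝ) : Prop := Continuous g ∧ HasCompactSupport g

theorem IsTest.isCc {g : Euc m → ℝ} {U : Set (Euc m)} (h : IsTest g U) : IsCc g :=
  ⟨h.continuous, h.2⟩

theorem IsCc.integrable {g : Euc m → ℝ} (h : IsCc g)
    (μ : Measure (Euc m)) [IsFiniteMeasureOnCompacts μ] : Integrable g μ :=
  h.1.integrable_of_hasCompactSupport h.2

namespace FinSigned

theorem int_sub (κ : FinSigned m) {f g : Euc m → ℝ} (hf : IsCc f) (hg : IsCc g) :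
    κ.int (fun y => f y - g y) = κ.int f - κ.int g := by
  simp only [int]
  rw [integral_sub (hf.integrable _) (hg.integrable _),
    integral_sub (hf.integrable _) (hg.integrable _)]
  ring

theorem int_sum (κ : FinSigned m) {ι : Type*} (s : Finset ι) {f : ι → Euc m → ℝ}
    (hf : ∀ i, IsCc (f i)) : κ.int (fun y => ∑ i ∈ s, f i y) = ∑ i ∈ s, κ.int (f i) := by
  simp only [int]
  rw [integral_finsetSum _ fun i _ => (hf i).integrable _,
    integral_finsetSum _ fun i _ => (hf i).integrable _, Finset.sum_sub_distrib]

/-- Functionals on `C_c` given by finite signed measures. -/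
def Represents (κ : FinSigned m) (S : (Euc m → ℝ) → ℝ) : Prop := ∀ g, IsCc g → S g = κ.int g

theorem exists_add (κ κ' : FinSigned m) :
    ∃ σ : FinSigned m, σ.Represents fun g => κ.int g + κ'.int g := by
  refine ⟨⟨κ.pos + κ'.pos, κ.neg + κ'.neg⟩, fun g hg => ?_⟩
  simp only [int]
  rw [integral_add_measure (hg.integrable _) (hg.integrable _),
    integral_add_measure (hg.integrable _) (hg.integrable _)]
  ring

theorem exists_neg (κ : FinSigned m) : ∃ σ : FinSigned m, σ.Represents fun g => -κ.int g :=
  ⟨⟨κ.neg, κ.pos⟩, fun g _ => by simp only [int]; ring⟩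

theorem exists_sum {ι : Type*} (s : Finset ι) (κ : ι → FinSigned m) :
    ∃ σ : FinSigned m, σ.Represents fun g => ∑ i ∈ s, (κ i).int g := by
  classical
  induction s using Finset.induction_on with
  | empty => exact ⟨⟨0, 0⟩, fun g _ => by simp [int]⟩
  | insert i s hi ih =>
    obtain ⟨σ, hσ⟩ := ih
    obtain ⟨τ, hτ⟩ := exists_add (κ i) σ
    refine ⟨τ, fun g hg => ?_⟩
    simp only [Finset.sum_insert hi]
    rw [← hτ g hg]
    exact congrArg _ (hσ g hg)

/-- A weighted integral along a measurable map is a finite signed measure. -/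
theorem exists_map {P : Type*} [MeasurableSpace P] (ν : Measure P) {b : P → ℝ}
    (hb : Integrable b ν) {a : P → Euc m} (ha : AEMeasurable a ν) :
    ∃ σ : FinSigned m, σ.Represents fun g => ∫ p, b p * g (a p) ∂ν := by
  have hfin : ∀ c : P → ℝ, Integrable c ν →
      IsFiniteMeasure (ν.withDensity fun p => ENNReal.ofReal (c p)) := fun c hc =>
    isFiniteMeasure_withDensity_ofReal hc.2
  have h1 := hfin b hb
  have h2 := hfin (fun p => -b p) hb.neg
  refine ⟨⟨(ν.withDensity fun p => ENNReal.ofReal (b p)).map a,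
    (ν.withDensity fun p => ENNReal.ofReal (-b p)).map a⟩, fun g hg => ?_⟩
  have hbm := hb.aestronglyMeasurable.aemeasurable
  have hint : ∀ c : P → ℝ, Integrable c ν → ∫ y, g y ∂(ν.withDensity fun p =>
      ENNReal.ofReal (c p)).map a = ∫ p, max (c p) 0 * g (a p) ∂ν := by
    intro c hc
    have hcm := hc.aestronglyMeasurable.aemeasurable
    rw [integral_map (ha.mono_ac (withDensity_absolutelyContinuous _ _))
      hg.1.aestronglyMeasurable, integral_withDensity_eq_integral_toReal_smul₀
      hcm.ennreal_ofReal (by simp)]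
    refine integral_congr_ae (Eventually.of_forall fun p => ?_)
    simp [ENNReal.toReal_ofReal']
  have hintg : ∀ c : P → ℝ, Integrable c ν →
      Integrable (fun p => max (c p) 0 * g (a p)) ν := by
    intro c hc
    obtain ⟨C, hC⟩ := hg.2.exists_bound_of_continuous hg.1
    refine Integrable.mul_bdd (c := C) hc.pos_part
      (hg.1.comp_aestronglyMeasurable ha.aestronglyMeasurable) (Eventually.of_forall fun p => hC _)
  simp only [int]
  rw [hint b hb, hint (fun p => -b p) hb.neg,
    ← integral_sub (hintg b hb) (hintg (fun p => -b p) hb.neg)]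
  refine integral_congr_ae (Eventually.of_forall fun p => ?_)
  change b p * g (a p) = max (b p) 0 * g (a p) - max (-b p) 0 * g (a p)
  rw [← sub_mul]
  congr 1
  rcases le_total 0 (b p) with h | h
  · rw [max_eq_left h, max_eq_right (by linarith), sub_zero]
  · rw [max_eq_right h, max_eq_left (by linarith)]; ring

/-- Fubini's theorem for a signed measure and a locally finite one. -/
theorem int_integral (κ : FinSigned m) (ν : Measure (Euc m)) [SFinite ν]
    [IsFiniteMeasureOnCompacts ν] {h : Euc m → Euc m → ℝ}
    (hh : IsCc (Function.uncurry h)) :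
    κ.int (fun y => ∫ w, h w y ∂ν) = ∫ w, κ.int (h w) ∂ν := by
  have hi : ∀ (μ : Measure (Euc m)) [IsFiniteMeasure μ],
      Integrable (Function.uncurry h) (ν.prod μ) := fun μ _ =>
    hh.1.integrable_of_hasCompactSupport hh.2
  simp only [int]
  have e : ∫ w, (∫ y, h w y ∂κ.pos - ∫ y, h w y ∂κ.neg) ∂ν =
      ∫ w, ∫ y, h w y ∂κ.pos ∂ν - ∫ w, ∫ y, h w y ∂κ.neg ∂ν :=
    integral_sub (hi κ.pos).integral_prod_left (hi κ.neg).integral_prod_left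
  rw [e, integral_integral_swap (hi κ.pos), integral_integral_swap (hi κ.neg)]

/-- Integration of a smooth family of functions with uniformly compact support. -/
theorem contDiffOn_int (κ : FinSigned m) {h : Euc m → Euc m → ℝ} {s k : Set (Euc m)}
    (hs : IsOpen s) (hk : IsCompact k) (hz : ∀ w ∈ s, ∀ y ∉ k, h w y = 0)
    (hh : ContDiffOn ℝ ∞ (Function.uncurry h) (s ×ˢ univ)) :
    ContDiffOn ℝ ∞ (fun w => κ.int (h w)) s := by
  have key : ∀ (μ : Measure (Euc m)) [IsFiniteMeasure μ],
      ContDiffOn ℝ ∞ (fun w => ∫ y, h w y ∂μ) s := by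
    intro μ _
    have h1 := contDiffOn_convolution_right_with_param_comp (μ := μ) (n := ⊤)
      (ContinuousLinearMap.lsmul ℝ ℝ) (f := fun _ : Euc m => (1 : ℝ))
      (g := fun w x => h w (-x)) (s := s) (k := (fun x : Euc m => -x) '' k) (v := fun _ => 0)
      contDiffOn_const hs (hk.image continuous_neg)
      (fun w x hw hx => hz w hw _ fun hx' => hx ⟨-x, hx', neg_neg x⟩)
      (continuous_const.locallyIntegrable)
      (hh.comp (contDiff_fst.prodMk contDiff_snd.neg).contDiffOn fun p hp => ⟨hp.1, mem_univ _⟩)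
    refine h1.congr fun w _ => ?_
    simp [convolution]
  exact (key κ.pos).sub (key κ.neg)

theorem int_congr_zero (κ : FinSigned m) {g : Euc m → ℝ} (h : ∀ y, g y = 0) : κ.int g = 0 := by
  simp [int, h]

theorem int_mul_left (κ : FinSigned m) (c : ℝ) (g : Euc m → ℝ) :
    κ.int (fun y => c * g y) = c * κ.int g := by
  simp only [int, integral_const_mul, mul_sub]

theorem contDiff_int_comp (κ : FinSigned m) {g : Euc m → ℝ} {U : Set (Euc m)} (hg : IsTest g U)
    {s t : ℝ} (hs : |s| = 1) (ht : |t| = 1) :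
    ContDiff ℝ ∞ fun z => κ.int fun p => g (s • z + t • p) := by
  obtain ⟨R, hR⟩ := hg.2.isCompact.isBounded.subset_closedBall 0
  refine contDiff_iff_contDiffAt.2 fun z => ?_
  refine (κ.contDiffOn_int (s := Metric.ball z 1) (k := Metric.closedBall 0 (‖z‖ + 1 + R))
    Metric.isOpen_ball (isCompact_closedBall _ _) ?_ ?_).contDiffAt (Metric.ball_mem_nhds _ one_pos)
  · intro w hw p hp
    by_contra h
    have h1 := hR (subset_tsupport _ h)
    rw [mem_closedBall_zero_iff] at h1 hp
    rw [mem_ball_iff_norm] at hw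
    have h2 : ‖w‖ ≤ ‖w - z‖ + ‖z‖ := by
      calc ‖w‖ = ‖(w - z) + z‖ := by rw [sub_add_cancel]
        _ ≤ _ := norm_add_le _ _
    have h3 : ‖p‖ ≤ ‖s • w + t • p‖ + ‖w‖ := by
      calc ‖p‖ = ‖(s • w + t • p) - s • w‖ := by
            rw [add_sub_cancel_left, norm_smul, Real.norm_eq_abs, ht, one_mul]
        _ ≤ ‖s • w + t • p‖ + ‖s • w‖ := norm_sub_le _ _
        _ = _ := by rw [norm_smul, Real.norm_eq_abs, hs, one_mul]
    linarith
  · exact (hg.1.comp ((contDiff_fst.const_smul s).add (contDiff_snd.const_smul t))).contDiffOn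

theorem contDiff_int_sub (κ : FinSigned m) {g : Euc m → ℝ} {U : Set (Euc m)} (hg : IsTest g U) :
    ContDiff ℝ ∞ fun z => κ.int fun p => g (z - p) := by
  simpa [sub_eq_add_neg] using κ.contDiff_int_comp hg (s := 1) (t := -1) (by simp) (by simp)

theorem fderiv_int_sub (κ : FinSigned m) {g : Euc m → ℝ} {U : Set (Euc m)} (hg : IsTest g U)
    (z v : Euc m) :
    fderiv ℝ (fun z => κ.int fun p => g (z - p)) z v = κ.int fun p => fderiv ℝ g (z - p) v := by
  have hcont : Continuous (fderiv ℝ g) := hg.1.continuous_fderiv (by simp)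
  obtain ⟨C, hC⟩ := (hg.2.fderiv ℝ).exists_bound_of_continuous hcont
  have hbdd : ∀ (μ : Measure (Euc m)) [IsFiniteMeasure μ] (z : Euc m),
      Integrable (fun p => g (z - p)) μ := by
    intro μ _ z
    obtain ⟨D, hD⟩ := hg.2.exists_bound_of_continuous hg.continuous
    exact Integrable.of_bound (hg.continuous.comp
      (continuous_const.sub continuous_id)).aestronglyMeasurable D (Eventually.of_forall fun p => hD _)
  have key : ∀ (μ : Measure (Euc m)) [IsFiniteMeasure μ],
      HasFDerivAt (fun z => ∫ p, g (z - p) ∂μ) (∫ p, fderiv ℝ g (z - p) ∂μ) z ∧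
        Integrable (fun p => fderiv ℝ g (z - p)) μ := by
    intro μ _
    have hm : AEStronglyMeasurable (fun p => fderiv ℝ g (z - p)) μ :=
      (hcont.comp (continuous_const.sub continuous_id)).aestronglyMeasurable
    refine ⟨hasFDerivAt_integral_of_dominated_of_fderiv_le (bound := fun _ => C)
      (F' := fun z p => fderiv ℝ g (z - p)) univ_mem
      (Eventually.of_forall fun z => (hbdd μ z).aestronglyMeasurable) (hbdd μ z) hm
      (Eventually.of_forall fun p z _ => hC _) (integrable_const C)
      (Eventually.of_forall fun p z _ => ?_), Integrable.of_bound hm C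
        (Eventually.of_forall fun p => hC _)⟩
    have h1 : HasFDerivAt g (fderiv ℝ g (z - p)) (z - p) :=
      (hg.1.differentiable (by simp) _).hasFDerivAt
    have h2 := h1.comp z ((hasFDerivAt_id z).sub_const p)
    rw [ContinuousLinearMap.comp_id] at h2
    exact h2
  have h := ((key κ.pos).1.sub (key κ.neg).1).fderiv
  have h' := congrArg (fun L : Euc m →L[ℝ] ℝ => L v) h
  simp only [sub_apply] at h'
  rw [ContinuousLinearMap.integral_apply (key κ.pos).2, ContinuousLinearMap.integral_apply
    (key κ.neg).2] at h'
  exact h'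

end FinSigned

/-- For each radius there are a mollifier `ρ` and finite signed measures `π` such that the field
`X` with components `g ⋆ π i` solves `div X = g - g ⋆ ρ`. The measures come from the homotopy
`g(z) - g(z - u) = ∫₀¹ dg(z - su)(u) ds`, averaged over `u` with weight `ρ`. -/
theorem exists_homotopy_measures (m : ℕ) {r : ℝ} (hr : 0 < r) :
    ∃ (ρ : Euc m → ℝ) (π : Fin m → FinSigned m), IsTest ρ univ ∧ (∀ u, r < ‖u‖ → ρ u = 0) ∧
      (∀ i g, IsCc g → (∀ p, ‖p‖ ≤ r → g p = 0) → (π i).int g = 0) ∧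
      ∀ g, IsTest g univ → ∀ z, ∑ i, (π i).int (fun p => fderiv ℝ g (z - p) (bv i)) =
        g z - ∫ u, ρ u * g (z - u) := by
  let bump : ContDiffBump (0 : Euc m) := ⟨r / 2, r, half_pos hr, half_lt_self hr⟩
  set ρ : Euc m → ℝ := bump.normed volume with hρ
  have hρs : ContDiff ℝ ∞ ρ := bump.contDiff_normed
  have hρc : HasCompactSupport ρ := bump.hasCompactSupport_normed
  have hρ1 : ∫ u, ρ u = 1 := bump.integral_normed
  have hρz : ∀ u, r < ‖u‖ → ρ u = 0 := by
    intro u hu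
    by_contra h
    have h1 : u ∈ Function.support (bump.normed volume) := h
    rw [bump.support_normed_eq, mem_ball_zero_iff] at h1
    exact lt_asymm hu h1
  set ν : Measure (Euc m × ℝ) := (volume : Measure (Euc m)).prod (volume.restrict (Icc 0 1)) with hν
  have hρi : ∀ i : Fin m, Integrable (fun u : Euc m => ρ u * u i) :=
    fun i => (hρs.continuous.mul (EuclideanSpace.proj (𝕜 := ℝ) i).continuous
      ).integrable_of_hasCompactSupport hρc.mul_right
  have hb : ∀ i : Fin m, Integrable (fun p : Euc m × ℝ => ρ p.1 * p.1 i) ν := fun i =>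
    (hρi i).comp_fst _
  choose π hπ using fun i : Fin m => FinSigned.exists_map ν (hb i)
    (a := fun p : Euc m × ℝ => p.2 • p.1) (by fun_prop)
  refine ⟨ρ, π, ⟨hρs, hρc, subset_univ _⟩, hρz, fun i g hg hz => ?_, fun g hg z => ?_⟩
  · rw [← hπ i g hg]
    have hs : ∀ᵐ p : Euc m × ℝ ∂ν, p.2 ∈ Icc (0 : ℝ) 1 :=
      Measure.quasiMeasurePreserving_snd.ae (ae_restrict_mem measurableSet_Icc)
    refine integral_eq_zero_of_ae (hs.mono fun p hp => ?_)
    rcases lt_or_ge r ‖p.1‖ with h | h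
    · simp [hρz _ h]
    · have h1 : ‖p.2 • p.1‖ ≤ r := by
        rw [norm_smul, Real.norm_of_nonneg hp.1]
        exact (mul_le_of_le_one_left (norm_nonneg _) hp.2).trans h
      simp [hz _ h1]
  · have hcc : ∀ i, IsCc fun p => fderiv ℝ g (z - p) (bv i) := by
      intro i
      refine ⟨(hg.fderiv (bv i)).continuous.comp (continuous_const.sub continuous_id), ?_⟩
      exact (hg.fderiv (bv i)).2.comp_homeomorph (Homeomorph.subLeft z)
    have hcont : Continuous (fderiv ℝ g) := hg.1.continuous_fderiv (by simp)
    have hint : ∀ i, Integrable (fun p : Euc m × ℝ =>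
        ρ p.1 * p.1 i * fderiv ℝ g (z - p.2 • p.1) (bv i)) ν := by
      intro i
      obtain ⟨C, hC⟩ := (hg.fderiv (bv i)).2.exists_bound_of_continuous (hg.fderiv (bv i)).continuous
      refine (hb i).mul_bdd (c := C) ?_ (Eventually.of_forall fun p => hC _)
      exact (((hg.fderiv (bv i)).continuous).comp (by fun_prop)).aestronglyMeasurable
    have h1 : ∑ i, (π i).int (fun p => fderiv ℝ g (z - p) (bv i)) =
        ∫ p, ρ p.1 * fderiv ℝ g (z - p.2 • p.1) p.1 ∂ν := by
      simp_rw [← fun i => hπ i _ (hcc i)]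
      rw [← integral_finsetSum _ fun i _ => hint i]
      refine integral_congr_ae (Eventually.of_forall fun p => ?_)
      simp only
      conv_rhs => rw [← sum_smul_bv p.1, map_sum, Finset.mul_sum]
      refine Finset.sum_congr rfl fun i _ => ?_
      rw [map_smul, smul_eq_mul, sum_smul_bv]
      ring
    have hint' : Integrable (fun p : Euc m × ℝ =>
        ρ p.1 * fderiv ℝ g (z - p.2 • p.1) p.1) ν := by
      refine (integrable_finsetSum Finset.univ fun i _ => hint i).congr
        (Eventually.of_forall fun p => ?_)
      simp only
      conv_rhs => rw [← sum_smul_bv p.1, map_sum, Finset.mul_sum]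
      refine Finset.sum_congr rfl fun i _ => ?_
      rw [map_smul, smul_eq_mul, sum_smul_bv]
      ring
    rw [h1, integral_prod _ hint']
    have h2 : ∀ u : Euc m, ∫ s, ρ u * fderiv ℝ g (z - s • u) u ∂(volume.restrict (Icc (0 : ℝ) 1)) =
        ρ u * g z - ρ u * g (z - u) := by
      intro u
      rw [integral_const_mul, ← mul_sub]
      congr 1
      have hd : ∀ s ∈ uIcc (0 : ℝ) 1, HasDerivAt (fun s : ℝ => -g (z - s • u))
          (fderiv ℝ g (z - s • u) u) s := by
        intro s _
        have h0 : HasFDerivAt g (fderiv ℝ g (z - s • u)) (z - s • u) :=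
          (hg.1.differentiable (by simp) _).hasFDerivAt
        have h3 : HasDerivAt (fun s : ℝ => z - s • u) (-u) s := by
          have h6 := ((hasDerivAt_id s).smul_const u).const_sub z
          rw [one_smul] at h6
          exact h6
        have h7 := (h0.comp_hasDerivAt s h3).neg
        rw [map_neg, neg_neg] at h7
        exact h7
      have h4 := intervalIntegral.integral_eq_sub_of_hasDerivAt hd
        (Continuous.intervalIntegrable (by fun_prop) _ _)
      rw [intervalIntegral.integral_of_le zero_le_one, ← integral_Icc_eq_integral_Ioc] at h4
      rw [h4, one_smul, zero_smul, sub_zero]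
      ring
    simp_rw [h2]
    have h5 : Integrable (fun u => ρ u * g (z - u)) :=
      (hρs.continuous.mul (hg.continuous.comp
        (continuous_const.sub continuous_id))).integrable_of_hasCompactSupport hρc.mul_right
    rw [integral_sub ((hρs.continuous.integrable_of_hasCompactSupport hρc).mul_const _) h5,
      integral_mul_const, hρ1, one_mul]

end Regularization

section Regularity

open MeasureTheory Filter Topology Set

variable {m : ℕ}

theorem isCc_mul_comp_sub {f g : Euc m → ℝ} (hf : IsCc f) (hg : IsCc g) {s t : ℝ} (ht : t ≠ 0) :
    IsCc fun p : Euc m × Euc m => f p.1 * g (s • p.1 + t • p.2) := by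
  refine ⟨(hf.1.comp continuous_fst).mul (hg.1.comp (by fun_prop)), ?_⟩
  refine HasCompactSupport.intro (K := (fun q : Euc m × Euc m => (q.1, t⁻¹ • (q.2 - s • q.1))) ''
    (tsupport f ×ˢ tsupport g)) ((hf.2.isCompact.prod hg.2.isCompact).image (by fun_prop)) ?_
  intro p hp
  by_contra h
  refine hp ⟨(p.1, s • p.1 + t • p.2), ⟨subset_tsupport _ (left_ne_zero_of_mul h),
    subset_tsupport _ (right_ne_zero_of_mul h)⟩, ?_⟩
  simp [smul_smul, inv_mul_cancel₀ ht]

namespace FinSigned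

theorem int_mollify (κ : FinSigned m) {ρ g : Euc m → ℝ} (hρ : IsCc ρ) (hg : IsCc g) :
    κ.int (fun y => ∫ u, ρ u * g (y - u)) = ∫ w, g w * κ.int fun y => ρ (y - w) := by
  have h1 : ∀ y : Euc m, ∫ u, ρ u * g (y - u) = ∫ w, g w * ρ (y - w) := by
    intro y
    rw [← integral_sub_left_eq_self _ volume y]
    refine integral_congr_ae (Eventually.of_forall fun w => ?_)
    simp [mul_comm]
  simp_rw [h1]
  rw [int_integral κ volume (h := fun w y => g w * ρ (y - w))]
  · exact integral_congr_ae (Eventually.of_forall fun w => κ.int_mul_left _ _)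
  · have h := isCc_mul_comp_sub hg hρ (s := -1) (t := 1) one_ne_zero
    refine (congrArg IsCc (funext fun p => ?_)).mp h
    simp [Function.uncurry, sub_eq_add_neg, add_comm]

theorem integral_mul_int_sub (κ : FinSigned m) {θ g : Euc m → ℝ} (hθ : IsCc θ) (hg : IsCc g) :
    ∫ z, θ z * κ.int (fun p => g (z - p)) = ∫ w, g w * κ.int fun p => θ (w + p) := by
  have h1 : ∀ z, θ z * κ.int (fun p => g (z - p)) = κ.int fun p => θ z * g (z - p) :=
    fun z => (κ.int_mul_left _ _).symm
  have h2 : ∀ w, g w * κ.int (fun p => θ (w + p)) = κ.int fun p => g w * θ (w + p) :=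
    fun z => (κ.int_mul_left _ _).symm
  simp_rw [h1, h2]
  rw [← int_integral κ volume (h := fun z p => θ z * g (z - p)),
    ← int_integral κ volume (h := fun w p => g w * θ (w + p))]
  · congr 1
    funext p
    rw [← integral_add_right_eq_self _ p]
    refine integral_congr_ae (Eventually.of_forall fun w => ?_)
    simp [mul_comm]
  · have h := isCc_mul_comp_sub hg hθ (s := 1) (t := 1) one_ne_zero
    refine (congrArg IsCc (funext fun p => ?_)).mp h
    simp [Function.uncurry]
  · have h := isCc_mul_comp_sub hθ hg (s := 1) (t := -1) (by norm_num)
    refine (congrArg IsCc (funext fun p => ?_)).mp h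
    simp [Function.uncurry, sub_eq_add_neg]

/-- The convolution of finite signed measures. -/
theorem exists_conv (κ π : FinSigned m) :
    ∃ σ : FinSigned m, σ.Represents fun g => κ.int fun z => π.int fun p => g (z - p) := by
  let c : Measure (Euc m) → Measure (Euc m) → Measure (Euc m) := fun μ ν =>
    (μ.prod ν).map fun q : Euc m × Euc m => q.1 - q.2
  have hm : Measurable fun q : Euc m × Euc m => q.1 - q.2 := by fun_prop
  have hc : ∀ (μ ν : Measure (Euc m)) [IsFiniteMeasure μ] [IsFiniteMeasure ν],
      IsFiniteMeasure (c μ ν) := fun μ ν _ _ => Measure.isFiniteMeasure_map _ _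
  have := hc κ.pos π.pos
  have := hc κ.pos π.neg
  have := hc κ.neg π.pos
  have := hc κ.neg π.neg
  refine ⟨⟨c κ.pos π.pos + c κ.neg π.neg, c κ.pos π.neg + c κ.neg π.pos⟩, fun g hg => ?_⟩
  have hint : ∀ (μ ν : Measure (Euc m)) [IsFiniteMeasure μ] [IsFiniteMeasure ν],
      Integrable (fun q : Euc m × Euc m => g (q.1 - q.2)) (μ.prod ν) := by
    intro μ ν _ _
    obtain ⟨D, hD⟩ := hg.2.exists_bound_of_continuous hg.1
    exact Integrable.of_bound (hg.1.comp (by fun_prop)).aestronglyMeasurable D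
      (Eventually.of_forall fun p => hD _)
  have hI : ∀ (μ ν : Measure (Euc m)) [IsFiniteMeasure μ] [IsFiniteMeasure ν],
      ∫ z, ∫ p, g (z - p) ∂ν ∂μ = ∫ y, g y ∂(c μ ν) := by
    intro μ ν _ _
    rw [integral_map hm.aemeasurable hg.1.aestronglyMeasurable, integral_prod _ (hint μ ν)]
  simp only [int]
  rw [integral_add_measure (hg.integrable _) (hg.integrable _),
    integral_add_measure (hg.integrable _) (hg.integrable _),
    integral_sub (hint κ.pos π.pos).integral_prod_left (hint κ.pos π.neg).integral_prod_left,
    integral_sub (hint κ.neg π.pos).integral_prod_left (hint κ.neg π.neg).integral_prod_left,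
    hI, hI, hI, hI]
  ring

/-- The field `g ⋆ π` has compact support close to that of `g`. -/
theorem isTest_int_sub (π : FinSigned m) {r a : ℝ} {w₀ : Euc m}
    (hπ : ∀ g, IsCc g → (∀ p, ‖p‖ ≤ r → g p = 0) → π.int g = 0) {g : Euc m → ℝ}
    (hg : IsTest g (Metric.ball w₀ a)) :
    IsTest (fun z => π.int fun p => g (z - p)) (Metric.ball w₀ (a + r)) := by
  have hK : IsCompact ((fun q : Euc m × Euc m => q.1 + q.2) ''
      (tsupport g ×ˢ Metric.closedBall 0 r)) :=
    (hg.2.isCompact.prod (isCompact_closedBall _ _)).image (by fun_prop)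
  have hz : ∀ z, z ∉ (fun q : Euc m × Euc m => q.1 + q.2) ''
      (tsupport g ×ˢ Metric.closedBall 0 r) → π.int (fun p => g (z - p)) = 0 := by
    intro z hz
    refine hπ _ ⟨hg.continuous.comp (by fun_prop), hg.2.comp_homeomorph (Homeomorph.subLeft z)⟩ ?_
    intro p hp
    by_contra h
    exact hz ⟨(z - p, p), ⟨subset_tsupport _ h, mem_closedBall_zero_iff.2 hp⟩,
      sub_add_cancel z p⟩
  refine ⟨π.contDiff_int_sub hg, HasCompactSupport.intro hK hz, ?_⟩
  have hsub : tsupport (fun z => π.int fun p => g (z - p)) ⊆ (fun q : Euc m × Euc m => q.1 + q.2) ''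
      (tsupport g ×ˢ Metric.closedBall 0 r) := by
    refine closure_minimal (fun z h => ?_) hK.isClosed
    by_contra h'
    exact h (hz z h')
  · refine hsub.trans ?_
    rintro _ ⟨⟨y, p⟩, ⟨hy, hp⟩, rfl⟩
    have h1 := hg.3 hy
    rw [mem_ball_iff_norm] at h1 ⊢
    rw [mem_closedBall_zero_iff] at hp
    calc ‖y + p - w₀‖ = ‖(y - w₀) + p‖ := by congr 1; abel
      _ ≤ ‖y - w₀‖ + ‖p‖ := norm_add_le _ _
      _ < a + r := by simp only at *; linarith

end FinSigned

/-- A smooth function on a larger ball agrees on a smaller one with a test function. -/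
theorem exists_isTest_eqOn {w₀ : Euc m} {a b : ℝ} (ha : 0 < a) (hab : a < b) {f : Euc m → ℝ}
    (hf : ContDiffOn ℝ ∞ f (Metric.ball w₀ b)) :
    ∃ f', IsTest f' univ ∧ ∀ z ∈ Metric.ball w₀ a, f' z = f z := by
  let bump : ContDiffBump w₀ := ⟨a, (a + b) / 2, ha, by linarith⟩
  refine ⟨fun z => bump z * f z, ⟨contDiff_mul_of_tsupport_subset Metric.isOpen_ball bump.contDiff
    ?_ hf, bump.hasCompactSupport.mul_right, subset_univ _⟩, fun z hz => ?_⟩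
  · rw [bump.tsupport_eq]
    exact Metric.closedBall_subset_ball (by change (a + b) / 2 < b; linarith)
  · simp only
    rw [bump.one_of_mem_closedBall (Metric.ball_subset_closedBall hz), one_mul]

theorem IsTest.integral_congr {g f f' : Euc m → ℝ} {U : Set (Euc m)} (hg : IsTest g U)
    (h : ∀ z ∈ U, f z = f' z) : ∫ z, f z * g z = ∫ z, f' z * g z := by
  refine integral_congr_ae (Eventually.of_forall fun z => ?_)
  by_cases hz : z ∈ U
  · simp only [h z hz]
  · simp only [hg.eq_zero hz, mul_zero]

theorem divg_int_sub {π : Fin m → FinSigned m} {g : Euc m → ℝ} {U : Set (Euc m)}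
    (hg : IsTest g U) (z : Euc m) :
    divg (fun i z => (π i).int fun p => g (z - p)) z =
      ∑ i, (π i).int (fun p => fderiv ℝ g (z - p) (bv i)) :=
  Finset.sum_congr rfl fun i _ => (π i).fderiv_int_sub hg z (bv i)

theorem isTest_divg {X : Fin m → Euc m → ℝ} {U : Set (Euc m)} (hX : ∀ i, IsTest (X i) U) :
    IsTest (divg X) U := by
  have hK : IsCompact (⋃ i, tsupport (X i)) := isCompact_iUnion fun i => (hX i).2
  have h0 : ∀ z ∉ ⋃ i, tsupport (X i), divg X z = 0 := fun z hz =>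
    Finset.sum_eq_zero fun i _ => by
      have hi : z ∉ tsupport fun z => fderiv ℝ (X i) z (bv i) := fun h =>
        hz (mem_iUnion.2 ⟨i, tsupport_fderiv_apply_subset ℝ _ h⟩)
      exact image_eq_zero_of_notMem_tsupport (f := fun z => fderiv ℝ (X i) z (bv i)) hi
  refine ⟨ContDiff.sum fun i _ => ((hX i).fderiv (bv i)).1, HasCompactSupport.intro hK h0,
    (closure_minimal (fun z h => ?_) hK.isClosed).trans (iUnion_subset fun i => (hX i).3)⟩
  by_contra h'
  exact h (h0 z h')

/-- A measure with smooth weak gradient has a smooth density: up to smooth terms, the integral of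
`g` is that of the divergence of `g ⋆ π`. -/
theorem exists_density {κ : FinSigned m} {w₀ : Euc m} {r : ℝ} (hr : 0 < r)
    {θ : Fin m → Euc m → ℝ} (hθ : ∀ i, ContDiffOn ℝ ∞ (θ i) (Metric.ball w₀ (3 * r)))
    (h : ∀ X : Fin m → Euc m → ℝ, (∀ i, IsTest (X i) (Metric.ball w₀ (3 * r))) →
      κ.int (divg X) = ∑ i, ∫ z, θ i z * X i z) :
    ∃ f : Euc m → ℝ, ContDiff ℝ ∞ f ∧ ∀ g, IsTest g (Metric.ball w₀ r) →
      κ.int g = ∫ w, f w * g w := by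
  obtain ⟨ρ, π, hρ, hρz, hπ, hhom⟩ := exists_homotopy_measures m hr
  choose θ' hθ' hθe using fun i => exists_isTest_eqOn (by linarith : 0 < 2 * r)
    (by linarith : 2 * r < 3 * r) (hθ i)
  -- The density is read off from `g = g ⋆ ρ + div (g ⋆ π)`, moving `ρ` and `π` to the other factor.
  refine ⟨fun w => κ.int (fun y => ρ (y - w)) + ∑ i, (π i).int fun p => θ' i (w + p), ?_,
    fun g hg => ?_⟩
  · refine ContDiff.add ?_ (ContDiff.sum fun i _ => ?_)
    · simpa [sub_eq_add_neg, add_comm] using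
        κ.contDiff_int_comp hρ (s := -1) (t := 1) (by simp) (by simp)
    · simpa using (π i).contDiff_int_comp (hθ' i) (s := 1) (t := 1) (by simp) (by simp)
  · set X : Fin m → Euc m → ℝ := fun i z => (π i).int fun p => g (z - p) with hX
    have hXt : ∀ i, IsTest (X i) (Metric.ball w₀ (2 * r)) := fun i => by
      rw [two_mul]; exact (π i).isTest_int_sub (hπ i) hg
    have hdiv : ∀ z, divg X z = g z - ∫ u, ρ u * g (z - u) := fun z => by
      rw [divg_int_sub hg, hhom g (hg.mono (subset_univ _))]
    have hdivc : IsCc (divg X) := (isTest_divg hXt).isCc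
    have hgc := hg.isCc
    have hmoll : κ.int g = κ.int (divg X) + κ.int fun y => ∫ u, ρ u * g (y - u) := by
      have e : (fun y => ∫ u, ρ u * g (y - u)) = fun y => g y - divg X y := by
        funext y; rw [hdiv]; ring
      rw [e, κ.int_sub hgc hdivc]
      ring
    rw [hmoll, h X fun i => (hXt i).mono (Metric.ball_subset_ball (by linarith)),
      κ.int_mollify hρ.isCc hgc]
    have h1 : ∀ i, ∫ z, θ i z * X i z = ∫ w, g w * (π i).int fun p => θ' i (w + p) := by
      intro i
      rw [← (π i).integral_mul_int_sub (hθ' i).isCc hgc]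
      exact (hXt i).integral_congr fun z hz => (hθe i z hz).symm
    simp_rw [h1]
    have hi0 : Integrable fun w => g w * κ.int fun y => ρ (y - w) := by
      refine Continuous.integrable_of_hasCompactSupport (hg.continuous.mul ?_) hg.2.mul_right
      have := (κ.contDiff_int_comp hρ (s := -1) (t := 1) (by simp) (by simp)).continuous
      simpa [sub_eq_add_neg, add_comm] using this
    have hi1 : ∀ i, Integrable fun w => g w * (π i).int fun p => θ' i (w + p) := by
      intro i
      refine Continuous.integrable_of_hasCompactSupport (hg.continuous.mul ?_) hg.2.mul_right
      have := ((π i).contDiff_int_comp (hθ' i) (s := 1) (t := 1) (by simp) (by simp)).continuous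
      simpa using this
    rw [← integral_finsetSum _ fun i _ => hi1 i, add_comm,
      ← integral_add hi0 (integrable_finsetSum _ fun i _ => hi1 i)]
    refine integral_congr_ae (Eventually.of_forall fun w => ?_)
    simp only
    rw [add_mul, Finset.sum_mul, mul_comm]
    congr 1
    exact Finset.sum_congr rfl fun i _ => mul_comm _ _

/-- A `1`-current of order zero with smooth exterior derivative is smooth up to the derivative of
a signed measure. This is the homotopy formula `κ = κ ⋆ ρ + h(dκ) + d(hκ)` with the homotopy
operator given by convolution with `π`: it preserves order zero, and the first two terms are
smooth. -/
theorem exists_regularization {κ : Fin m → FinSigned m} {w₀ : Euc m} {r : ℝ} (hr : 0 < r)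
    {a : Fin m → Fin m → Euc m → ℝ}
    (ha : ∀ i j, ContDiffOn ℝ ∞ (a i j) (Metric.ball w₀ (3 * r)))
    (h : ∀ i j g, IsTest g (Metric.ball w₀ (3 * r)) →
      (κ j).int (fun z => fderiv ℝ g z (bv i)) - (κ i).int (fun z => fderiv ℝ g z (bv j)) =
        -∫ z, a i j z * g z) :
    ∃ (θ : Fin m → Euc m → ℝ) (σ : FinSigned m), (∀ j, ContDiff ℝ ∞ (θ j)) ∧
      ∀ X : Fin m → Euc m → ℝ, (∀ i, IsTest (X i) (Metric.ball w₀ r)) →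
        ∑ j, (κ j).int (X j) = (∑ j, ∫ z, θ j z * X j z) - σ.int (divg X) := by
  obtain ⟨ρ, π, hρ, hρz, hπ, hhom⟩ := exists_homotopy_measures m hr
  choose a' ha' hae using fun i j => exists_isTest_eqOn (by linarith : 0 < 2 * r)
    (by linarith : 2 * r < 3 * r) (ha i j)
  -- The measure `σ = -∑ κᵢ ⋆ πᵢ` is the term whose derivative is not smooth.
  choose τ hτ using fun i => (κ i).exists_conv (π i)
  obtain ⟨τ', hτ'⟩ := FinSigned.exists_sum Finset.univ τ
  obtain ⟨σ, hσ⟩ := τ'.exists_neg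
  have hσ' : ∀ g, IsCc g → σ.int g = -∑ i, (κ i).int fun z => (π i).int fun p => g (z - p) := by
    intro g hg
    refine (hσ g hg).symm.trans (congrArg Neg.neg ((hτ' g hg).symm.trans ?_))
    exact Finset.sum_congr rfl fun i _ => (hτ i g hg).symm
  set θ : Fin m → Euc m → ℝ := fun j w => (κ j).int (fun y => ρ (y - w)) -
    ∑ i, (π i).int fun p => a' i j (w + p) with hθ
  have hc0 : ∀ j, ContDiff ℝ ∞ fun w => (κ j).int (fun y => ρ (y - w)) := fun j => by
    simpa [sub_eq_add_neg, add_comm] using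
        (κ j).contDiff_int_comp hρ (s := -1) (t := 1) (by simp) (by simp)
  have hc1 : ∀ i j, ContDiff ℝ ∞ fun w => (π i).int fun p => a' i j (w + p) := fun i j => by
    simpa using (π i).contDiff_int_comp (ha' i j) (s := 1) (t := 1) (by simp) (by simp)
  refine ⟨θ, σ, fun j => (hc0 j).sub (ContDiff.sum fun i _ => hc1 i j), fun X hX => ?_⟩
  have key : ∀ j, ∀ g, IsTest g (Metric.ball w₀ r) → (κ j).int g = (∫ z, θ j z * g z) +
      ∑ i, (κ i).int fun z => (π i).int fun p => fderiv ℝ g (z - p) (bv j) := by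
    intro j g hg
    set Y : Fin m → Euc m → ℝ := fun i z => (π i).int fun p => g (z - p) with hY
    have hYt : ∀ i, IsTest (Y i) (Metric.ball w₀ (2 * r)) := fun i => by
      rw [two_mul]; exact (π i).isTest_int_sub (hπ i) hg
    have hgc := hg.isCc
    have hdiv : ∀ z, divg Y z = g z - ∫ u, ρ u * g (z - u) := fun z => by
      rw [divg_int_sub hg, hhom g (hg.mono (subset_univ _))]
    have hdivc : IsCc (divg Y) := (isTest_divg hYt).isCc
    have hmoll : (κ j).int g = (κ j).int (fun y => ∫ u, ρ u * g (y - u)) + (κ j).int (divg Y) := by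
      have e : (fun y => ∫ u, ρ u * g (y - u)) = fun y => g y - divg Y y := by
        funext y; rw [hdiv]; ring
      rw [e, (κ j).int_sub hgc hdivc]
      ring
    -- The exterior derivative exchanges the indices `i` and `j`.
    have h1 : (κ j).int (divg Y) = ∑ i, ((κ i).int (fun z => fderiv ℝ (Y i) z (bv j)) -
        ∫ z, a i j z * Y i z) := by
      rw [show divg Y = fun z => ∑ i, fderiv ℝ (Y i) z (bv i) from rfl,
        (κ j).int_sum _ fun i => ((hYt i).fderiv _).isCc]
      refine Finset.sum_congr rfl fun i _ => ?_
      have := h i j (Y i) ((hYt i).mono (Metric.ball_subset_ball (by linarith)))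
      linarith
    have h2 : ∀ i, ∫ z, a i j z * Y i z = ∫ w, g w * (π i).int fun p => a' i j (w + p) := by
      intro i
      rw [← (π i).integral_mul_int_sub (ha' i j).isCc hgc]
      exact (hYt i).integral_congr fun z hz => (hae i j z hz).symm
    have h3 : ∀ i, (κ i).int (fun z => fderiv ℝ (Y i) z (bv j)) =
        (κ i).int fun z => (π i).int fun p => fderiv ℝ g (z - p) (bv j) := fun i =>
      congrArg _ (funext fun z => (π i).fderiv_int_sub hg z (bv j))
    rw [hmoll, h1, (κ j).int_mollify hρ.isCc hgc, Finset.sum_sub_distrib]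
    simp_rw [h2, h3]
    have hi0 : Integrable fun w => g w * (κ j).int fun y => ρ (y - w) :=
      (hg.continuous.mul (hc0 j).continuous).integrable_of_hasCompactSupport hg.2.mul_right
    have hi1 : ∀ i, Integrable fun w => g w * (π i).int fun p => a' i j (w + p) := fun i =>
      (hg.continuous.mul (hc1 i j).continuous).integrable_of_hasCompactSupport hg.2.mul_right
    have h4 : ∫ z, θ j z * g z = (∫ w, g w * (κ j).int (fun y => ρ (y - w))) -
        ∑ i, ∫ w, g w * (π i).int fun p => a' i j (w + p) := by
      rw [← integral_finsetSum _ fun i _ => hi1 i,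
        ← integral_sub hi0 (integrable_finsetSum _ fun i _ => hi1 i)]
      refine integral_congr_ae (Eventually.of_forall fun w => ?_)
      simp only [hθ]
      rw [← Finset.mul_sum]
      ring
    rw [h4]
    ring
  have hdivX : IsCc (divg X) := (isTest_divg hX).isCc
  rw [Finset.sum_congr rfl fun j _ => key j (X j) (hX j), Finset.sum_add_distrib, hσ' _ hdivX,
    sub_neg_eq_add, Finset.sum_comm]
  congr 1
  refine Finset.sum_congr rfl fun i _ => ?_
  have hcc : ∀ j z, IsCc fun p => fderiv ℝ (X j) (z - p) (bv j) := fun j z =>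
    ⟨((hX j).fderiv _).continuous.comp (by fun_prop),
      ((hX j).fderiv _).2.comp_homeomorph (Homeomorph.subLeft z)⟩
  have hcc' : ∀ j, IsCc fun z => (π i).int fun p => fderiv ℝ (X j) (z - p) (bv j) := fun j =>
    ((π i).isTest_int_sub (hπ i) ((hX j).fderiv (bv j))).isCc
  rw [← (κ i).int_sum _ hcc']
  congr 1
  funext z
  rw [← (π i).int_sum _ fun j => hcc j z]
  rfl

end Regularity

/-! ### The adjugate pairing -/

section Adjugate

open Matrix

variable {m : ℕ}

/-- The rows of the matrix of a linear map. -/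
def linRows (A : Euc m →L[ℝ] Euc m) : Fin m → Fin m → ℝ := fun p k => A (bv k) p

/-- The components of a covector. -/
def covRow (ξ : Euc m →L[ℝ] ℝ) : Fin m → ℝ := fun k => ξ (bv k)

/-- The pairing `ξ(adj(A) v)` of a covector with the adjugate of a linear map, expanded in `v`:
its `j`-th coefficient is the determinant of `A` with `j`-th row replaced by `ξ`. -/
def cofForm (A : Euc m →L[ℝ] Euc m) (ξ : Euc m →L[ℝ] ℝ) (v : Euc m) : ℝ :=
  ∑ j, v j * rowDet m (Function.update (linRows A) j (covRow ξ))

theorem jacRows_eq_linRows (σ : Euc m → Euc m) (z : Euc m) :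
    jacRows σ z = linRows (fderiv ℝ σ z) := rfl

theorem rowDet_linRows (A : Euc m →L[ℝ] Euc m) : rowDet m (linRows A) = A.det := by
  have h := rowDet_jacRows A 0
  rwa [jacRows_eq_linRows, A.fderiv] at h

theorem det_of_linRows (A : Euc m →L[ℝ] Euc m) : (Matrix.of (linRows A)).det = A.det :=
  rowDet_linRows A

theorem of_linRows_mulVec (A : Euc m →L[ℝ] Euc m) (v : Euc m) :
    Matrix.of (linRows A) *ᵥ (fun k => v k) = fun p => A v p := by
  funext p
  conv_rhs => rw [← sum_smul_bv v, map_sum]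
  simp [Matrix.mulVec, dotProduct, linRows, mul_comm]

theorem of_linRows_comp (A B : Euc m →L[ℝ] Euc m) :
    Matrix.of (linRows (A.comp B)) = Matrix.of (linRows A) * Matrix.of (linRows B) := by
  ext p k
  have h := congrFun (of_linRows_mulVec A (B (bv k))) p
  rw [Matrix.mul_apply]
  exact h.symm

theorem covRow_comp (ξ : Euc m →L[ℝ] ℝ) (P : Euc m →L[ℝ] Euc m) :
    covRow (ξ.comp P) = covRow ξ ᵥ* Matrix.of (linRows P) := by
  funext k
  simp only [covRow, ContinuousLinearMap.comp_apply, Matrix.vecMul, dotProduct, Matrix.of_apply,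
    linRows]
  conv_lhs => rw [← sum_smul_bv (P (bv k)), map_sum]
  simp [mul_comm]

theorem cofForm_eq (A : Euc m →L[ℝ] Euc m) (ξ : Euc m →L[ℝ] ℝ) (v : Euc m) :
    cofForm A ξ v = covRow ξ ⬝ᵥ ((Matrix.of (linRows A)).adjugate *ᵥ fun k => v k) := by
  have h : ∀ j, rowDet m (Function.update (linRows A) j (covRow ξ)) =
      ((Matrix.of (linRows A))ᵀ.adjugate *ᵥ covRow ξ) j := by
    intro j
    rw [← Matrix.cramer_eq_adjugate_mulVec, Matrix.cramer_transpose_apply]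
    rfl
  simp only [cofForm, h]
  rw [← Matrix.adjugate_transpose, Matrix.mulVec_transpose, Matrix.dotProduct_mulVec,
    dotProduct_comm]
  rfl

theorem cofForm_comp {Q Q' : Euc m →L[ℝ] Euc m} (hQ : ∀ v, Q (Q' v) = v)
    (A P : Euc m →L[ℝ] Euc m) (ξ : Euc m →L[ℝ] ℝ) (v : Euc m) :
    cofForm (Q.comp (A.comp P)) (ξ.comp P) v = Q.det * P.det * cofForm A ξ (Q' v) := by
  have h1 : (fun k => v k) = Matrix.of (linRows Q) *ᵥ (fun k => Q' v k) := by
    rw [of_linRows_mulVec, hQ]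
  have h2 : ∀ MP MA MQ : Matrix (Fin m) (Fin m) ℝ,
      MP * ((MP.adjugate * MA.adjugate * MQ.adjugate) * MQ) =
        (MQ.det * MP.det) • MA.adjugate := by
    intro MP MA MQ
    calc MP * ((MP.adjugate * MA.adjugate * MQ.adjugate) * MQ)
        = (MP * MP.adjugate) * MA.adjugate * (MQ.adjugate * MQ) := by simp only [mul_assoc]
      _ = (MQ.det * MP.det) • MA.adjugate := by
        rw [Matrix.mul_adjugate, Matrix.adjugate_mul]
        simp [smul_smul]
  rw [cofForm_eq, cofForm_eq, of_linRows_comp, of_linRows_comp, covRow_comp,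
    Matrix.adjugate_mul_distrib, Matrix.adjugate_mul_distrib, ← Matrix.dotProduct_mulVec, h1,
    Matrix.mulVec_mulVec, Matrix.mulVec_mulVec, Matrix.mul_assoc, h2, Matrix.smul_mulVec,
    dotProduct_smul, smul_eq_mul, det_of_linRows, det_of_linRows]

theorem cofForm_self (A : Euc m →L[ℝ] Euc m) (ξ : Euc m →L[ℝ] ℝ) (v : Euc m) :
    cofForm A (ξ.comp A) v = A.det * ξ v := by
  rw [cofForm_eq, covRow_comp, ← Matrix.dotProduct_mulVec, Matrix.mulVec_mulVec,
    Matrix.mul_adjugate, det_of_linRows, Matrix.smul_mulVec, Matrix.one_mulVec, dotProduct_smul,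
    smul_eq_mul]
  congr 1
  conv_rhs => rw [← sum_smul_bv v, map_sum]
  simp [dotProduct, covRow, mul_comm]

theorem cofForm_smul (A : Euc m →L[ℝ] Euc m) (ξ : Euc m →L[ℝ] ℝ) (c : ℝ) (v : Euc m) :
    cofForm A ξ (c • v) = c * cofForm A ξ v := by
  simp only [cofForm, Finset.mul_sum]
  exact Finset.sum_congr rfl fun i _ => by simp [mul_assoc]

theorem cofForm_zero (A : Euc m →L[ℝ] Euc m) (ξ : Euc m →L[ℝ] ℝ) : cofForm A ξ 0 = 0 := by
  simp [cofForm]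

theorem continuous_cofForm : Continuous fun p : (Euc m →L[ℝ] Euc m) × (Euc m →L[ℝ] ℝ) × Euc m =>
    cofForm p.1 p.2.1 p.2.2 := by
  unfold cofForm
  refine continuous_finsetSum _ fun j _ => ?_
  refine Continuous.mul (by fun_prop) ((rowDet m).cont.comp ?_)
  refine Continuous.update ?_ j ?_
  · refine continuous_pi fun p => continuous_pi fun k => ?_
    exact (EuclideanSpace.proj (𝕜 := ℝ) p).continuous.comp (continuous_fst.clm_apply continuous_const)
  · exact continuous_pi fun k => (continuous_fst.comp continuous_snd).clm_apply continuous_const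

/-- The divergence-free field `∂ᵢg eⱼ - ∂ⱼg eᵢ`. -/
def curlField (g : Euc m → ℝ) (i j : Fin m) : Fin m → Euc m → ℝ := fun k z =>
  (if k = j then fderiv ℝ g z (bv i) else 0) - if k = i then fderiv ℝ g z (bv j) else 0

/-- The vector field with given components. -/
def fieldOf (X : Fin m → Euc m → ℝ) (z : Euc m) : Euc m := WithLp.toLp 2 fun i => X i z

theorem fieldOf_apply (X : Fin m → Euc m → ℝ) (z : Euc m) (i : Fin m) : fieldOf X z i = X i z := rfl

/-- The vector `ℓ(eᵢ) eⱼ - ℓ(eⱼ) eᵢ`. -/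
def curlVec (l : Euc m →L[ℝ] ℝ) (i j : Fin m) : Euc m :=
  WithLp.toLp 2 fun k => (if k = j then l (bv i) else 0) - if k = i then l (bv j) else 0

theorem fieldOf_curlField (g : Euc m → ℝ) (i j : Fin m) (z : Euc m) :
    fieldOf (curlField g i j) z = curlVec (fderiv ℝ g z) i j := rfl

theorem covRow_comp_eq_sum (l : Euc m →L[ℝ] ℝ) (A : Euc m →L[ℝ] Euc m) :
    covRow (l.comp A) = ∑ p, l (bv p) • linRows A p := by
  funext k
  simp only [covRow, Finset.sum_apply, Pi.smul_apply, smul_eq_mul, linRows,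
    ContinuousLinearMap.comp_apply]
  conv_lhs => rw [← sum_smul_bv (A (bv k)), map_sum]
  simp [mul_comm]

theorem cofForm_curlVec (A : Euc m →L[ℝ] Euc m) (ξ l : Euc m →L[ℝ] ℝ) {i j : Fin m}
    (hij : i ≠ j) :
    cofForm A ξ (curlVec l i j) = rowDet m (Function.update (Function.update (linRows A) i
      (covRow (l.comp A))) j (covRow ξ)) := by
  set B := linRows A with hB
  have hlin : rowDet m (Function.update (Function.update B i (∑ p, l (bv p) • B p)) j
      (covRow ξ)) =
      ∑ p, l (bv p) * rowDet m (Function.update (Function.update B i (B p)) j (covRow ξ)) := by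
    rw [Function.update_comm hij]
    change (rowDet m).toContinuousLinearMap (Function.update B j (covRow ξ)) i _ = _
    rw [map_sum]
    refine Finset.sum_congr rfl fun p _ => ?_
    rw [map_smul, smul_eq_mul]
    congr 1
    change rowDet m (Function.update (Function.update B j (covRow ξ)) i (B p)) = _
    rw [Function.update_comm hij]
  have hp : ∀ p, rowDet m (Function.update (Function.update B i (B p)) j (covRow ξ)) =
      (if p = i then rowDet m (Function.update B j (covRow ξ)) else 0) -
        if p = j then rowDet m (Function.update B i (covRow ξ)) else 0 := by
    intro p
    by_cases h1 : p = i
    · subst h1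
      simp [hij]
    · by_cases h2 : p = j
      · subst h2
        rw [rowDet_update_update_swap hij, Function.update_comm hij, Function.update_eq_self]
        simp [h1]
      · rw [if_neg h1, if_neg h2, sub_zero]
        refine rowDet_eq_zero (i := i) (j := p) (Ne.symm h1) ?_
        simp [Function.update_of_ne hij, Function.update_of_ne h2, Function.update_of_ne h1]
  rw [covRow_comp_eq_sum, hlin]
  simp only [hp, cofForm, curlVec, mul_sub, sub_mul, Finset.sum_sub_distrib,
    ite_mul, mul_ite, zero_mul, mul_zero, Finset.sum_ite_eq', Finset.mem_univ, if_true]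
  rfl

theorem rowDet_covRow_comp (ξ : Fin m → Euc m →L[ℝ] ℝ) (P : Euc m →L[ℝ] Euc m) :
    rowDet m (fun p => covRow ((ξ p).comp P)) = P.det * rowDet m fun p => covRow (ξ p) := by
  have h : Matrix.of (fun p => covRow ((ξ p).comp P)) =
      Matrix.of (fun p => covRow (ξ p)) * Matrix.of (linRows P) := by
    ext p k
    exact congrFun (covRow_comp (ξ p) P) k
  rw [rowDet_apply, rowDet_apply, h, Matrix.det_mul, det_of_linRows, mul_comm]

/-- The coordinate covector of a linear map. -/
def rowCov (A : Euc m →L[ℝ] Euc m) (p : Fin m) : Euc m →L[ℝ] ℝ :=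
  (EuclideanSpace.proj (𝕜 := ℝ) p).comp A

theorem rowDet_update_update_comp (A P : Euc m →L[ℝ] Euc m) (ξ ξ' : Euc m →L[ℝ] ℝ)
    (i j : Fin m) :
    rowDet m (Function.update (Function.update (linRows (A.comp P)) i (covRow (ξ.comp P))) j
      (covRow (ξ'.comp P))) =
    P.det * rowDet m (Function.update (Function.update (linRows A) i (covRow ξ)) j
      (covRow ξ')) := by
  have h := rowDet_covRow_comp (Function.update (Function.update (rowCov A) i ξ) j ξ') P
  have e : ∀ (C : Euc m →L[ℝ] Euc m) (a b : Euc m →L[ℝ] ℝ),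
      Function.update (Function.update (linRows C) i (covRow a)) j (covRow b) =
      fun p => covRow (Function.update (Function.update (rowCov C) i a) j b p) := by
    intro C a b
    funext p
    by_cases hj : p = j
    · subst hj; simp
    · by_cases hi : p = i
      · subst hi; simp [Function.update_of_ne hj]
      · simp only [Function.update_of_ne hj, Function.update_of_ne hi]
        rfl
  rw [e, e, ← h]
  congr 1
  funext p
  by_cases hj : p = j
  · subst hj; simp
  · by_cases hi : p = i
    · subst hi; simp [Function.update_of_ne hj]
    · simp only [Function.update_of_ne hj, Function.update_of_ne hi]
      rfl

theorem divg_curlField {g : Euc m → ℝ} (hg : ContDiff ℝ ∞ g) (i j : Fin m) (z : Euc m) :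
    divg (curlField g i j) z = 0 := by
  have hd : ∀ i, Differentiable ℝ fun z => fderiv ℝ g z (bv i) := fun i =>
    ((hg.fderiv_right (m := ∞) (by simp)).clm_apply contDiff_const).differentiable (by simp)
  have h1 : ∀ k, fderiv ℝ (curlField g i j k) z (bv k) =
      (if k = j then fderiv ℝ (fun z => fderiv ℝ g z (bv i)) z (bv j) else 0) -
        if k = i then fderiv ℝ (fun z => fderiv ℝ g z (bv j)) z (bv i) else 0 := by
    intro k
    have e : curlField g i j k = fun z => (if k = j then fderiv ℝ g z (bv i) else 0) -
      if k = i then fderiv ℝ g z (bv j) else 0 := rfl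
    rw [e, fderiv_fun_sub]
    · by_cases h1 : k = j <;> by_cases h2 : k = i <;> simp [h1, h2] <;> simp_all
    · by_cases h : k = j
      · simp only [h, if_true]; exact hd i z
      · simp [h]
    · by_cases h : k = i
      · simp only [h, if_true]; exact hd j z
      · simp [h]
  have hs : ∀ a b : Fin m, fderiv ℝ (fun z => fderiv ℝ g z (bv a)) z (bv b) =
      fderiv ℝ (fderiv ℝ g) z (bv b) (bv a) := by
    intro a b
    rw [fderiv_clm_apply ((hg.fderiv_right (m := ∞) (by simp)).differentiable (by simp) z)
      (differentiableAt_const _)]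
    simp
  simp only [divg, h1, Finset.sum_sub_distrib, Finset.sum_ite_eq', Finset.mem_univ, if_true, hs]
  have := (hg.contDiffAt (x := z)).isSymmSndFDerivAt (by simpa using WithTop.coe_le_coe.2 (le_top (a := (2 : ℕ∞))))
  rw [this.eq, sub_self]

theorem IsTest.curlField {g : Euc m → ℝ} {U : Set (Euc m)} (h : IsTest g U) (i j k : Fin m) :
    IsTest (curlField g i j k) U := by
  have h0 : IsTest (fun _ : Euc m => (0 : ℝ)) U :=
    ⟨contDiff_const, HasCompactSupport.zero, by simp [tsupport]⟩
  have hsub : ∀ {a b : Euc m → ℝ}, IsTest a U → IsTest b U → IsTest (fun z => a z - b z) U :=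
    fun ha hb => ⟨ha.1.sub hb.1, ha.2.sub hb.2,
      (tsupport_sub _ _).trans (Set.union_subset ha.3 hb.3)⟩
  have hite : ∀ (p : Prop) [Decidable p] {a : Euc m → ℝ}, IsTest a U →
      IsTest (fun z => if p then a z else 0) U := fun p _ a ha => by
    by_cases hp : p
    · simpa [hp] using ha
    · simpa [hp] using h0
  exact hsub (hite _ (h.fderiv _)) (hite _ (h.fderiv _))

end Adjugate

/-! ### Densities on compact manifolds -/

section Density

open MeasureTheory Filter Topology Set

theorem exists_finite_partition {E : Type*} [NormedAddCommGroup E] [NormedSpace ℝ E]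
    [FiniteDimensional ℝ E] {M : Type*} [TopologicalSpace M] [T2Space M] [CompactSpace M]
    [ChartedSpace E M] [IsManifold 𝓘(ℝ, E) ∞ M] (U : M → Set M) (hU : ∀ x, IsOpen (U x))
    (hx : ∀ x, x ∈ U x) :
    ∃ (s : Finset M) (χ : M → M → ℝ), (∀ k, ContMDiff 𝓘(ℝ, E) 𝓘(ℝ, ℝ) ∞ (χ k)) ∧
      (∀ k x, 0 ≤ χ k x) ∧ (∀ k, tsupport (χ k) ⊆ U k) ∧ ∀ x, ∑ k ∈ s, χ k x = 1 := by
  obtain ⟨ρ, hρ⟩ := SmoothPartitionOfUnity.exists_isSubordinate 𝓘(ℝ, E) isClosed_univ U hU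
    fun x _ => mem_iUnion.2 ⟨x, hx x⟩
  have hfin : {k | (Function.support (ρ k)).Nonempty}.Finite :=
    ρ.locallyFinite.finite_nonempty_of_compact
  refine ⟨hfin.toFinset, fun k => ρ k, fun k => (ρ k).contMDiff, fun k x => ρ.nonneg k x, hρ,
    fun x => ?_⟩
  rw [← ρ.sum_eq_one (mem_univ x), finsum_eq_sum_of_support_subset]
  intro k hk
  simp only [Finite.coe_toFinset, mem_ofPred_eq]
  exact ⟨x, hk⟩

theorem image_transition {E M : Type*} [TopologicalSpace E] [TopologicalSpace M]
    (e e' : OpenPartialHomeomorph M E) :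
    inCharts id e e' '' chartDomain id e e' = chartDomain id e' e := by
  ext w
  constructor
  · rintro ⟨z, ⟨hz, hz'⟩, rfl⟩
    have hx : e.symm z ∈ e'.source := hz'
    refine ⟨e'.map_source hx, ?_⟩
    simp only [mem_preimage, inCharts, id, e'.left_inv hx]
    exact e.map_target hz
  · rintro ⟨hw, hw'⟩
    have hx : e'.symm w ∈ e.source := hw'
    refine ⟨e (e'.symm w), ⟨e.map_source hx, ?_⟩, ?_⟩
    · simp only [mem_preimage, id, e.left_inv hx]
      exact e'.map_target hw
    · simp only [inCharts, id, e.left_inv hx, e'.right_inv hw]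

theorem injOn_transition {E M : Type*} [TopologicalSpace E] [TopologicalSpace M]
    (e e' : OpenPartialHomeomorph M E) :
    InjOn (inCharts id e e') (chartDomain id e e') := by
  intro z hz w hw h
  have h1 : e.symm z = e.symm w := e'.injOn hz.2 hw.2 h
  exact e.symm.injOn hz.1 hw.1 h1

variable {m : ℕ} {M : Type*} [TopologicalSpace M] [ChartedSpace (Euc m) M]

/-- The coordinate expression of a density `γ`, given by its values on the standard frames of the
tangent spaces. -/
def dens (e : OpenPartialHomeomorph M (Euc m)) (γ : M → ℝ) (z : Euc m) : ℝ :=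
  γ (e.symm z) * |(rawDeriv (E := Euc m) (F := Euc m) e.symm z).det|

/-- Densities with continuous coordinate expressions. -/
def ContDens (γ : M → ℝ) : Prop :=
  ∀ k : M, ContinuousOn (dens (chartAt (Euc m) k) γ) (chartAt (Euc m) k).target

theorem dens_mul (e : OpenPartialHomeomorph M (Euc m)) (a γ : M → ℝ) (z : Euc m) :
    dens e (fun x => a x * γ x) z = a (e.symm z) * dens e γ z := mul_assoc _ _ _

theorem dens_sum (e : OpenPartialHomeomorph M (Euc m)) {ι : Type*} (s : Finset ι) (γ : ι → M → ℝ)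
    (z : Euc m) : dens e (fun x => ∑ i ∈ s, γ i x) z = ∑ i ∈ s, dens e (γ i) z :=
  Finset.sum_mul _ _ _

theorem ContDens.mul {γ a : M → ℝ} (h : ContDens (m := m) γ) (ha : Continuous a) :
    ContDens (m := m) fun x => a x * γ x := fun k =>
  ((ha.comp_continuousOn (chartAt (Euc m) k).continuousOn_symm).mul (h k)).congr
    fun z _ => dens_mul _ _ _ z

theorem ContDens.integrableOn {γ : M → ℝ} (h : ContDens (m := m) γ) {k : M} {C : Set M}
    (hC : IsCompact C) (hCk : C ⊆ (chartAt (Euc m) k).source) (hγ : ∀ x ∉ C, γ x = 0) :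
    IntegrableOn (dens (chartAt (Euc m) k) γ) (chartAt (Euc m) k).target := by
  set e := chartAt (Euc m) k
  have hK : IsCompact (e '' C) := hC.image_of_continuousOn (e.continuousOn.mono hCk)
  have hKt : e '' C ⊆ e.target := by
    rintro _ ⟨x, hx, rfl⟩
    exact e.map_source (hCk hx)
  refine ((h k).mono hKt |>.integrableOn_compact hK).of_forall_sdiff_eq_zero
    e.open_target.measurableSet fun z hz => ?_
  have : e.symm z ∉ C := fun h' => hz.2 ⟨_, h', e.right_inv hz.1⟩
  exact mul_eq_zero_of_left (hγ _ this) _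

variable [IsManifold 𝓘(ℝ, Euc m) ∞ M]

theorem det_chart_mul_det_symm {e : OpenPartialHomeomorph M (Euc m)} (he : e ∈ atlas (Euc m) M)
    {x : M} (hx : x ∈ e.source) :
    (rawDeriv (E := Euc m) (F := Euc m) e x).det *
      (rawDeriv (E := Euc m) (F := Euc m) e.symm (e x)).det = 1 := by
  have h := congrArg ContinuousLinearMap.det (rawDeriv_symm_comp he hx)
  rw [ContinuousLinearMap.det_comp] at h
  rw [mul_comm, h]
  exact LinearMap.det_id

theorem det_rawDeriv_symm_ne_zero {e : OpenPartialHomeomorph M (Euc m)}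
    (he : e ∈ atlas (Euc m) M) {x : M} (hx : x ∈ e.source) :
    (rawDeriv (E := Euc m) (F := Euc m) e.symm (e x)).det ≠ 0 :=
  right_ne_zero_of_mul_eq_one (det_chart_mul_det_symm he hx)

/-- The derivative of a transition map, which is the expression of the identity in two charts. -/
theorem fderiv_transition {e e' : OpenPartialHomeomorph M (Euc m)} (he : e ∈ atlas (Euc m) M)
    (he' : e' ∈ atlas (Euc m) M) {z : Euc m} (hz : z ∈ chartDomain id e e') :
    fderiv ℝ (inCharts id e e') z = (rawDeriv (E := Euc m) (F := Euc m) e' (e.symm z)).comp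
      (rawDeriv (E := Euc m) (F := Euc m) e.symm z) := by
  rw [fderiv_inCharts contMDiff_id he he' hz, rawDeriv_id]
  rfl

theorem dens_transition {e e' : OpenPartialHomeomorph M (Euc m)} (he : e ∈ atlas (Euc m) M)
    (he' : e' ∈ atlas (Euc m) M) (γ : M → ℝ) {z : Euc m} (hz : z ∈ chartDomain id e e') :
    |(fderiv ℝ (inCharts id e e') z).det| * dens e' γ (inCharts id e e' z) = dens e γ z := by
  have hx : e.symm z ∈ e'.source := hz.2
  rw [fderiv_transition he he' hz, ContinuousLinearMap.det_comp]
  simp only [dens, inCharts, id]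
  rw [e'.left_inv hx, abs_mul]
  have h := congrArg abs (det_chart_mul_det_symm he' hx)
  rw [abs_mul, abs_one] at h
  linear_combination (γ (e.symm z) * |(rawDeriv (E := Euc m) (F := Euc m) e.symm z).det|) * h

theorem integral_transition {e e' : OpenPartialHomeomorph M (Euc m)} (he : e ∈ atlas (Euc m) M)
    (he' : e' ∈ atlas (Euc m) M) (g : Euc m → ℝ) :
    ∫ w in chartDomain id e' e, g w =
      ∫ z in chartDomain id e e', |(fderiv ℝ (inCharts id e e') z).det| * g (inCharts id e e' z) := by
  have hm : MeasurableSet (chartDomain id e e') :=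
    (isOpen_chartDomain continuous_id e e').measurableSet
  rw [← image_transition e e', integral_image_eq_integral_abs_det_fderiv_smul volume hm
    (fun z hz => (hasFDerivAt_inCharts contMDiff_id he he' hz).differentiableAt.hasFDerivAt.hasFDerivWithinAt)
    (injOn_transition e e')]
  rfl

variable (m M) in
/-- A finite smooth partition of unity subordinate to preferred charts. -/
structure ChartPartition where
  /-- The centres of the charts in use. -/
  s : Finset M
  /-- The functions of the partition. -/
  χ : M → M → ℝ
  contMDiff : ∀ k, ContMDiff 𝓘(ℝ, Euc m) 𝓘(ℝ, ℝ) ∞ (χ k)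
  nonneg : ∀ k x, 0 ≤ χ k x
  tsupport_subset : ∀ k, tsupport (χ k) ⊆ (chartAt (Euc m) k).source
  sum_eq_one : ∀ x, ∑ k ∈ s, χ k x = 1

theorem nonempty_chartPartition [T2Space M] [CompactSpace M] : Nonempty (ChartPartition m M) := by
  obtain ⟨s, χ, h1, h2, h3, h4⟩ := exists_finite_partition (E := Euc m)
    (fun k : M => (chartAt (Euc m) k).source) (fun k => (chartAt (Euc m) k).open_source)
    (fun k => mem_chart_source _ k)
  exact ⟨⟨s, χ, h1, h2, h3, h4⟩⟩

namespace ChartPartition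

variable (P : ChartPartition m M)

/-- The integral of a density. -/
def integ (γ : M → ℝ) : ℝ :=
  ∑ k ∈ P.s, ∫ z in (chartAt (Euc m) k).target,
    dens (chartAt (Euc m) k) (fun x => P.χ k x * γ x) z

omit [IsManifold 𝓘(ℝ, Euc m) ∞ M] in
theorem eq_zero_of_notMem {k x : M} (h : x ∉ tsupport (P.χ k)) : P.χ k x = 0 :=
  image_eq_zero_of_notMem_tsupport h

omit [IsManifold 𝓘(ℝ, Euc m) ∞ M] in
theorem integrableOn [CompactSpace M] {γ : M → ℝ} (h : ContDens (m := m) γ) (k : M) :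
    IntegrableOn (dens (chartAt (Euc m) k) fun x => P.χ k x * γ x) (chartAt (Euc m) k).target :=
  (h.mul (P.contMDiff k).continuous).integrableOn (isClosed_tsupport _).isCompact
    (P.tsupport_subset k) fun x hx => by simp [P.eq_zero_of_notMem hx]

omit [IsManifold 𝓘(ℝ, Euc m) ∞ M] in
theorem integ_sum [CompactSpace M] {ι : Type*} (s : Finset ι) {γ : ι → M → ℝ}
    (h : ∀ i, ContDens (m := m) (γ i)) :
    P.integ (fun x => ∑ i ∈ s, γ i x) = ∑ i ∈ s, P.integ (γ i) := by
  simp only [integ]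
  rw [Finset.sum_comm]
  refine Finset.sum_congr rfl fun k _ => ?_
  rw [← integral_finsetSum _ fun i _ => P.integrableOn (h i) k]
  congr 1
  funext z
  simp only [Finset.mul_sum]
  exact dens_sum _ _ _ _

/-- The integral of a density supported in a preferred chart can be computed in that chart. -/
theorem integ_eq {γ : M → ℝ} (h : ContDens (m := m) γ) {l : M} {C : Set M}
    (hC : IsCompact C) (hCl : C ⊆ (chartAt (Euc m) l).source) (hγ : ∀ x ∉ C, γ x = 0) :
    P.integ γ = ∫ z in (chartAt (Euc m) l).target, dens (chartAt (Euc m) l) γ z := by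
  set e := chartAt (Euc m) l
  have he : e ∈ atlas (Euc m) M := chart_mem_atlas _ l
  have hk : ∀ k, ∫ z in (chartAt (Euc m) k).target,
      dens (chartAt (Euc m) k) (fun x => P.χ k x * γ x) z =
      ∫ z in e.target, dens e (fun x => P.χ k x * γ x) z := by
    intro k
    set e' := chartAt (Euc m) k
    have he' : e' ∈ atlas (Euc m) M := chart_mem_atlas _ k
    have h1 : ∫ z in e'.target, dens e' (fun x => P.χ k x * γ x) z =
        ∫ z in chartDomain id e' e, dens e' (fun x => P.χ k x * γ x) z := by
      refine setIntegral_eq_of_subset_of_forall_sdiff_eq_zero e'.open_target.measurableSet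
        inter_subset_left fun z hz => ?_
      have : e'.symm z ∉ C := fun h' => hz.2 ⟨hz.1, hCl h'⟩
      simp [dens, hγ _ this]
    have h2 : ∫ z in e.target, dens e (fun x => P.χ k x * γ x) z =
        ∫ z in chartDomain id e e', dens e (fun x => P.χ k x * γ x) z := by
      refine setIntegral_eq_of_subset_of_forall_sdiff_eq_zero e.open_target.measurableSet
        inter_subset_left fun z hz => ?_
      have : e.symm z ∉ tsupport (P.χ k) := fun h' => hz.2 ⟨hz.1, P.tsupport_subset k h'⟩
      simp [dens, P.eq_zero_of_notMem this]
    rw [h1, h2, integral_transition he he']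
    exact setIntegral_congr_fun (isOpen_chartDomain continuous_id e e').measurableSet
      fun z hz => dens_transition he he' _ hz
  simp only [integ, hk]
  rw [← integral_finsetSum]
  · congr 1
    funext z
    rw [← dens_sum]
    simp only [← Finset.sum_mul, P.sum_eq_one, one_mul]
  · exact fun k _ => (h.mul (P.contMDiff k).continuous).integrableOn hC hCl
      fun x hx => by simp [hγ x hx]

omit [IsManifold 𝓘(ℝ, Euc m) ∞ M] in
theorem integ_nonneg {γ : M → ℝ} (h0 : ∀ x, 0 ≤ γ x) : 0 ≤ P.integ γ :=
  Finset.sum_nonneg fun _ _ => integral_nonneg fun _ =>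
    mul_nonneg (mul_nonneg (P.nonneg _ _) (h0 _)) (abs_nonneg _)

theorem eq_zero_of_integ_eq_zero [CompactSpace M] {γ : M → ℝ} (h : ContDens (m := m) γ)
    (h0 : ∀ x, 0 ≤ γ x)
    (hI : P.integ γ = 0) (x : M) : γ x = 0 := by
  have hnn : ∀ k z, 0 ≤ dens (chartAt (Euc m) k) (fun x => P.χ k x * γ x) z := fun k z =>
    mul_nonneg (mul_nonneg (P.nonneg _ _) (h0 _)) (abs_nonneg _)
  have h1 := (Finset.sum_eq_zero_iff_of_nonneg fun k _ => integral_nonneg (hnn k)).1 hI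
  obtain ⟨k, hk, hkx⟩ : ∃ k ∈ P.s, P.χ k x ≠ 0 := by
    by_contra! hc
    have := P.sum_eq_one x
    rw [Finset.sum_eq_zero hc] at this
    exact zero_ne_one this
  set e := chartAt (Euc m) k
  have hx : x ∈ e.source := P.tsupport_subset k (subset_tsupport _ hkx)
  have h2 := (setIntegral_eq_zero_iff_of_nonneg_ae (Eventually.of_forall (hnn k))
    (P.integrableOn h k)).1 (h1 k hk)
  have h3 := Measure.eqOn_open_of_ae_eq h2 e.open_target (h.mul (P.contMDiff k).continuous k)
    continuousOn_const (e.map_source hx)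
  have hex : (chartAt (Euc m) k).symm (e x) = x := e.left_inv hx
  simp only [dens, Pi.zero_apply, mul_eq_zero, abs_eq_zero, hex] at h3
  exact (h3.resolve_right (det_rawDeriv_symm_ne_zero (chart_mem_atlas _ k) hx)).resolve_left hkx

omit [IsManifold 𝓘(ℝ, Euc m) ∞ M] in
/-- The push-forward of a continuous density is a finite signed measure. -/
theorem exists_map [CompactSpace M] {γ : M → ℝ} (h : ContDens (m := m) γ)
    {a : M → Euc m} (ha : Continuous a) :
    ∃ κ : FinSigned m, κ.Represents fun g => P.integ fun x => g (a x) * γ x := by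
  have hk : ∀ k : M, ∃ κ : FinSigned m, κ.Represents fun g => ∫ z in (chartAt (Euc m) k).target,
      dens (chartAt (Euc m) k) (fun x => P.χ k x * (g (a x) * γ x)) z := by
    intro k
    obtain ⟨κ, hκ⟩ := FinSigned.exists_map _ (P.integrableOn h k)
      (a := fun z => a ((chartAt (Euc m) k).symm z))
      ((ha.comp_continuousOn (chartAt (Euc m) k).continuousOn_symm).aemeasurable
        (chartAt (Euc m) k).open_target.measurableSet)
    refine ⟨κ, fun g hg => (?_ : _ = _).trans (hκ g hg)⟩
    refine integral_congr_ae (Eventually.of_forall fun z => ?_)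
    simp only [dens]
    ring
  choose κ hκ using hk
  obtain ⟨σ, hσ⟩ := FinSigned.exists_sum P.s κ
  exact ⟨σ, fun g hg => (Finset.sum_congr rfl fun k _ => hκ k g hg).trans (hσ g hg)⟩

end ChartPartition

end Density

/-! ### The transfer of one-forms along a pseudoholomorphic map -/

section Transfer

open MeasureTheory Filter Topology Set Bundle

/-- The coordinate expression of an endomorphism field. -/
def endInChart {E : Type*} [NormedAddCommGroup E] [NormedSpace ℝ E] {M : Type*}
    [TopologicalSpace M] [ChartedSpace E M] (e : OpenPartialHomeomorph M E) (A : M → E →L[ℝ] E)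
    (z : E) : E →L[ℝ] E :=
  (rawDeriv (E := E) (F := E) e (e.symm z)).comp
    ((A (e.symm z)).comp (rawDeriv (E := E) (F := E) e.symm z))

/-- The endomorphism field of an almost complex structure. -/
def AlmostComplexStructure.val {E : Type*} [NormedAddCommGroup E] [NormedSpace ℝ E] {M : Type*}
    [TopologicalSpace M] [ChartedSpace E M] [IsManifold 𝓘(ℝ, E) ∞ M]
    (𝒥 : AlmostComplexStructure E M) : M → E →L[ℝ] E := fun x => 𝒥.J x

theorem continuousOn_endInChart {E : Type*} [NormedAddCommGroup E] [NormedSpace ℝ E] {M : Type*}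
    [TopologicalSpace M] [ChartedSpace E M] [IsManifold 𝓘(ℝ, E) ∞ M]
    (𝒥 : AlmostComplexStructure E M) (k : M) :
    ContinuousOn (endInChart (chartAt E k) 𝒥.val) (chartAt E k).target := by
  set e := chartAt E k
  let V : M → Type _ := fun x : M => TangentSpace 𝓘(ℝ, E) x →L[ℝ] TangentSpace 𝓘(ℝ, E) x
  let t := trivializationAt (E →L[ℝ] E) V k
  have hcont : Continuous fun x : M => (TotalSpace.mk' (E →L[ℝ] E) x (𝒥.J x) : TotalSpace _ V) :=
    𝒥.J.contMDiff.continuous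
  have hbase : t.baseSet = e.source := by
    simp only [t, V]
    rw [hom_trivializationAt_baseSet, TangentBundle.trivializationAt_baseSet, inter_self]
  have h1 : ContinuousOn (fun x : M => (t (TotalSpace.mk' (E →L[ℝ] E) x (𝒥.J x))).2) e.source := by
    refine continuous_snd.comp_continuousOn (t.continuousOn.comp hcont.continuousOn fun x hx => ?_)
    rw [t.mem_source, hbase]
    exact hx
  refine (h1.comp e.continuousOn_symm e.symm.mapsTo).congr fun z hz => ?_
  have hx : e.symm z ∈ e.source := e.map_target hz
  simp only [Function.comp, t, V]
  rw [hom_trivializationAt_apply]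
  simp only [ContinuousLinearMap.inCoordinates]
  rw [TangentBundle.continuousLinearMapAt_trivializationAt hx,
    TangentBundle.symmL_trivializationAt hx]
  have hr : (chartAt E k) (e.symm z) = z := e.right_inv hz
  simp only [extChartAt_coe, extChartAt_coe_symm,
    modelWithCornersSelf_coe, modelWithCornersSelf_coe_symm, range_id, mfderivWithin_univ,
    Function.comp_id, Function.id_comp]
  exact congrArg (fun w => (rawDeriv (E := E) (F := E) e (e.symm z)).comp
    ((𝒥.val (e.symm z)).comp (rawDeriv (E := E) (F := E) e.symm w))) hr.symm

theorem isComplexStructure_val {E : Type*} [NormedAddCommGroup E] [NormedSpace ℝ E] {M : Type*}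
    [TopologicalSpace M] [ChartedSpace E M] [IsManifold 𝓘(ℝ, E) ∞ M]
    (𝒥 : AlmostComplexStructure E M) (x : M) : IsComplexStructure (𝒥.val x) := fun v =>
  𝒥.sq_eq_neg x v

variable {m : ℕ} {N : Type*} [TopologicalSpace N] [ChartedSpace (Euc m) N]

open Classical in
/-- The density on `N` supported in the chart `e` with coordinate expression `g`. -/
def pushDens (e : OpenPartialHomeomorph N (Euc m)) (g : Euc m → ℝ) (y : N) : ℝ :=
  if y ∈ e.source then |(rawDeriv (E := Euc m) (F := Euc m) e y).det| * g (e y) else 0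

open Classical in
/-- The vector field density on `N` supported in the chart `e` with coordinate expression `X`. -/
def pushField (e : OpenPartialHomeomorph N (Euc m)) (X : Euc m → Euc m) (y : N) : Euc m :=
  if y ∈ e.source then |(rawDeriv (E := Euc m) (F := Euc m) e y).det| •
    rawDeriv (E := Euc m) (F := Euc m) e.symm (e y) (X (e y)) else 0

theorem pushDens_of_mem {e : OpenPartialHomeomorph N (Euc m)} {g : Euc m → ℝ} {y : N}
    (hy : y ∈ e.source) : pushDens e g y =
      |(rawDeriv (E := Euc m) (F := Euc m) e y).det| * g (e y) := if_pos hy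

theorem pushField_of_mem {e : OpenPartialHomeomorph N (Euc m)} {X : Euc m → Euc m} {y : N}
    (hy : y ∈ e.source) : pushField e X y = |(rawDeriv (E := Euc m) (F := Euc m) e y).det| •
      rawDeriv (E := Euc m) (F := Euc m) e.symm (e y) (X (e y)) := if_pos hy

theorem pushDens_eq_zero {e : OpenPartialHomeomorph N (Euc m)} {g : Euc m → ℝ} {y : N}
    (hy : y ∈ e.source → g (e y) = 0) : pushDens e g y = 0 := by
  unfold pushDens
  split_ifs with h
  · rw [hy h, mul_zero]
  · rfl

theorem pushField_eq_zero {e : OpenPartialHomeomorph N (Euc m)} {X : Euc m → Euc m} {y : N}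
    (hy : y ∈ e.source → X (e y) = 0) : pushField e X y = 0 := by
  unfold pushField
  split_ifs with h
  · rw [hy h, map_zero, smul_zero]
  · rfl

omit [ChartedSpace (Euc m) N] in
/-- Functions supported in a chart vanish near the points outside of the chart. -/
theorem eventually_chart_eq_zero [T2Space N] {F : Type*} [Zero F]
    {e : OpenPartialHomeomorph N (Euc m)} {g : Euc m → F} (hc : HasCompactSupport g)
    (hg : tsupport g ⊆ e.target) {y : N} (hy : y ∉ e.source) :
    ∀ᶠ y' in 𝓝 y, y' ∈ e.source → g (e y') = 0 := by
  have hK : IsCompact (e.symm '' tsupport g) :=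
    hc.isCompact.image_of_continuousOn (e.continuousOn_symm.mono hg)
  have hyK : y ∉ e.symm '' tsupport g := by
    rintro ⟨w, hw, rfl⟩
    exact hy (e.map_target (hg hw))
  filter_upwards [hK.isClosed.isOpen_compl.mem_nhds hyK] with y' hy' hs
  by_contra h
  exact hy' ⟨e y', subset_tsupport _ h, e.left_inv hs⟩

/-- The covector underlying an alternating form of degree one. -/
def toCov (β : Euc m [⋀^Fin 1]→L[ℝ] ℝ) : Euc m →L[ℝ] ℝ :=
  (ContinuousAlternatingMap.ofSubsingleton ℝ (Euc m) ℝ (0 : Fin 1)).symm β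

theorem toCov_apply (β : Euc m [⋀^Fin 1]→L[ℝ] ℝ) (v : Euc m) : toCov β v = β fun _ => v := rfl

theorem continuous_toCov : Continuous (toCov (m := m)) := by
  refine continuous_clm_apply.2 fun v => ?_
  simp only [toCov_apply]
  fun_prop

theorem toCov_comp (β : Euc m [⋀^Fin 1]→L[ℝ] ℝ) (A : Euc m →L[ℝ] Euc m) :
    toCov (β.compContinuousLinearMap A) = (toCov β).comp A := rfl

variable {M : Type*} [TopologicalSpace M] [ChartedSpace (Euc m) M]
variable [IsManifold 𝓘(ℝ, Euc m) ∞ M] [IsManifold 𝓘(ℝ, Euc m) ∞ N]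

/-- The density on `M` whose integral is the value on `X` of the transfer of `β`: the sign that
turns the Jacobian determinant of `f` into its absolute value, times `β(adj(df) X(f x))`. At a point
where `df` is invertible it is `|det df|` times the value on `X` of the image of `β` under `df`. -/
def transferDens (𝒥 : AlmostComplexStructure (Euc m) M) (𝒥' : AlmostComplexStructure (Euc m) N)
    (f : M → N) (β : RawForm (Euc m) M 1) (X : N → Euc m) (x : M) : ℝ :=
  relSign (𝒥.val x) (𝒥'.val (f x)) *
    cofForm (rawDeriv (E := Euc m) (F := Euc m) f x) (toCov (β.val x)) (X (f x))

/-- The density on `M` whose integral is the value on `γ` of the transfer of the function `1`. -/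
def degDens (f : M → N) (γ : N → ℝ) (x : M) : ℝ :=
  |(rawDeriv (E := Euc m) (F := Euc m) f x).det| * γ (f x)

variable {𝒥 : AlmostComplexStructure (Euc m) M} {𝒥' : AlmostComplexStructure (Euc m) N} {f : M → N}

theorem IsPseudoholomorphic.rawDeriv_comm (hf : IsPseudoholomorphic 𝒥 𝒥' f) (x : M) (v : Euc m) :
    rawDeriv (E := Euc m) (F := Euc m) f x (𝒥.val x v) =
      𝒥'.val (f x) (rawDeriv (E := Euc m) (F := Euc m) f x v) := hf.2 x v

/-- The transfer of `f^*γ` is the transfer of `1` times `γ`. -/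
theorem transferDens_pullback (hf : IsPseudoholomorphic 𝒥 𝒥' f) (γ : RawForm (Euc m) N 1)
    (X : N → Euc m) (x : M) :
    transferDens 𝒥 𝒥' f (RawForm.pullback f γ) X x =
      degDens (m := m) f (fun y => toCov (γ.val y) (X y)) x := by
  rw [transferDens, RawForm.pullback_val, toCov_comp, cofForm_self, ← mul_assoc,
    relSign_mul_det (isComplexStructure_val 𝒥 x) (isComplexStructure_val 𝒥' (f x))
      (hf.rawDeriv_comm x)]
  rfl

theorem rawDeriv_chart_symm_apply {e : OpenPartialHomeomorph M (Euc m)}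
    (he : e ∈ atlas (Euc m) M) {x : M} (hx : x ∈ e.source) (v : Euc m) :
    rawDeriv (E := Euc m) (F := Euc m) e x (rawDeriv (E := Euc m) (F := Euc m) e.symm (e x) v) =
      v := by
  have h := congrArg (fun A : Euc m →L[ℝ] Euc m => A v) (rawDeriv_comp_symm he (e.map_source hx))
  simp only [e.left_inv hx] at h
  exact h

theorem rawDeriv_symm_chart_apply {e : OpenPartialHomeomorph M (Euc m)}
    (he : e ∈ atlas (Euc m) M) {x : M} (hx : x ∈ e.source) (v : Euc m) :
    rawDeriv (E := Euc m) (F := Euc m) e.symm (e x) (rawDeriv (E := Euc m) (F := Euc m) e x v) =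
      v :=
  congrArg (fun A : Euc m →L[ℝ] Euc m => A v) (rawDeriv_symm_comp he hx)

theorem isComplexStructure_endInChart (𝒥 : AlmostComplexStructure (Euc m) M)
    {e : OpenPartialHomeomorph M (Euc m)} (he : e ∈ atlas (Euc m) M) {z : Euc m}
    (hz : z ∈ e.target) : IsComplexStructure (endInChart e 𝒥.val z) := by
  intro v
  have h := rawDeriv_symm_chart_apply he (e.map_target hz)
  rw [e.right_inv hz] at h
  have h' := rawDeriv_chart_symm_apply he (e.map_target hz)
  rw [e.right_inv hz] at h'
  simp only [endInChart, ContinuousLinearMap.comp_apply, h, isComplexStructure_val 𝒥 _ _, map_neg,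
    h']

/-- The sign of the transfer in charts. -/
theorem relSign_mul_abs_det_chart (𝒥 : AlmostComplexStructure (Euc m) M)
    (𝒥' : AlmostComplexStructure (Euc m) N) (f : M → N) {e : OpenPartialHomeomorph M (Euc m)}
    (he : e ∈ atlas (Euc m) M) {e' : OpenPartialHomeomorph N (Euc m)}
    (he' : e' ∈ atlas (Euc m) N) {z : Euc m} (hz : z ∈ chartDomain f e e') :
    relSign (𝒥.val (e.symm z)) (𝒥'.val (f (e.symm z))) *
        |(rawDeriv (E := Euc m) (F := Euc m) e' (f (e.symm z))).det| *
        |(rawDeriv (E := Euc m) (F := Euc m) e.symm z).det| =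
      relSign (endInChart e 𝒥.val z) (endInChart e' 𝒥'.val (inCharts f e e' z)) *
        ((rawDeriv (E := Euc m) (F := Euc m) e' (f (e.symm z))).det *
        (rawDeriv (E := Euc m) (F := Euc m) e.symm z).det) := by
  have hy : f (e.symm z) ∈ e'.source := hz.2
  refine relSign_mul_abs_det (isComplexStructure_endInChart 𝒥 he hz.1)
    (isComplexStructure_endInChart 𝒥' he' (e'.map_source hy)) (isComplexStructure_val 𝒥 _)
    (isComplexStructure_val 𝒥' _) (fun v => ?_) (fun v => ?_)
  · have h := rawDeriv_symm_chart_apply he (e.map_target hz.1)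
    rw [e.right_inv hz.1] at h
    simp only [endInChart, ContinuousLinearMap.comp_apply, h]
  · simp only [endInChart, ContinuousLinearMap.comp_apply, e'.left_inv hy,
      rawDeriv_symm_chart_apply he' hy]

theorem eventually_relSign_chart (𝒥 : AlmostComplexStructure (Euc m) M)
    (𝒥' : AlmostComplexStructure (Euc m) N) (hf : ContMDiff 𝓘(ℝ, Euc m) 𝓘(ℝ, Euc m) ∞ f) (k : M)
    (q : N) {z : Euc m} (hz : z ∈ chartDomain f (chartAt (Euc m) k) (chartAt (Euc m) q)) :
    ∀ᶠ z' in 𝓝 z, relSign (endInChart (chartAt (Euc m) k) 𝒥.val z')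
      (endInChart (chartAt (Euc m) q) 𝒥'.val
        (inCharts f (chartAt (Euc m) k) (chartAt (Euc m) q) z')) =
      relSign (endInChart (chartAt (Euc m) k) 𝒥.val z)
      (endInChart (chartAt (Euc m) q) 𝒥'.val
        (inCharts f (chartAt (Euc m) k) (chartAt (Euc m) q) z)) := by
  set e := chartAt (Euc m) k
  set e' := chartAt (Euc m) q
  have he : e ∈ atlas (Euc m) M := chart_mem_atlas _ k
  have he' : e' ∈ atlas (Euc m) N := chart_mem_atlas _ q
  have hU := (isOpen_chartDomain hf.continuous e e').mem_nhds hz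
  have hσ : ContinuousAt (inCharts f e e') z :=
    ((contDiffOn_inCharts hf he he').continuousOn.continuousAt hU)
  have ht : ∀ w ∈ chartDomain f e e', inCharts f e e' w ∈ e'.target := fun w hw =>
    e'.map_source hw.2
  refine eventually_relSign_eq
    ((continuousOn_endInChart 𝒥 k).continuousAt (e.open_target.mem_nhds hz.1))
    (((continuousOn_endInChart 𝒥' q).continuousAt (e'.open_target.mem_nhds (ht z hz))).comp hσ)
    (isComplexStructure_endInChart 𝒥 he hz.1) (isComplexStructure_endInChart 𝒥' he' (ht z hz)) ?_ ?_
  · filter_upwards [hU] with w hw using isComplexStructure_endInChart 𝒥 he hw.1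
  · filter_upwards [hU] with w hw using isComplexStructure_endInChart 𝒥' he' (ht w hw)

theorem dens_transferDens (hf : ContMDiff 𝓘(ℝ, Euc m) 𝓘(ℝ, Euc m) ∞ f) (β : RawForm (Euc m) M 1)
    {e : OpenPartialHomeomorph M (Euc m)}
    (he : e ∈ atlas (Euc m) M) {e' : OpenPartialHomeomorph N (Euc m)}
    (he' : e' ∈ atlas (Euc m) N) {z : Euc m} (hz : z ∈ chartDomain f e e') (X : Euc m → Euc m) :
    dens e (transferDens 𝒥 𝒥' f β (pushField e' X)) z =
      relSign (endInChart e 𝒥.val z) (endInChart e' 𝒥'.val (inCharts f e e' z)) *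
        cofForm (fderiv ℝ (inCharts f e e') z) (toCov (β.inChart e z)) (X (inCharts f e e' z)) := by
  have hy : f (e.symm z) ∈ e'.source := hz.2
  rw [fderiv_inCharts hf he he' hz, RawForm.inChart_eq, toCov_comp]
  have h := cofForm_comp (Q := rawDeriv (E := Euc m) (F := Euc m) e' (f (e.symm z)))
    (Q' := rawDeriv (E := Euc m) (F := Euc m) e'.symm (e' (f (e.symm z))))
    (rawDeriv_chart_symm_apply he' hy) (rawDeriv (E := Euc m) (F := Euc m) f (e.symm z))
    (rawDeriv (E := Euc m) (F := Euc m) e.symm z) (toCov (β.val (e.symm z)))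
    (X (inCharts f e e' z))
  rw [ContinuousLinearMap.comp_assoc, h, ← mul_assoc, ← relSign_mul_abs_det_chart 𝒥 𝒥' f he he' hz]
  simp only [dens, transferDens, pushField_of_mem hy, cofForm_smul, inCharts]
  ring

omit [IsManifold 𝓘(ℝ, Euc m) ∞ M] [IsManifold 𝓘(ℝ, Euc m) ∞ N] in
/-- A density that is continuous near the points over the chart `e'` and vanishes near the other
points is continuous. -/
theorem contDens_of_charts (hf : Continuous f) {γ : M → ℝ} (q : N)
    (h1 : ∀ k : M, ContinuousOn (dens (chartAt (Euc m) k) γ)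
      (chartDomain f (chartAt (Euc m) k) (chartAt (Euc m) q)))
    (h2 : ∀ x, f x ∉ (chartAt (Euc m) q).source → ∀ᶠ x' in 𝓝 x, γ x' = 0) :
    ContDens (m := m) γ := by
  intro k z hz
  set e := chartAt (Euc m) k
  by_cases h : f (e.symm z) ∈ (chartAt (Euc m) q).source
  · exact ((h1 k).continuousAt ((isOpen_chartDomain hf _ _).mem_nhds ⟨hz, h⟩)).continuousWithinAt
  · have h3 : ∀ᶠ z' in 𝓝 z, dens e γ z' = 0 := by
      filter_upwards [(e.continuousAt_symm hz).eventually (h2 _ h)] with z' hz'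
      simp [dens, hz']
    exact (continuousAt_const.congr (h3.mono fun _ h => h.symm)).continuousWithinAt

theorem contDens_transferDens [T2Space N] (hf : ContMDiff 𝓘(ℝ, Euc m) 𝓘(ℝ, Euc m) ∞ f)
    {β : RawForm (Euc m) M 1} (hβ : β ∈ smoothForms (Euc m) M 1) (q : N) {X : Euc m → Euc m}
    (hX : Continuous X) (hXc : HasCompactSupport X)
    (hXs : tsupport X ⊆ (chartAt (Euc m) q).target) :
    ContDens (m := m) (transferDens 𝒥 𝒥' f β (pushField (chartAt (Euc m) q) X)) := by
  refine contDens_of_charts hf.continuous q (fun k z hz => ?_) (fun x hx => ?_)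
  · set e := chartAt (Euc m) k
    set e' := chartAt (Euc m) q
    have he : e ∈ atlas (Euc m) M := chart_mem_atlas _ k
    have he' : e' ∈ atlas (Euc m) N := chart_mem_atlas _ q
    have hU := isOpen_chartDomain hf.continuous e e'
    have hσ := contDiffOn_inCharts hf he he'
    refine ContinuousAt.continuousWithinAt ?_
    have h1 : ContinuousAt (fun z' => relSign (endInChart e 𝒥.val z)
        (endInChart e' 𝒥'.val (inCharts f e e' z)) * cofForm (fderiv ℝ (inCharts f e e') z')
          (toCov (β.inChart e z')) (X (inCharts f e e' z'))) z := by
      refine continuousAt_const.mul (continuous_cofForm.continuousAt.comp (f := fun z' =>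
        (fderiv ℝ (inCharts f e e') z', toCov (β.inChart e z'), X (inCharts f e e' z')))
        (ContinuousAt.prodMk ?_ (ContinuousAt.prodMk ?_ ?_)))
      · exact (hσ.continuousOn_fderiv_of_isOpen hU (by simp)).continuousAt (hU.mem_nhds hz)
      · exact continuous_toCov.continuousAt.comp
          ((hβ e he).continuousOn.continuousAt (e.open_target.mem_nhds hz.1))
      · exact hX.continuousAt.comp (hσ.continuousOn.continuousAt (hU.mem_nhds hz))
    refine h1.congr ?_
    filter_upwards [hU.mem_nhds hz, eventually_relSign_chart 𝒥 𝒥' hf k q hz] with z' hz' hs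
    rw [dens_transferDens hf β he he' hz', hs]
  · filter_upwards [hf.continuous.continuousAt.eventually
      (eventually_chart_eq_zero hXc hXs hx)] with x' hx'
    rw [transferDens, pushField_eq_zero hx', cofForm_zero, mul_zero]

theorem dens_degDens (hf : ContMDiff 𝓘(ℝ, Euc m) 𝓘(ℝ, Euc m) ∞ f)
    {e : OpenPartialHomeomorph M (Euc m)}
    (he : e ∈ atlas (Euc m) M) {e' : OpenPartialHomeomorph N (Euc m)}
    (he' : e' ∈ atlas (Euc m) N) {z : Euc m} (hz : z ∈ chartDomain f e e') (g : Euc m → ℝ) :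
    dens e (degDens (m := m) f (pushDens e' g)) z =
      |(fderiv ℝ (inCharts f e e') z).det| * g (inCharts f e e' z) := by
  have hy : f (e.symm z) ∈ e'.source := hz.2
  rw [fderiv_inCharts hf he he' hz, ContinuousLinearMap.det_comp, ContinuousLinearMap.det_comp]
  simp only [dens, degDens, pushDens_of_mem hy, inCharts, abs_mul]
  ring

theorem contDens_degDens [T2Space N] (hf : ContMDiff 𝓘(ℝ, Euc m) 𝓘(ℝ, Euc m) ∞ f)
    (q : N) {g : Euc m → ℝ} (hg : Continuous g) (hgc : HasCompactSupport g)
    (hgs : tsupport g ⊆ (chartAt (Euc m) q).target) :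
    ContDens (m := m) (degDens (m := m) f (pushDens (chartAt (Euc m) q) g)) := by
  refine contDens_of_charts hf.continuous q (fun k => ?_) (fun x hx => ?_)
  · set e := chartAt (Euc m) k
    set e' := chartAt (Euc m) q
    have he : e ∈ atlas (Euc m) M := chart_mem_atlas _ k
    have he' : e' ∈ atlas (Euc m) N := chart_mem_atlas _ q
    have hU := isOpen_chartDomain hf.continuous e e'
    have hσ := contDiffOn_inCharts hf he he'
    refine ContinuousOn.congr ?_ fun z hz => dens_degDens hf he he' hz g
    have h1 : ContinuousOn (fun z => (fderiv ℝ (inCharts f e e') z).det) (chartDomain f e e') :=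
      ContinuousLinearMap.continuous_det.comp_continuousOn
        (hσ.continuousOn_fderiv_of_isOpen hU (by simp))
    exact h1.abs.mul (hg.comp_continuousOn hσ.continuousOn)
  · filter_upwards [hf.continuous.continuousAt.eventually
      (eventually_chart_eq_zero hgc hgs hx)] with x' hx'
    rw [degDens, pushDens_eq_zero hx', mul_zero]

end Transfer

/-! ### The exterior derivative of the transfer -/

section TransferDeriv

open MeasureTheory Filter Topology Set

variable {m : ℕ}

theorem rowDet_update_zero (B : Fin m → Fin m → ℝ) (i : Fin m) :
    rowDet m (Function.update B i 0) = 0 :=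
  (rowDet m).toMultilinearMap.map_update_zero B i

theorem rowDet_update_update_add {i j : Fin m} (hij : i ≠ j) (B : Fin m → Fin m → ℝ)
    {ι : Type*} (s : Finset ι) (a : ι → Fin m → ℝ) (b : Fin m → ℝ) :
    rowDet m (Function.update (Function.update B i (∑ l ∈ s, a l)) j b) =
      ∑ l ∈ s, rowDet m (Function.update (Function.update B i (a l)) j b) := by
  simp only [Function.update_comm hij]
  exact map_sum ((rowDet m).toContinuousLinearMap (Function.update B j b) i) a s

theorem rowDet_update_update_smul {i j : Fin m} (hij : i ≠ j) (B : Fin m → Fin m → ℝ)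
    (c : ℝ) (a b : Fin m → ℝ) :
    rowDet m (Function.update (Function.update B i (c • a)) j b) =
      c * rowDet m (Function.update (Function.update B i a) j b) := by
  simp only [Function.update_comm hij]
  exact map_smul ((rowDet m).toContinuousLinearMap (Function.update B j b) i) c a

theorem rowDet_update_update_zero {i j : Fin m} (hij : i ≠ j) (B : Fin m → Fin m → ℝ)
    (b : Fin m → ℝ) : rowDet m (Function.update (Function.update B i 0) j b) = 0 := by
  rw [Function.update_comm hij, rowDet_update_zero]

theorem extDeriv_one_apply {F : Type*} [NormedAddCommGroup F] [NormedSpace ℝ F]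
    {η : F → F [⋀^Fin 1]→L[ℝ] ℝ} {x : F} (h : DifferentiableAt ℝ η x) (u w : F) :
    extDeriv η x ![u, w] = fderiv ℝ (fun y => η y fun _ => w) x u -
      fderiv ℝ (fun y => η y fun _ => u) x w := by
  rw [extDeriv_apply h, Fin.sum_univ_two]
  have h0 : (0 : Fin 2).removeNth ![u, w] = fun _ => w := by
    funext i; fin_cases i; rfl
  have h1 : (1 : Fin 2).removeNth ![u, w] = fun _ => u := by
    funext i; fin_cases i; rfl
  rw [h0, h1]
  simp [sub_eq_add_neg]

theorem twoForm_apply_eq_sum (η : Euc m [⋀^Fin 2]→L[ℝ] ℝ) (u w : Euc m) :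
    η ![u, w] = ∑ p, ∑ q, η ![bv p, bv q] * u p * w q := by
  have h0 : ∀ (w : Euc m), ∃ L : Euc m →L[ℝ] ℝ, ∀ u, L u = η ![u, w] := fun w =>
    ⟨η.toContinuousMultilinearMap.toContinuousLinearMap ![0, w] 0, fun u => by
      change η (Function.update ![0, w] 0 u) = _
      congr 1; funext i; fin_cases i <;> rfl⟩
  have h1 : ∀ (u : Euc m), ∃ L : Euc m →L[ℝ] ℝ, ∀ w, L w = η ![u, w] := fun u =>
    ⟨η.toContinuousMultilinearMap.toContinuousLinearMap ![u, 0] 1, fun w => by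
      change η (Function.update ![u, 0] 1 w) = _
      congr 1; funext i; fin_cases i <;> rfl⟩
  obtain ⟨L, hL⟩ := h0 w
  rw [← hL]
  conv_lhs => rw [← sum_smul_bv u, map_sum]
  refine Finset.sum_congr rfl fun p _ => ?_
  obtain ⟨K, hK⟩ := h1 (bv p)
  rw [map_smul, hL, ← hK]
  conv_lhs => rw [← sum_smul_bv w, map_sum]
  rw [smul_eq_mul, Finset.mul_sum]
  refine Finset.sum_congr rfl fun q _ => ?_
  rw [map_smul, hK, smul_eq_mul]
  ring

theorem twoForm_swap (η : Euc m [⋀^Fin 2]→L[ℝ] ℝ) (u w : Euc m) : η ![u, w] = -η ![w, u] := by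
  have h := η.toAlternatingMap.map_swap ![w, u] (zero_ne_one (α := Fin 2))
  have e : ![w, u] ∘ Equiv.swap (0 : Fin 2) 1 = ![u, w] := by
    funext i; fin_cases i <;> rfl
  rw [e] at h
  exact h

variable {M N : Type*} [TopologicalSpace M] [TopologicalSpace N]
  [ChartedSpace (Euc m) M] [ChartedSpace (Euc m) N]

/-- The components of a two-form in a chart. -/
def twoFormComp (α : RawForm (Euc m) N 2) (e : OpenPartialHomeomorph N (Euc m)) (i j : Fin m)
    (y : Euc m) : ℝ := α.inChart e y ![bv i, bv j]

variable [IsManifold 𝓘(ℝ, Euc m) ∞ M] [IsManifold 𝓘(ℝ, Euc m) ∞ N]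
variable {𝒥 : AlmostComplexStructure (Euc m) M} {𝒥' : AlmostComplexStructure (Euc m) N} {f : M → N}

/-- The differential of `f`, read in a chart of the target only. -/
def derivTo (f : M → N) (e' : OpenPartialHomeomorph N (Euc m)) (x : M) : Euc m →L[ℝ] Euc m :=
  (rawDeriv (E := Euc m) (F := Euc m) e' (f x)).comp (rawDeriv (E := Euc m) (F := Euc m) f x)

/-- The sign of the transfer, read in a chart of the target only. -/
def signTo (𝒥 : AlmostComplexStructure (Euc m) M) (𝒥' : AlmostComplexStructure (Euc m) N)
    (f : M → N) (e' : OpenPartialHomeomorph N (Euc m)) (x : M) : ℝ :=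
  relSign (𝒥.val x) (𝒥'.val (f x)) * |(rawDeriv (E := Euc m) (F := Euc m) e' (f x)).det| *
    ((rawDeriv (E := Euc m) (F := Euc m) e' (f x)).det)⁻¹

/-- For `dβ = f^*α` and a function `v` on `M`, the density obtained by wedging `d(v β)` with the
`df_k` for `k ≠ i, j`. Its integral vanishes by Stokes' theorem. -/
def stokesDens (𝒥 : AlmostComplexStructure (Euc m) M) (𝒥' : AlmostComplexStructure (Euc m) N)
    (f : M → N) (α : RawForm (Euc m) N 2) (β : RawForm (Euc m) M 1)
    (e' : OpenPartialHomeomorph N (Euc m)) (i j : Fin m) (v : M → ℝ) (x : M) : ℝ :=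
  signTo 𝒥 𝒥' f e' x *
    (rowDet m (Function.update (Function.update (linRows (derivTo f e' x)) i
      (covRow (rawDeriv (E := Euc m) (F := ℝ) v x))) j (covRow (toCov (β.val x)))) +
    v x * twoFormComp α e' i j (e' (f x)) * (derivTo f e' x).det)

theorem det_rawDeriv_ne_zero {e : OpenPartialHomeomorph M (Euc m)}
    (he : e ∈ atlas (Euc m) M) {x : M} (hx : x ∈ e.source) :
    (rawDeriv (E := Euc m) (F := Euc m) e x).det ≠ 0 :=
  left_ne_zero_of_mul_eq_one (det_chart_mul_det_symm he hx)

omit [IsManifold 𝓘(ℝ, Euc m) ∞ M] in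
theorem rawDeriv_eq_zero {v : M → ℝ} {x : M} (hx : x ∉ tsupport v) :
    rawDeriv (E := Euc m) (F := ℝ) v x = 0 := by
  have h : v =ᶠ[𝓝 x] fun _ => 0 := notMem_tsupport_iff_eventuallyEq.1 hx
  have h1 : rawDeriv (E := Euc m) (F := ℝ) v x =
      rawDeriv (E := Euc m) (F := ℝ) (fun _ : M => (0 : ℝ)) x := h.mfderiv_eq
  rw [h1]
  exact mfderiv_const

theorem covRow_zero : covRow (0 : Euc m →L[ℝ] ℝ) = 0 := rfl

theorem stokesDens_eq_zero (α : RawForm (Euc m) N 2) (β : RawForm (Euc m) M 1)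
    (e' : OpenPartialHomeomorph N (Euc m)) {i j : Fin m} (hij : i ≠ j) {v : M → ℝ} {x : M}
    (hx : x ∉ tsupport v) : stokesDens 𝒥 𝒥' f α β e' i j v x = 0 := by
  rw [stokesDens, rawDeriv_eq_zero hx, covRow_zero, rowDet_update_update_zero hij,
    image_eq_zero_of_notMem_tsupport hx]
  simp

theorem hasFDerivAt_comp_symm {v : M → ℝ} (hv : ContMDiff 𝓘(ℝ, Euc m) 𝓘(ℝ, ℝ) ∞ v)
    {e : OpenPartialHomeomorph M (Euc m)} (he : e ∈ atlas (Euc m) M) {z : Euc m}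
    (hz : z ∈ e.target) :
    HasFDerivAt (fun w => v (e.symm w)) ((rawDeriv (E := Euc m) (F := ℝ) v (e.symm z)).comp
      (rawDeriv (E := Euc m) (F := Euc m) e.symm z)) z := by
  have h0 : HasMFDerivAt 𝓘(ℝ, Euc m) 𝓘(ℝ, ℝ) v (e.symm z)
      (rawDeriv (E := Euc m) (F := ℝ) v (e.symm z)) :=
    (hv.mdifferentiable (by simp) _).hasMFDerivAt
  exact (h0.comp z (hasMFDerivAt_chart_symm he hz)).hasFDerivAt

theorem contDiffOn_comp_symm {v : M → ℝ} (hv : ContMDiff 𝓘(ℝ, Euc m) 𝓘(ℝ, ℝ) ∞ v)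
    {e : OpenPartialHomeomorph M (Euc m)} (he : e ∈ atlas (Euc m) M) :
    ContDiffOn ℝ ∞ (fun w => v (e.symm w)) e.target :=
  contMDiffOn_iff_contDiffOn.1 (hv.comp_contMDiffOn
    (contMDiffOn_symm_of_mem_maximalAtlas (IsManifold.subset_maximalAtlas he)))

theorem dens_stokesDens (hf : ContMDiff 𝓘(ℝ, Euc m) 𝓘(ℝ, Euc m) ∞ f) (α : RawForm (Euc m) N 2)
    (β : RawForm (Euc m) M 1) {e : OpenPartialHomeomorph M (Euc m)}
    (he : e ∈ atlas (Euc m) M) {e' : OpenPartialHomeomorph N (Euc m)}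
    (he' : e' ∈ atlas (Euc m) N) {z : Euc m} (hz : z ∈ chartDomain f e e') {v : M → ℝ}
    (hv : ContMDiff 𝓘(ℝ, Euc m) 𝓘(ℝ, ℝ) ∞ v) (i j : Fin m) :
    dens e (stokesDens 𝒥 𝒥' f α β e' i j v) z =
      relSign (endInChart e 𝒥.val z) (endInChart e' 𝒥'.val (inCharts f e e' z)) *
      (rowDet m (Function.update (Function.update (jacRows (inCharts f e e') z) i
        (gradRow (fun w => v (e.symm w)) z)) j (covRow (toCov (β.inChart e z)))) +
      v (e.symm z) * twoFormComp α e' i j (inCharts f e e' z) *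
        rowDet m (jacRows (inCharts f e e') z)) := by
  have hy : f (e.symm z) ∈ e'.source := hz.2
  have hQ := det_rawDeriv_ne_zero he' hy
  have hs := relSign_mul_abs_det_chart 𝒥 𝒥' f he he' hz
  have hgrad : gradRow (fun w => v (e.symm w)) z =
      covRow ((rawDeriv (E := Euc m) (F := ℝ) v (e.symm z)).comp
        (rawDeriv (E := Euc m) (F := Euc m) e.symm z)) := by
    rw [← (hasFDerivAt_comp_symm hv he hz.1).fderiv]; rfl
  have hσ : fderiv ℝ (inCharts f e e') z = (derivTo f e' (e.symm z)).comp
      (rawDeriv (E := Euc m) (F := Euc m) e.symm z) := fderiv_inCharts hf he he' hz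
  rw [hgrad, rowDet_jacRows, jacRows_eq_linRows, hσ, RawForm.inChart_eq, toCov_comp,
    rowDet_update_update_comp, ContinuousLinearMap.det_comp]
  simp only [dens, stokesDens, signTo]
  set s := relSign (endInChart e 𝒥.val z) (endInChart e' 𝒥'.val (inCharts f e e' z))
  set s' := relSign (𝒥.val (e.symm z)) (𝒥'.val (f (e.symm z)))
  set Q := (rawDeriv (E := Euc m) (F := Euc m) e' (f (e.symm z))).det
  set Pd := (rawDeriv (E := Euc m) (F := Euc m) e.symm z).det
  have hs' : s' * |Q| * Q⁻¹ * |Pd| = s * Pd := by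
    rw [mul_right_comm, hs]
    field_simp
  change s' * |Q| * Q⁻¹ * (_ + _ * twoFormComp α e' i j (inCharts f e e' z) * _) * |Pd| = _
  linear_combination (rowDet m (Function.update (Function.update
    (linRows (derivTo f e' (e.symm z))) i
      (covRow (rawDeriv (E := Euc m) (F := ℝ) v (e.symm z)))) j
        (covRow (toCov (β.val (e.symm z))))) + v (e.symm z) *
    twoFormComp α e' i j (inCharts f e e' z) * (derivTo f e' (e.symm z)).det) * hs'

omit [IsManifold 𝓘(ℝ, Euc m) ∞ N] in
theorem contDiffOn_twoFormComp {α : RawForm (Euc m) N 2} (hα : α ∈ smoothForms (Euc m) N 2)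
    {e : OpenPartialHomeomorph N (Euc m)} (he : e ∈ atlas (Euc m) N) (i j : Fin m) :
    ContDiffOn ℝ ∞ (twoFormComp α e i j) e.target :=
  (ContinuousAlternatingMap.apply ℝ (Euc m) ℝ ![bv i, bv j]).contDiff.comp_contDiffOn (hα e he)

end TransferDeriv

section TransferStokes

open MeasureTheory Filter Topology Set

variable {m : ℕ} {M N : Type*} [TopologicalSpace M] [TopologicalSpace N]
  [ChartedSpace (Euc m) M] [ChartedSpace (Euc m) N]
variable [IsManifold 𝓘(ℝ, Euc m) ∞ M] [IsManifold 𝓘(ℝ, Euc m) ∞ N]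
variable {𝒥 : AlmostComplexStructure (Euc m) M} {𝒥' : AlmostComplexStructure (Euc m) N} {f : M → N}

omit [IsManifold 𝓘(ℝ, Euc m) ∞ M] in
theorem contDiffOn_covRow {β : RawForm (Euc m) M 1} (hβ : β ∈ smoothForms (Euc m) M 1)
    {e : OpenPartialHomeomorph M (Euc m)} (he : e ∈ atlas (Euc m) M) (k : Fin m) :
    ContDiffOn ℝ ∞ (fun z => covRow (toCov (β.inChart e z)) k) e.target :=
  (ContinuousAlternatingMap.apply ℝ (Euc m) ℝ (fun _ : Fin 1 => bv k)).contDiff.comp_contDiffOn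
    (hβ e he)

theorem contDens_stokesDens (hf : ContMDiff 𝓘(ℝ, Euc m) 𝓘(ℝ, Euc m) ∞ f)
    {α : RawForm (Euc m) N 2} (hα : α ∈ smoothForms (Euc m) N 2) {β : RawForm (Euc m) M 1}
    (hβ : β ∈ smoothForms (Euc m) M 1) (q : N) {i j : Fin m} (hij : i ≠ j) {v : M → ℝ}
    (hv : ContMDiff 𝓘(ℝ, Euc m) 𝓘(ℝ, ℝ) ∞ v)
    (hvs : tsupport v ⊆ f ⁻¹' (chartAt (Euc m) q).source) :
    ContDens (m := m) (stokesDens 𝒥 𝒥' f α β (chartAt (Euc m) q) i j v) := by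
  refine contDens_of_charts hf.continuous q (fun k z hz => ?_) (fun x hx => ?_)
  · set e := chartAt (Euc m) k
    set e' := chartAt (Euc m) q
    have he : e ∈ atlas (Euc m) M := chart_mem_atlas _ k
    have he' : e' ∈ atlas (Euc m) N := chart_mem_atlas _ q
    have hU := isOpen_chartDomain hf.continuous e e'
    have hσ := contDiffOn_inCharts hf he he'
    have hUz := hU.mem_nhds hz
    have hez := e.open_target.mem_nhds hz.1
    refine ContinuousAt.continuousWithinAt ?_
    have hjac : ContinuousAt (jacRows (inCharts f e e')) z :=
      (contDiffOn_jacRows hU hσ).continuousOn.continuousAt hUz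
    have hgr : ContinuousAt (gradRow fun w => v (e.symm w)) z := by
      refine continuousAt_pi.2 fun k => ?_
      exact ((((contDiffOn_comp_symm hv he).continuousOn_fderiv_of_isOpen e.open_target
        (by simp)).continuousAt hez).clm_apply continuousAt_const)
    have hcov : ContinuousAt (fun z => covRow (toCov (β.inChart e z))) z :=
      continuousAt_pi.2 fun k => (contDiffOn_covRow hβ he k).continuousOn.continuousAt hez
    have ha : ContinuousAt (fun z => twoFormComp α e' i j (inCharts f e e' z)) z :=
      ContinuousAt.comp (g := twoFormComp α e' i j) (f := inCharts f e e')
        ((contDiffOn_twoFormComp hα he' i j).continuousOn.continuousAt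
          (e'.open_target.mem_nhds (e'.map_source hz.2)))
        (hσ.continuousOn.continuousAt hUz)
    have hv' : ContinuousAt (fun z => v (e.symm z)) z :=
      (contDiffOn_comp_symm hv he).continuousOn.continuousAt hez
    have h1 := (continuousAt_const (y := relSign (endInChart e 𝒥.val z)
        (endInChart e' 𝒥'.val (inCharts f e e' z))) (x := z)).mul
      ((((rowDet m).cont.continuousAt.comp ((hjac.update i hgr).update j hcov))).add
        ((hv'.mul ha).mul ((rowDet m).cont.continuousAt.comp hjac)))
    refine h1.congr ?_
    filter_upwards [hUz, eventually_relSign_chart 𝒥 𝒥' hf k q hz] with z' hz' hs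
    rw [dens_stokesDens hf α β he he' hz' hv, hs]
    rfl
  · have hx' : x ∉ tsupport v := fun h => hx (hvs h)
    filter_upwards [(isClosed_tsupport v).isOpen_compl.mem_nhds hx'] with x' h
    exact stokesDens_eq_zero α β _ hij h

theorem stokesDens_sum (α : RawForm (Euc m) N 2) (β : RawForm (Euc m) M 1)
    (e' : OpenPartialHomeomorph N (Euc m)) {i j : Fin m} (hij : i ≠ j) {ι : Type*} (s : Finset ι)
    {v : ι → M → ℝ} (hv : ∀ l, ContMDiff 𝓘(ℝ, Euc m) 𝓘(ℝ, ℝ) ∞ (v l)) (x : M) :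
    stokesDens 𝒥 𝒥' f α β e' i j (fun x => ∑ l ∈ s, v l x) x =
      ∑ l ∈ s, stokesDens 𝒥 𝒥' f α β e' i j (v l) x := by
  have h0 : ∀ l, HasMFDerivAt 𝓘(ℝ, Euc m) 𝓘(ℝ, ℝ) (v l) x
      (rawDeriv (E := Euc m) (F := ℝ) (v l) x) := fun l =>
    ((hv l).mdifferentiable (by simp) _).hasMFDerivAt
  have h1 : rawDeriv (E := Euc m) (F := ℝ) (fun x => ∑ l ∈ s, v l x) x =
      ∑ l ∈ s, rawDeriv (E := Euc m) (F := ℝ) (v l) x := by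
    have hw : ∀ l, HasFDerivWithinAt (𝕜 := ℝ) (E := Euc m) (F := ℝ)
        (writtenInExtChartAt 𝓘(ℝ, Euc m) 𝓘(ℝ, ℝ) x (v l))
        (rawDeriv (E := Euc m) (F := ℝ) (v l) x) (range 𝓘(ℝ, Euc m))
        (extChartAt 𝓘(ℝ, Euc m) x x) := fun l => (h0 l).2
    have h2 : HasMFDerivAt 𝓘(ℝ, Euc m) 𝓘(ℝ, ℝ) (fun x => ∑ l ∈ s, v l x) x
        (∑ l ∈ s, rawDeriv (E := Euc m) (F := ℝ) (v l) x : Euc m →L[ℝ] ℝ) :=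
      ⟨(continuous_finsetSum s fun l _ => (hv l).continuous).continuousAt,
        HasFDerivWithinAt.fun_sum fun l _ => hw l⟩
    exact h2.mfderiv
  have h3 : covRow (∑ l ∈ s, rawDeriv (E := Euc m) (F := ℝ) (v l) x) =
      ∑ l ∈ s, covRow (rawDeriv (E := Euc m) (F := ℝ) (v l) x) := by
    funext k
    simp [covRow]
  simp only [stokesDens, h1, h3, rowDet_update_update_add hij, Finset.sum_mul,
    ← Finset.sum_add_distrib, Finset.mul_sum]

theorem fderiv_covRow_sub {β : RawForm (Euc m) M 1} (hβ : β ∈ smoothForms (Euc m) M 1)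
    {α : RawForm (Euc m) N 2} (hf : ContMDiff 𝓘(ℝ, Euc m) 𝓘(ℝ, Euc m) ∞ f)
    (hd : β.d = RawForm.pullback f α) {e : OpenPartialHomeomorph M (Euc m)}
    (he : e ∈ atlas (Euc m) M) {e' : OpenPartialHomeomorph N (Euc m)}
    (he' : e' ∈ atlas (Euc m) N) {z : Euc m} (hz : z ∈ chartDomain f e e') (l k : Fin m) :
    fderiv ℝ (fun z => covRow (toCov (β.inChart e z)) k) z (bv l) -
      fderiv ℝ (fun z => covRow (toCov (β.inChart e z)) l) z (bv k) =
      ∑ p, ∑ q, twoFormComp α e' p q (inCharts f e e' z) * jacRows (inCharts f e e') z p l *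
        jacRows (inCharts f e e') z q k := by
  have h1 := RawForm.inChart_d he hβ hz.1
  rw [hd, RawForm.inChart_pullback hf he he' α hz] at h1
  have h2 := congrArg (fun η : Euc m [⋀^Fin 2]→L[ℝ] ℝ => η ![bv l, bv k]) h1
  rw [extDeriv_one_apply (((hβ e he).contDiffAt (e.open_target.mem_nhds hz.1)).differentiableAt
    (by simp))] at h2
  refine h2.symm.trans ?_
  have h3 : (((α.inChart e' (inCharts f e e' z)).compContinuousLinearMap
      (fderiv ℝ (inCharts f e e') z)) ![bv l, bv k]) = α.inChart e' (inCharts f e e' z)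
        ![fderiv ℝ (inCharts f e e') z (bv l), fderiv ℝ (inCharts f e e') z (bv k)] := by
    rw [ContinuousAlternatingMap.compContinuousLinearMap_apply]
    congr 1
    funext i; fin_cases i <;> rfl
  rw [h3, twoForm_apply_eq_sum]
  rfl

theorem integ_stokesDens_of_chart [T2Space M] [CompactSpace M] (P : ChartPartition m M)
    (hf : ContMDiff 𝓘(ℝ, Euc m) 𝓘(ℝ, Euc m) ∞ f)
    {α : RawForm (Euc m) N 2} (hα : α ∈ smoothForms (Euc m) N 2) {β : RawForm (Euc m) M 1}
    (hβ : β ∈ smoothForms (Euc m) M 1) (hd : β.d = RawForm.pullback f α) (q : N) {i j : Fin m}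
    (hij : i ≠ j) {v : M → ℝ} (hv : ContMDiff 𝓘(ℝ, Euc m) 𝓘(ℝ, ℝ) ∞ v)
    (hvs : tsupport v ⊆ f ⁻¹' (chartAt (Euc m) q).source) {l : M}
    (hvl : tsupport v ⊆ (chartAt (Euc m) l).source) :
    P.integ (stokesDens 𝒥 𝒥' f α β (chartAt (Euc m) q) i j v) = 0 := by
  have hC : IsCompact (tsupport v) := (isClosed_tsupport v).isCompact
  rw [P.integ_eq (contDens_stokesDens hf hα hβ q hij hv hvs) hC hvl
    fun x hx => stokesDens_eq_zero α β _ hij hx]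
  set e := chartAt (Euc m) l
  set e' := chartAt (Euc m) q
  have he : e ∈ atlas (Euc m) M := chart_mem_atlas _ l
  have he' : e' ∈ atlas (Euc m) N := chart_mem_atlas _ q
  set U := chartDomain f e e' with hUdef
  have hU : IsOpen U := isOpen_chartDomain hf.continuous e e'
  have hσ := contDiffOn_inCharts hf he he'
  set σ := inCharts f e e'
  set s : Euc m → ℝ := fun z => relSign (endInChart e 𝒥.val z) (endInChart e' 𝒥'.val (σ z))
  -- The cut-off function absorbs the locally constant sign.
  classical
  let u : Euc m → ℝ := fun z => if z ∈ U then s z * v (e.symm z) else 0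
  have hK : IsCompact (e '' tsupport v) := hC.image_of_continuousOn (e.continuousOn.mono hvl)
  have hKU : e '' tsupport v ⊆ U := by
    rintro _ ⟨x, hx, rfl⟩
    refine ⟨e.map_source (hvl hx), ?_⟩
    change f (e.symm (e x)) ∈ e'.source
    rw [e.left_inv (hvl hx)]
    exact hvs hx
  have hu0 : ∀ z ∉ e '' tsupport v, u z = 0 := by
    intro z hz
    simp only [u]
    split_ifs with h
    · have : e.symm z ∉ tsupport v := fun h' => hz ⟨_, h', e.right_inv h.1⟩
      rw [image_eq_zero_of_notMem_tsupport this, mul_zero]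
    · rfl
  have hus : tsupport u ⊆ e '' tsupport v :=
    closure_minimal (fun z h => by by_contra h'; exact h (hu0 z h')) hK.isClosed
  have hueq : ∀ z ∈ U, u =ᶠ[𝓝 z] fun w => s z * v (e.symm w) := by
    intro z hz
    filter_upwards [hU.mem_nhds hz, eventually_relSign_chart 𝒥 𝒥' hf l q hz] with w hw hs
    simp only [u, if_pos hw]
    congr 1
  have hu : ContDiff ℝ ∞ u := by
    refine contDiff_iff_contDiffAt.2 fun z => ?_
    by_cases hz : z ∈ U
    · refine ContDiffAt.congr_of_eventuallyEq ?_ (hueq z hz)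
      exact contDiffAt_const.mul ((contDiffOn_comp_symm hv he).contDiffAt
        (e.open_target.mem_nhds hz.1))
    · refine (contDiffAt_const (c := (0 : ℝ))).congr_of_eventuallyEq ?_
      filter_upwards [hK.isClosed.isOpen_compl.mem_nhds fun h => hz (hKU h)] with w hw
      exact hu0 w hw
  have key := integral_rowDet_update_update hU hσ hu (HasCompactSupport.intro hK hu0)
    (hus.trans hKU) hij (fun k z => covRow (toCov (β.inChart e z)) k)
    (fun k => (contDiffOn_covRow hβ he k).mono inter_subset_left)
    (fun p q z => twoFormComp α e' p q (σ z)) (fun p q z => twoForm_swap (α.inChart e' (σ z)) (bv p) (bv q))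
    (fun z hz l k => fderiv_covRow_sub hβ hf hd he he' hz l k)
  rw [← key]
  refine (setIntegral_congr_fun e.open_target.measurableSet fun z hz => ?_).trans
    (setIntegral_eq_integral_of_forall_compl_eq_zero fun z hz => ?_)
  · by_cases hzU : z ∈ U
    · have hg : gradRow u z = s z • gradRow (fun w => v (e.symm w)) z := by
        funext k
        simp only [gradRow, (hueq z hzU).fderiv_eq, Pi.smul_apply, smul_eq_mul]
        rw [fderiv_const_mul (hasFDerivAt_comp_symm hv he hz).differentiableAt]
        rfl
      have huz : u z = s z * v (e.symm z) := (hueq z hzU).self_of_nhds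
      rw [dens_stokesDens hf α β he he' hzU hv, hg, rowDet_update_update_smul hij, huz]
      change s z * _ = _
      ring
    · have h1 : z ∉ tsupport u := fun h => hzU (hKU (hus h))
      have h2 : e.symm z ∉ tsupport v := fun h => hzU (hKU ⟨_, h, e.right_inv hz⟩)
      rw [gradRow_eq_zero h1, rowDet_update_update_zero hij,
        image_eq_zero_of_notMem_tsupport h1, dens, stokesDens_eq_zero α β _ hij h2]
      simp
  · have h1 : z ∉ tsupport u := fun h => hz (hKU (hus h)).1
    rw [gradRow_eq_zero h1, rowDet_update_update_zero hij, image_eq_zero_of_notMem_tsupport h1]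
    simp

/-- Stokes' theorem on `M`, localized by a partition of unity. -/
theorem integ_stokesDens [T2Space M] [CompactSpace M] (P : ChartPartition m M)
    (hf : ContMDiff 𝓘(ℝ, Euc m) 𝓘(ℝ, Euc m) ∞ f)
    {α : RawForm (Euc m) N 2} (hα : α ∈ smoothForms (Euc m) N 2) {β : RawForm (Euc m) M 1}
    (hβ : β ∈ smoothForms (Euc m) M 1) (hd : β.d = RawForm.pullback f α) (q : N) {i j : Fin m}
    (hij : i ≠ j) {v : M → ℝ} (hv : ContMDiff 𝓘(ℝ, Euc m) 𝓘(ℝ, ℝ) ∞ v)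
    (hvs : tsupport v ⊆ f ⁻¹' (chartAt (Euc m) q).source) :
    P.integ (stokesDens 𝒥 𝒥' f α β (chartAt (Euc m) q) i j v) = 0 := by
  have hs : ∀ l, ContMDiff 𝓘(ℝ, Euc m) 𝓘(ℝ, ℝ) ∞ fun x => P.χ l x * v x := fun l =>
    (P.contMDiff l).mul hv
  have h1 : ∀ l, tsupport (fun x => P.χ l x * v x) ⊆ tsupport v := fun l =>
    tsupport_mul_subset_right
  have h2 : v = fun x => ∑ l ∈ P.s, P.χ l x * v x := by
    funext x
    rw [← Finset.sum_mul, P.sum_eq_one, one_mul]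
  have h3 : stokesDens 𝒥 𝒥' f α β (chartAt (Euc m) q) i j v = fun x =>
      ∑ l ∈ P.s, stokesDens 𝒥 𝒥' f α β (chartAt (Euc m) q) i j (fun x => P.χ l x * v x) x := by
    funext x
    conv_lhs => rw [h2]
    exact stokesDens_sum α β _ hij _ hs x
  rw [h3, P.integ_sum _ fun l => contDens_stokesDens hf hα hβ q hij (hs l) ((h1 l).trans hvs)]
  exact Finset.sum_eq_zero fun l _ => integ_stokesDens_of_chart P hf hα hβ hd q hij (hs l)
    ((h1 l).trans hvs) (tsupport_mul_subset_left.trans (P.tsupport_subset l))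

end TransferStokes

section TransferCurrent

open MeasureTheory Filter Topology Set

theorem integral_mul_fderiv_test {m : ℕ} {c g : Euc m → ℝ} {U : Set (Euc m)} (hU : IsOpen U)
    (hc : ContDiffOn ℝ ∞ c U) (hg : IsTest g U) (v : Euc m) :
    ∫ w, c w * fderiv ℝ g w v = -∫ w, fderiv ℝ c w v * g w := by
  have h1 : ContDiff ℝ ∞ fun w => g w * c w := contDiff_mul_of_tsupport_subset hU hg.1 hg.3 hc
  have h2 := integral_fderiv_eq_zero volume (h1.of_le (by simp)) (hg.2.mul_right) v
  have hd : ∀ w, fderiv ℝ (fun w => g w * c w) w v = c w * fderiv ℝ g w v + fderiv ℝ c w v * g w := by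
    intro w
    by_cases hw : w ∈ tsupport g
    · have hcw : DifferentiableAt ℝ c w :=
        (hc.contDiffAt (hU.mem_nhds (hg.3 hw))).differentiableAt (by simp)
      rw [fderiv_fun_mul (hg.1.differentiable (by simp) w) hcw]
      simp
      ring
    · have h3 : (fun w => g w * c w) =ᶠ[𝓝 w] fun _ => 0 := by
        filter_upwards [notMem_tsupport_iff_eventuallyEq.1 hw] with y hy
        rw [hy, Pi.zero_apply, zero_mul]
      rw [h3.fderiv_eq, (notMem_tsupport_iff_eventuallyEq.1 hw).fderiv_eq,
        image_eq_zero_of_notMem_tsupport hw]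
      simp
  have hc' : ContDiffOn ℝ ∞ (fun w => fderiv ℝ c w v) U :=
    (hc.fderiv_of_isOpen hU (by simp)).clm_apply contDiffOn_const
  have hi1 : Integrable fun w => c w * fderiv ℝ g w v := by
    simpa [mul_comm] using ((hg.fderiv v).mul_left hU hc).integrable volume
  have hi2 : Integrable fun w => fderiv ℝ c w v * g w := by
    simpa [mul_comm] using (hg.mul_left hU hc').integrable volume
  simp_rw [hd] at h2
  rw [integral_add hi1 hi2] at h2
  linarith

theorem eqOn_of_forall_integral_test {m : ℕ} {c c' : Euc m → ℝ} {U : Set (Euc m)} (hU : IsOpen U)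
    (hc : ContinuousOn c U) (hc' : ContinuousOn c' U)
    (h : ∀ g, IsTest g U → ∫ w, c w * g w = ∫ w, c' w * g w) : EqOn c c' U := by
  have hint : ∀ {b : Euc m → ℝ}, ContinuousOn b U → ∀ g, IsTest g U →
      Integrable fun w => b w * g w := by
    intro b hb g hg
    have h1 : IntegrableOn (fun w => b w * g w) (tsupport g) :=
      ((hb.mono hg.3).mul hg.continuous.continuousOn).integrableOn_compact hg.2
    refine (integrableOn_iff_integrable_of_support_subset fun w hw => ?_).1 h1
    exact subset_tsupport _ fun h0 => hw (by simp only [h0, mul_zero])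
  have hae : ∀ᵐ w, w ∈ U → c w - c' w = 0 := by
    refine hU.ae_eq_zero_of_integral_contDiff_smul_eq_zero
      ((hc.sub hc').locallyIntegrableOn hU.measurableSet) fun g h1 h2 h3 => ?_
    have hg : IsTest g U := ⟨h1, h2, h3⟩
    have := h g hg
    rw [← sub_eq_zero, ← integral_sub (hint hc g hg) (hint hc' g hg)] at this
    rw [← this]
    exact integral_congr_ae (Eventually.of_forall fun w => by simp only [smul_eq_mul]; ring)
  refine Measure.eqOn_open_of_ae_eq (μ := volume) ?_ hU hc hc'
  rw [EventuallyEq, ae_restrict_iff' hU.measurableSet]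
  exact hae.mono fun w hw hwU => sub_eq_zero.1 (hw hwU)

theorem isTest_zero {m : ℕ} (U : Set (Euc m)) : IsTest (fun _ : Euc m => (0 : ℝ)) U :=
  ⟨contDiff_const, HasCompactSupport.zero, by simp [tsupport]⟩

theorem fieldOf_isCc {m : ℕ} {X : Fin m → Euc m → ℝ} {U : Set (Euc m)}
    (hX : ∀ i, IsTest (X i) U) :
    Continuous (fieldOf X) ∧ HasCompactSupport (fieldOf X) ∧ tsupport (fieldOf X) ⊆ U := by
  have hK : IsCompact (⋃ i, tsupport (X i)) := isCompact_iUnion fun i => (hX i).2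
  have h0 : ∀ z ∉ ⋃ i, tsupport (X i), fieldOf X z = 0 := by
    intro z hz
    simp only [mem_iUnion, not_exists] at hz
    ext i
    exact (image_eq_zero_of_notMem_tsupport (hz i) : X i z = 0)
  refine ⟨(PiLp.continuous_toLp 2 _).comp (continuous_pi fun i => (hX i).continuous),
    HasCompactSupport.intro hK h0, ?_⟩
  refine (closure_minimal (fun z h => ?_) hK.isClosed).trans (iUnion_subset fun i => (hX i).3)
  by_contra h'
  exact h (h0 z h')

variable {m : ℕ} {M N : Type*} [TopologicalSpace M] [TopologicalSpace N]
  [ChartedSpace (Euc m) M] [ChartedSpace (Euc m) N]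

open Classical in
/-- The function on `N` that is `h` in the chart `e` and zero outside of it. -/
def extZero {F : Type*} [Zero F] (e : OpenPartialHomeomorph N (Euc m)) (h : Euc m → F) (y : N) :
    F := if y ∈ e.source then h (e y) else 0

omit [ChartedSpace (Euc m) N] in
theorem extZero_of_mem {F : Type*} [Zero F] {e : OpenPartialHomeomorph N (Euc m)} {h : Euc m → F}
    {y : N} (hy : y ∈ e.source) : extZero e h y = h (e y) := if_pos hy

omit [ChartedSpace (Euc m) N] in
theorem extZero_eventuallyEq {F : Type*} [Zero F] {e : OpenPartialHomeomorph N (Euc m)}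
    {h : Euc m → F} {y : N} (hy : y ∈ e.source) : extZero e h =ᶠ[𝓝 y] fun y => h (e y) := by
  filter_upwards [e.open_source.mem_nhds hy] with y' hy' using extZero_of_mem hy'

omit [ChartedSpace (Euc m) N] in
theorem extZero_eventuallyEq_zero [T2Space N] {F : Type*} [Zero F]
    {e : OpenPartialHomeomorph N (Euc m)}
    {h : Euc m → F} (hc : HasCompactSupport h) (hs : tsupport h ⊆ e.target) {y : N}
    (hy : y ∉ e.source) : extZero e h =ᶠ[𝓝 y] fun _ => 0 := by
  filter_upwards [eventually_chart_eq_zero hc hs hy] with y' hy'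
  by_cases h' : y' ∈ e.source
  · rw [extZero_of_mem h', hy' h']
  · exact if_neg h'

variable [IsManifold 𝓘(ℝ, Euc m) ∞ M] [IsManifold 𝓘(ℝ, Euc m) ∞ N]

theorem contMDiff_extZero [T2Space N] {F : Type*} [NormedAddCommGroup F] [NormedSpace ℝ F]
    {e : OpenPartialHomeomorph N (Euc m)} (he : e ∈ atlas (Euc m) N) {h : Euc m → F}
    (hh : ContDiff ℝ ∞ h) (hc : HasCompactSupport h) (hs : tsupport h ⊆ e.target) :
    ContMDiff 𝓘(ℝ, Euc m) 𝓘(ℝ, F) ∞ (extZero e h) := by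
  intro y
  by_cases hy : y ∈ e.source
  · refine ContMDiffAt.congr_of_eventuallyEq ?_ (extZero_eventuallyEq hy)
    exact hh.contMDiff.contMDiffAt.comp y
      (contMDiffAt_of_mem_maximalAtlas (IsManifold.subset_maximalAtlas he) hy)
  · exact (contMDiffAt_const (c := (0 : F))).congr_of_eventuallyEq
      (extZero_eventuallyEq_zero hc hs hy)

variable {𝒥 : AlmostComplexStructure (Euc m) M} {𝒥' : AlmostComplexStructure (Euc m) N} {f : M → N}

omit [IsManifold 𝓘(ℝ, Euc m) ∞ M] in
theorem cofForm_derivTo {e' : OpenPartialHomeomorph N (Euc m)} (he' : e' ∈ atlas (Euc m) N) {x : M}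
    (hx : f x ∈ e'.source) (ξ : Euc m →L[ℝ] ℝ) (v : Euc m) :
    cofForm (derivTo f e' x) ξ v = (rawDeriv (E := Euc m) (F := Euc m) e' (f x)).det *
      cofForm (rawDeriv (E := Euc m) (F := Euc m) f x) ξ
        (rawDeriv (E := Euc m) (F := Euc m) e'.symm (e' (f x)) v) := by
  have h := cofForm_comp (rawDeriv_chart_symm_apply he' hx)
    (rawDeriv (E := Euc m) (F := Euc m) f x) (ContinuousLinearMap.id ℝ (Euc m)) ξ v
  rw [ContinuousLinearMap.comp_id, ContinuousLinearMap.comp_id] at h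
  rw [derivTo, h]
  have h1 : (ContinuousLinearMap.id ℝ (Euc m)).det = 1 := LinearMap.det_id
  rw [h1, mul_one]

omit [IsManifold 𝓘(ℝ, Euc m) ∞ M] in
theorem rawDeriv_extZero_comp (hf : ContMDiff 𝓘(ℝ, Euc m) 𝓘(ℝ, Euc m) ∞ f)
    {e' : OpenPartialHomeomorph N (Euc m)} (he' : e' ∈ atlas (Euc m) N) {g : Euc m → ℝ}
    (hg : ContDiff ℝ ∞ g) {x : M} (hx : f x ∈ e'.source) :
    rawDeriv (E := Euc m) (F := ℝ) (fun x => extZero e' g (f x)) x =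
      (fderiv ℝ g (e' (f x))).comp (derivTo f e' x) := by
  have h0 : HasMFDerivAt 𝓘(ℝ, Euc m) 𝓘(ℝ, Euc m) f x (rawDeriv (E := Euc m) (F := Euc m) f x) :=
    (hf.mdifferentiable (by simp) _).hasMFDerivAt
  have h1 : HasMFDerivAt 𝓘(ℝ, Euc m) 𝓘(ℝ, ℝ) g (e' (f x)) (fderiv ℝ g (e' (f x))) :=
    (hg.differentiable (by simp) _).hasFDerivAt.hasMFDerivAt
  have h2 := (h1.comp (f x) (hasMFDerivAt_chart he' hx)).comp x h0
  have h3 : (fun x => extZero e' g (f x)) =ᶠ[𝓝 x] (g ∘ e') ∘ f :=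
    hf.continuous.continuousAt.eventually (extZero_eventuallyEq hx)
  exact (h2.congr_of_eventuallyEq h3).mfderiv

theorem stokesDens_extZero [T2Space N] (hf : IsPseudoholomorphic 𝒥 𝒥' f) (α : RawForm (Euc m) N 2)
    (β : RawForm (Euc m) M 1) {e' : OpenPartialHomeomorph N (Euc m)}
    (he' : e' ∈ atlas (Euc m) N) {i j : Fin m} (hij : i ≠ j) {g : Euc m → ℝ}
    (hg : IsTest g e'.target) (x : M) :
    stokesDens 𝒥 𝒥' f α β e' i j (fun x => extZero e' g (f x)) x =
      transferDens 𝒥 𝒥' f β (pushField e' (fieldOf (curlField g i j))) x +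
        degDens (m := m) f (pushDens e' fun y => g y * twoFormComp α e' i j y) x := by
  by_cases hx : f x ∈ e'.source
  · have hQ := det_rawDeriv_ne_zero he' hx
    rw [stokesDens, rawDeriv_extZero_comp hf.1 he' hg.1 hx, ← cofForm_curlVec _ _ _ hij,
      cofForm_derivTo he' hx, transferDens, pushField_of_mem hx, cofForm_smul, degDens,
      pushDens_of_mem hx, extZero_of_mem hx, signTo, derivTo, ContinuousLinearMap.det_comp,
      fieldOf_curlField, ← relSign_mul_det (isComplexStructure_val 𝒥 x)
        (isComplexStructure_val 𝒥' (f x)) (hf.rawDeriv_comm x)]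
    field_simp
  · have h1 : x ∉ tsupport fun x => extZero e' g (f x) := by
      rw [notMem_tsupport_iff_eventuallyEq]
      exact hf.1.continuous.continuousAt.eventually (extZero_eventuallyEq_zero hg.2 hg.3 hx)
    rw [stokesDens_eq_zero α β _ hij h1, transferDens, degDens, pushField_eq_zero fun h => absurd h hx,
      pushDens_eq_zero fun h => absurd h hx, cofForm_zero]
    simp

/-- The transfer `T` of `β` and the transfer `D` of `1` satisfy `dT = D α` if `dβ = f^*α`. Pairing
with the field `curlField g i j` is pairing `dT` with the density `-g` in the component `i j`. -/
theorem integ_transferDens_curlField [T2Space M] [T2Space N] [CompactSpace M]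
    (P : ChartPartition m M) (hf : IsPseudoholomorphic 𝒥 𝒥' f)
    {α : RawForm (Euc m) N 2} (hα : α ∈ smoothForms (Euc m) N 2) {β : RawForm (Euc m) M 1}
    (hβ : β ∈ smoothForms (Euc m) M 1) (hd : β.d = RawForm.pullback f α) (q : N) {i j : Fin m}
    (hij : i ≠ j) {g : Euc m → ℝ} (hg : IsTest g (chartAt (Euc m) q).target) :
    P.integ (transferDens 𝒥 𝒥' f β (pushField (chartAt (Euc m) q) (fieldOf (curlField g i j)))) =
      -P.integ (degDens (m := m) f (pushDens (chartAt (Euc m) q)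
        fun y => g y * twoFormComp α (chartAt (Euc m) q) i j y)) := by
  set e' := chartAt (Euc m) q with he'def
  have he' : e' ∈ atlas (Euc m) N := chart_mem_atlas _ q
  have hv : ContMDiff 𝓘(ℝ, Euc m) 𝓘(ℝ, ℝ) ∞ fun x => extZero e' g (f x) :=
    (contMDiff_extZero he' hg.1 hg.2 hg.3).comp hf.1
  have hvs : tsupport (fun x => extZero e' g (f x)) ⊆ f ⁻¹' e'.source := fun x hx => by
    by_contra h
    refine notMem_tsupport_iff_eventuallyEq.2 ?_ hx
    exact hf.1.continuous.continuousAt.eventually (extZero_eventuallyEq_zero hg.2 hg.3 h)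
  have key := integ_stokesDens (𝒥 := 𝒥) (𝒥' := 𝒥') P hf.1 hα hβ hd q hij hv hvs
  have hX := fieldOf_isCc fun k => hg.curlField i j k
  have h1 : ContDens (m := m) (transferDens 𝒥 𝒥' f β
      (pushField e' (fieldOf (curlField g i j)))) :=
    contDens_transferDens hf.1 hβ q hX.1 hX.2.1 hX.2.2
  have hg' := hg.mul_left e'.open_target (contDiffOn_twoFormComp hα he' i j)
  have h2 : ContDens (m := m) (degDens (m := m) f (pushDens e'
      fun y => g y * twoFormComp α e' i j y)) :=
    contDens_degDens hf.1 q hg'.continuous hg'.2 hg'.3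
  have h3 := P.integ_sum Finset.univ (γ := ![transferDens 𝒥 𝒥' f β
      (pushField e' (fieldOf (curlField g i j))), degDens (m := m) f (pushDens e'
      fun y => g y * twoFormComp α e' i j y)]) (fun i => by fin_cases i <;> assumption)
  simp only [Fin.sum_univ_two, Matrix.cons_val_zero, Matrix.cons_val_one] at h3
  rw [show stokesDens 𝒥 𝒥' f α β e' i j (fun x => extZero e' g (f x)) = _ from
    funext (stokesDens_extZero hf α β he' hij hg), h3] at key
  linarith

/-- A global map that agrees with a chart over a ball. -/
theorem exists_contMDiff_eq_chart [T2Space N] {e : OpenPartialHomeomorph N (Euc m)}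
    (he : e ∈ atlas (Euc m) N) {w₀ : Euc m} {a b : ℝ} (ha : 0 < a) (hab : a < b)
    (hb : Metric.closedBall w₀ b ⊆ e.target) :
    ∃ Ψ : N → Euc m, ContMDiff 𝓘(ℝ, Euc m) 𝓘(ℝ, Euc m) ∞ Ψ ∧
      ∀ y ∈ e.source, e y ∈ Metric.closedBall w₀ a → Ψ y = e y := by
  let bump : ContDiffBump w₀ := ⟨a, b, ha, hab⟩
  have hts : tsupport (fun w => bump w • w) ⊆ Metric.closedBall w₀ b :=
    (tsupport_smul_subset_left _ _).trans bump.tsupport_eq.subset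
  refine ⟨extZero e fun w => bump w • w, contMDiff_extZero he (bump.contDiff.smul contDiff_id)
    bump.hasCompactSupport.smul_right (hts.trans hb), fun y hy hya => ?_⟩
  rw [extZero_of_mem hy, bump.one_of_mem_closedBall hya, one_smul]

theorem cofForm_sum {ι : Type*} (A : Euc m →L[ℝ] Euc m) (ξ : Euc m →L[ℝ] ℝ) (s : Finset ι)
    (v : ι → Euc m) : cofForm A ξ (∑ l ∈ s, v l) = ∑ l ∈ s, cofForm A ξ (v l) := by
  simp only [cofForm]
  rw [Finset.sum_comm]
  refine Finset.sum_congr rfl fun j _ => ?_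
  rw [← Finset.sum_mul]
  congr 1
  simp

/-- The transfer of a one-form is a current of order zero: its components are push-forwards of
continuous densities on `M`. -/
theorem exists_transfer_measure [T2Space N] [CompactSpace M]
    (P : ChartPartition m M) (hf : ContMDiff 𝓘(ℝ, Euc m) 𝓘(ℝ, Euc m) ∞ f)
    {β : RawForm (Euc m) M 1} (hβ : β ∈ smoothForms (Euc m) M 1) (q : N) {w₀ : Euc m} {a b : ℝ}
    (ha : 0 < a) (hab : a < b) (hb : Metric.closedBall w₀ b ⊆ (chartAt (Euc m) q).target) :
    ∃ κ : Fin m → FinSigned m, ∀ X : Fin m → Euc m → ℝ, (∀ i, IsTest (X i) (Metric.ball w₀ a)) →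
      P.integ (transferDens 𝒥 𝒥' f β (pushField (chartAt (Euc m) q) (fieldOf X))) =
        ∑ j, (κ j).int (X j) := by
  set e' := chartAt (Euc m) q with he'def
  have he' : e' ∈ atlas (Euc m) N := chart_mem_atlas _ q
  obtain ⟨Ψ, hΨ, hΨe⟩ := exists_contMDiff_eq_chart he' (a := (a + b) / 2) (b := b) (by linarith)
    (by linarith) hb
  let bump : ContDiffBump w₀ := ⟨a, (a + b) / 2, ha, by linarith⟩
  have hts : ∀ j : Fin m, tsupport (fun w => bump w • bv j) ⊆ e'.target := fun j =>
    ((tsupport_smul_subset_left _ _).trans bump.tsupport_eq.subset).trans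
      ((Metric.closedBall_subset_closedBall (by change (a + b) / 2 ≤ b; linarith)).trans hb)
  have hcd : ∀ j : Fin m, ContDens (m := m) (transferDens 𝒥 𝒥' f β
      (pushField e' fun w => bump w • bv j)) := fun j =>
    contDens_transferDens hf hβ q (bump.continuous.smul continuous_const)
      bump.hasCompactSupport.smul_right (hts j)
  choose κ hκ using fun j => P.exists_map (hcd j) (a := fun x => Ψ (f x))
    (hΨ.continuous.comp hf.continuous)
  refine ⟨κ, fun X hX => ?_⟩
  rw [← Finset.sum_congr rfl fun j _ => hκ j (X j) (hX j).isCc]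
  have hpt : transferDens 𝒥 𝒥' f β (pushField e' (fieldOf X)) = fun x => ∑ j, X j (Ψ (f x)) *
      transferDens 𝒥 𝒥' f β (pushField e' fun w => bump w • bv j) x := by
    funext x
    have hzero : (f x ∈ e'.source → e' (f x) ∉ Metric.ball w₀ a) →
        transferDens 𝒥 𝒥' f β (pushField e' (fieldOf X)) x = 0 := by
      intro h
      rw [transferDens, pushField_eq_zero, cofForm_zero, mul_zero]
      intro hx
      ext j
      exact (hX j).eq_zero (h hx)
    by_cases hx : f x ∈ e'.source
    · by_cases hw : e' (f x) ∈ Metric.ball w₀ a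
      · have hw' := Metric.ball_subset_closedBall hw
        rw [hΨe _ hx (Metric.closedBall_subset_closedBall (by linarith) hw')]
        have h1 : fieldOf X (e' (f x)) = ∑ j, X j (e' (f x)) • bv j :=
          (sum_smul_bv (fieldOf X (e' (f x)))).symm
        simp only [transferDens, pushField_of_mem hx, bump.one_of_mem_closedBall hw', one_smul]
        rw [h1, map_sum, Finset.smul_sum, cofForm_sum, Finset.mul_sum]
        refine Finset.sum_congr rfl fun j _ => ?_
        rw [map_smul, smul_comm, cofForm_smul]
        ring
      · rw [hzero fun _ => hw]
        refine (Finset.sum_eq_zero fun j _ => ?_).symm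
        by_cases hw2 : e' (f x) ∈ Metric.closedBall w₀ ((a + b) / 2)
        · rw [hΨe _ hx hw2, (hX j).eq_zero hw, zero_mul]
        · rw [transferDens, pushField_eq_zero, cofForm_zero, mul_zero, mul_zero]
          intro _
          have : e' (f x) ∉ tsupport bump := by rw [bump.tsupport_eq]; exact hw2
          rw [image_eq_zero_of_notMem_tsupport this, zero_smul]
    · rw [hzero fun h => absurd h hx]
      refine (Finset.sum_eq_zero fun j _ => ?_).symm
      rw [transferDens, pushField_eq_zero fun h => absurd h hx, cofForm_zero, mul_zero, mul_zero]
  rw [hpt, P.integ_sum]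
  exact fun j => (hcd j).mul (((hX j).continuous.comp hΨ.continuous).comp hf.continuous)

end TransferCurrent

/-! ### The degree function -/

section Degree

open MeasureTheory Filter Topology Set

variable {m : ℕ} {M N : Type*} [TopologicalSpace M] [TopologicalSpace N]
  [ChartedSpace (Euc m) M] [ChartedSpace (Euc m) N]
variable [IsManifold 𝓘(ℝ, Euc m) ∞ M] [IsManifold 𝓘(ℝ, Euc m) ∞ N]
variable {𝒥 : AlmostComplexStructure (Euc m) M} {𝒥' : AlmostComplexStructure (Euc m) N} {f : M → N}

/-- The constant one-form `dyⱼ` on `ℝᵐ`. -/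
def coordForm (j : Fin m) : RawForm (Euc m) (Euc m) 1 := fun _ =>
  ContinuousAlternatingMap.ofSubsingleton ℝ (Euc m) ℝ (0 : Fin 1) (EuclideanSpace.proj (𝕜 := ℝ) j)

theorem coordForm_inChart (j : Fin m) (z : Euc m) :
    (coordForm j).inChart (OpenPartialHomeomorph.refl (Euc m)) z =
      ContinuousAlternatingMap.ofSubsingleton ℝ (Euc m) ℝ (0 : Fin 1)
        (EuclideanSpace.proj (𝕜 := ℝ) j) := by
  have h : rawDeriv (E := Euc m) (F := Euc m) (OpenPartialHomeomorph.refl (Euc m)).symm z =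
      ContinuousLinearMap.id ℝ (Euc m) := rawDeriv_id z
  rw [RawForm.inChart_eq, h]
  rfl

theorem coordForm_mem_closedForms (j : Fin m) : coordForm j ∈ closedForms (Euc m) (Euc m) 1 := by
  have h1 : (coordForm j).inChart (OpenPartialHomeomorph.refl (Euc m)) = fun _ =>
      ContinuousAlternatingMap.ofSubsingleton ℝ (Euc m) ℝ (0 : Fin 1)
        (EuclideanSpace.proj (𝕜 := ℝ) j) := funext (coordForm_inChart j)
  refine ⟨fun e he => ?_, ?_⟩
  · rw [chartedSpaceSelf_atlas.1 he, h1]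
    exact contDiffOn_const
  · funext z
    change (extDeriv ((coordForm j).inChart (OpenPartialHomeomorph.refl (Euc m)))
      z).compContinuousLinearMap _ = 0
    have h2 : extDeriv ((coordForm j).inChart (OpenPartialHomeomorph.refl (Euc m))) z = 0 := by
      ext v
      rw [h1, extDeriv_apply (differentiableAt_const _)]
      simp
    rw [h2]
    rfl

theorem toCov_pullback_coordForm {e : OpenPartialHomeomorph N (Euc m)} (he : e ∈ atlas (Euc m) N)
    {Ψ : N → Euc m} {w₀ : Euc m} {a : ℝ}
    (hΨ : ∀ y ∈ e.source, e y ∈ Metric.closedBall w₀ a → Ψ y = e y) {y : N} (hy : y ∈ e.source)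
    (hya : e y ∈ Metric.ball w₀ a) (j : Fin m) (v : Euc m) :
    toCov ((RawForm.pullback Ψ (coordForm j) : RawForm (Euc m) N 1).val y)
      (rawDeriv (E := Euc m) (F := Euc m) e.symm (e y) v) = v j := by
  have h1 : Ψ =ᶠ[𝓝 y] e := by
    filter_upwards [e.open_source.mem_nhds hy,
      (e.continuousAt hy).eventually (Metric.isOpen_ball.mem_nhds hya)] with y' h h'
      using hΨ y' h (Metric.ball_subset_closedBall h')
  have h2 : rawDeriv (E := Euc m) (F := Euc m) Ψ y = rawDeriv (E := Euc m) (F := Euc m) e y :=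
    h1.mfderiv_eq
  rw [RawForm.pullback_val, toCov_comp, h2, ContinuousLinearMap.comp_apply,
    rawDeriv_chart_symm_apply he hy]
  rfl

/-- For `β = f^*(dyⱼ)` the transfer of `β` is the transfer of `1` times `dyⱼ`. -/
theorem transferDens_coordForm (hf : IsPseudoholomorphic 𝒥 𝒥' f)
    {e : OpenPartialHomeomorph N (Euc m)} (he : e ∈ atlas (Euc m) N)
    {Ψ : N → Euc m} {w₀ : Euc m} {a : ℝ}
    (hΨ : ∀ y ∈ e.source, e y ∈ Metric.closedBall w₀ a → Ψ y = e y) (j : Fin m)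
    {X : Fin m → Euc m → ℝ} (hX : ∀ i, IsTest (X i) (Metric.ball w₀ a)) :
    transferDens 𝒥 𝒥' f
      (RawForm.pullback f (RawForm.pullback Ψ (coordForm j) : RawForm (Euc m) N 1))
        (pushField e (fieldOf X)) = degDens (m := m) f (pushDens e (X j)) := by
  funext x
  rw [transferDens_pullback hf]
  congr 1
  funext y
  by_cases hy : y ∈ e.source ∧ e y ∈ Metric.ball w₀ a
  · rw [pushField_of_mem hy.1, pushDens_of_mem hy.1, map_smul,
      toCov_pullback_coordForm he hΨ hy.1 hy.2]
    rfl
  · rw [pushField_eq_zero, pushDens_eq_zero, map_zero]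
    · exact fun h => (hX j).eq_zero fun h' => hy ⟨h, h'⟩
    · intro h
      ext i
      exact (hX i).eq_zero fun h' => hy ⟨h, h'⟩

/-- The transfer `D` of `1` is locally a constant, the degree: its product with each closed form
`dyⱼ` is the transfer of a closed form, hence closed, so that the weak gradient of `D` vanishes. In
dimension one `D dy` is closed for every `D`, whence the lower bound for `m`. -/
theorem exists_degree [T2Space M] [T2Space N] [CompactSpace M] (hm : 2 ≤ m)
    (P : ChartPartition m M) (hf : IsPseudoholomorphic 𝒥 𝒥' f) (q : N) {w₀ : Euc m} {r b : ℝ}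
    (hr : 0 < r) (hrb : 3 * r < b) (hb : Metric.closedBall w₀ b ⊆ (chartAt (Euc m) q).target) :
    ∃ c : ℝ, ∀ g, IsTest g (Metric.ball w₀ r) →
      P.integ (degDens (m := m) f (pushDens (chartAt (Euc m) q) g)) = c * ∫ w, g w := by
  set e' := chartAt (Euc m) q with he'def
  have he' : e' ∈ atlas (Euc m) N := chart_mem_atlas _ q
  have hball : Metric.ball w₀ (3 * r) ⊆ e'.target :=
    (Metric.ball_subset_closedBall.trans (Metric.closedBall_subset_closedBall hrb.le)).trans hb
  obtain ⟨Ψ, hΨ, hΨe⟩ := exists_contMDiff_eq_chart he' (by linarith : 0 < 3 * r) hrb hb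
  let β : Fin m → RawForm (Euc m) M 1 := fun j =>
    RawForm.pullback f (RawForm.pullback Ψ (coordForm j) : RawForm (Euc m) N 1)
  have hβ : ∀ j, β j ∈ closedForms (Euc m) M 1 := fun j =>
    RawForm.pullback_mem_closedForms hf.1 _
      (RawForm.pullback_mem_closedForms hΨ _ (coordForm_mem_closedForms j))
  have hT := fun (j : Fin m) (X : Fin m → Euc m → ℝ)
    (hX : ∀ i, IsTest (X i) (Metric.ball w₀ (3 * r))) =>
    congrArg P.integ (transferDens_coordForm hf he' hΨe j hX)
  -- The weak derivative in the direction `i` comes from `dyⱼ` for any `j ≠ i`.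
  have hD : ∀ (i : Fin m) g, IsTest g (Metric.ball w₀ (3 * r)) →
      P.integ (degDens (m := m) f (pushDens e' fun w => fderiv ℝ g w (bv i))) = 0 := by
    intro i g hg
    obtain ⟨j, hij⟩ : ∃ j : Fin m, i ≠ j := by
      have : Nontrivial (Fin m) := Fin.nontrivial_iff_two_le.2 hm
      exact (exists_ne i).imp fun _ h => h.symm
    have h1 := integ_transferDens_curlField (α := 0) P hf (Submodule.zero_mem _) (hβ j).1
      (by rw [map_zero]; exact (hβ j).2) q hij (hg.mono hball)
    rw [hT j _ fun k => hg.curlField i j k] at h1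
    have h2 : curlField g i j j = fun w => fderiv ℝ g w (bv i) := by
      funext w
      simp [curlField, hij.symm]
    rw [h2] at h1
    rw [h1, neg_eq_zero]
    have h3 : degDens (m := m) f (pushDens e' fun y => g y *
        twoFormComp (0 : RawForm (Euc m) N 2) e' i j y) = fun _ => 0 := by
      funext x
      rw [degDens, pushDens_eq_zero, mul_zero]
      intro _
      have h4 : twoFormComp (0 : RawForm (Euc m) N 2) e' i j (e' (f x)) = 0 := rfl
      rw [h4, mul_zero]
    rw [h3]
    simp [ChartPartition.integ, dens]
  -- The transfer of `1` is a measure, being the component `j₀` of the transfer of `f^*(dy_{j₀})`.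
  let j₀ : Fin m := ⟨0, by omega⟩
  obtain ⟨κ, hκ⟩ := exists_transfer_measure (𝒥 := 𝒥) (𝒥' := 𝒥') P hf.1 (hβ j₀).1 q
    (by linarith : 0 < 3 * r) hrb hb
  have hκ' : ∀ g, IsTest g (Metric.ball w₀ (3 * r)) →
      P.integ (degDens (m := m) f (pushDens e' g)) = (κ j₀).int g := by
    intro g hg
    let X : Fin m → Euc m → ℝ := fun i => if i = j₀ then g else fun _ => 0
    have hX : ∀ i, IsTest (X i) (Metric.ball w₀ (3 * r)) := by
      intro i
      by_cases h : i = j₀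
      · simp only [X, h, if_true]; exact hg
      · simp only [X, h, if_false]; exact isTest_zero _
    have h1 := hT j₀ X hX
    rw [hκ X hX, Finset.sum_eq_single j₀] at h1
    · simpa [X] using h1.symm
    · intro i _ hi
      simp only [X, hi, if_false]
      exact (κ i).int_congr_zero fun _ => rfl
    · simp
  obtain ⟨c, hc, hcg⟩ := exists_density (κ := κ j₀) hr (θ := fun _ _ => 0)
    (fun _ => contDiffOn_const) fun X hX => by
      rw [show divg X = fun z => ∑ i, fderiv ℝ (X i) z (bv i) from rfl,
        (κ j₀).int_sum _ fun i => ((hX i).fderiv _).isCc]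
      simp only [zero_mul, integral_zero]
      exact Finset.sum_congr rfl fun i _ => by
        rw [← hκ' _ ((hX i).fderiv _), hD i _ (hX i)]
  have hsub : Metric.ball w₀ r ⊆ Metric.ball w₀ (3 * r) := Metric.ball_subset_ball (by linarith)
  have hdc : ∀ i, EqOn (fun w => fderiv ℝ c w (bv i)) (fun _ => 0) (Metric.ball w₀ r) := by
    intro i
    refine eqOn_of_forall_integral_test Metric.isOpen_ball ?_ continuousOn_const fun g hg => ?_
    · exact ((hc.continuous_fderiv (by simp)).clm_apply continuous_const).continuousOn
    · have h1 := integral_mul_fderiv_test Metric.isOpen_ball hc.contDiffOn hg (bv i)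
      rw [← hcg _ (hg.fderiv _), ← hκ' _ ((hg.fderiv _).mono hsub), hD i g (hg.mono hsub)] at h1
      simp only [zero_mul, integral_zero]
      linarith
  have hconst : ∀ w ∈ Metric.ball w₀ r, c w = c w₀ := by
    intro w hw
    refine Metric.isOpen_ball.is_const_of_fderiv_eq_zero (𝕜 := ℝ) (convex_ball w₀ r).isPreconnected
      (hc.differentiable (by simp)).differentiableOn (fun z hz => ?_) hw (Metric.mem_ball_self hr)
    ext v
    rw [← sum_smul_bv v, map_sum]
    simp only [map_smul, Pi.zero_apply, zero_apply]
    exact Finset.sum_eq_zero fun i _ => by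
      have := hdc i hz
      simp only at this
      rw [this, smul_zero]
  refine ⟨c w₀, fun g hg => ?_⟩
  rw [hκ' g (hg.mono hsub), hcg g hg, ← integral_const_mul]
  refine integral_congr_ae (Eventually.of_forall fun w => ?_)
  by_cases hw : w ∈ Metric.ball w₀ r
  · simp only [hconst w hw]
  · simp only [hg.eq_zero hw, mul_zero]

theorem exists_bump_test (w₀ : Euc m) {a b : ℝ} (ha : 0 < a) (hab : a < b) :
    ∃ g : Euc m → ℝ, IsTest g (Metric.ball w₀ b) ∧ (∀ w, 0 ≤ g w) ∧
      (∀ w ∈ Metric.ball w₀ a, 0 < g w) ∧ 0 < ∫ w, g w := by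
  let bump : ContDiffBump w₀ := ⟨a, (a + b) / 2, ha, by linarith⟩
  refine ⟨bump, ⟨bump.contDiff, bump.hasCompactSupport, ?_⟩, fun w => bump.nonneg, fun w hw => ?_,
    bump.integral_pos⟩
  · rw [bump.tsupport_eq]
    exact Metric.closedBall_subset_ball (by change (a + b) / 2 < b; linarith)
  · rw [bump.one_of_mem_closedBall (Metric.ball_subset_closedBall hw)]
    exact one_pos

/-- The degree is positive: it is computed by integrating `|det df|` over the preimage of a
ball, so if it vanished then, `f` being surjective, all points of the ball would be critical values,
against Sard's theorem. -/
theorem degree_pos [CompactSpace M] [T2Space N] (P : ChartPartition m M)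
    (hf : ContMDiff 𝓘(ℝ, Euc m) 𝓘(ℝ, Euc m) ∞ f)
    (hsurj : Function.Surjective f) (q : N) {w₀ : Euc m} {r : ℝ}
    (hr : 0 < r) (hb : Metric.ball w₀ r ⊆ (chartAt (Euc m) q).target) {c : ℝ}
    (hc : ∀ g, IsTest g (Metric.ball w₀ r) →
      P.integ (degDens (m := m) f (pushDens (chartAt (Euc m) q) g)) = c * ∫ w, g w) : 0 < c := by
  set e' := chartAt (Euc m) q with he'def
  have he' : e' ∈ atlas (Euc m) N := chart_mem_atlas _ q
  obtain ⟨g, hg, hg0, hgp, hgi⟩ := exists_bump_test w₀ (half_pos hr) (half_lt_self hr)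
  have hnn : ∀ x, 0 ≤ degDens (m := m) f (pushDens e' g) x := by
    intro x
    refine mul_nonneg (abs_nonneg _) ?_
    unfold pushDens
    split_ifs
    · exact mul_nonneg (abs_nonneg _) (hg0 _)
    · exact le_rfl
  have hc0 : 0 ≤ c := by
    have := P.integ_nonneg hnn
    rw [hc g hg] at this
    exact nonneg_of_mul_nonneg_left this hgi
  refine hc0.lt_of_ne' fun h0 => ?_
  have hcont := contDens_degDens hf q hg.continuous hg.2 (hg.3.trans hb)
  have hzero := P.eq_zero_of_integ_eq_zero hcont hnn (by rw [hc g hg, h0, zero_mul])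
  have hcrit : ∀ x, f x ∈ e'.source → e' (f x) ∈ Metric.ball w₀ (r / 2) →
      (rawDeriv (E := Euc m) (F := Euc m) f x).det = 0 := by
    intro x hx hw
    have h := hzero x
    rw [degDens, pushDens_of_mem hx] at h
    have h1 := det_rawDeriv_ne_zero he' hx
    have h2 := (hgp _ hw).ne'
    simpa [h1, h2] using h
  -- All points of the ball are critical values, which is excluded by Sard's theorem.
  have hcov : Metric.ball w₀ (r / 2) ⊆ ⋃ k ∈ P.s, inCharts f (chartAt (Euc m) k) e' ''
      {z ∈ chartDomain f (chartAt (Euc m) k) e' | inCharts f (chartAt (Euc m) k) e' z ∈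
        Metric.ball w₀ (r / 2)} := by
    intro w hw
    have hwt : w ∈ e'.target := hb (Metric.ball_subset_ball (by linarith) hw)
    obtain ⟨x, hx⟩ := hsurj (e'.symm w)
    obtain ⟨k, hk, hkx⟩ : ∃ k ∈ P.s, P.χ k x ≠ 0 := by
      by_contra! hc
      have := P.sum_eq_one x
      rw [Finset.sum_eq_zero hc] at this
      exact zero_ne_one this
    have hxk : x ∈ (chartAt (Euc m) k).source := P.tsupport_subset k (subset_tsupport _ hkx)
    have hv : inCharts f (chartAt (Euc m) k) e' (chartAt (Euc m) k x) = w := by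
      simp only [inCharts]
      rw [(chartAt (Euc m) k).left_inv hxk, hx, e'.right_inv hwt]
    refine mem_iUnion₂.2 ⟨k, hk, chartAt (Euc m) k x, ⟨⟨(chartAt (Euc m) k).map_source hxk, ?_⟩, ?_⟩,
      hv⟩
    · change f ((chartAt (Euc m) k).symm (chartAt (Euc m) k x)) ∈ e'.source
      rw [(chartAt (Euc m) k).left_inv hxk, hx]
      exact e'.map_target hwt
    · rw [hv]; exact hw
  have hnull : volume (Metric.ball w₀ (r / 2)) = 0 := by
    refine measure_mono_null hcov ((measure_biUnion_null_iff P.s.countable_toSet).2 fun k _ => ?_)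
    have he := chart_mem_atlas (Euc m) k
    refine addHaar_image_eq_zero_of_det_fderivWithin_eq_zero volume
      (f' := fderiv ℝ (inCharts f (chartAt (Euc m) k) e')) (fun z hz =>
        (hasFDerivAt_inCharts hf he he' hz.1).differentiableAt.hasFDerivAt.hasFDerivWithinAt)
      fun z hz => ?_
    rw [fderiv_inCharts hf he he' hz.1, ContinuousLinearMap.det_comp, ContinuousLinearMap.det_comp,
      hcrit _ hz.1.2 hz.2]
    simp
  exact (Metric.measure_ball_pos volume w₀ (half_pos hr)).ne' hnull

end Degree

/-! ### Change of charts for densities and vector densities -/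

section ChartChange

open MeasureTheory Filter Topology Set

variable {m : ℕ} {N : Type*} [TopologicalSpace N] [ChartedSpace (Euc m) N]

open Classical in
/-- The coordinate expression of a density, extended by zero. -/
def dens0 (e : OpenPartialHomeomorph N (Euc m)) (γ : N → ℝ) (w : Euc m) : ℝ :=
  if w ∈ e.target then dens e γ w else 0

open Classical in
/-- The components of a vector density in a chart, extended by zero. For a change of charts,
`fieldIn e' (pushField e X)` is the transform of the field `X`. -/
def fieldIn (e : OpenPartialHomeomorph N (Euc m)) (X : N → Euc m) (k : Fin m) (w : Euc m) : ℝ :=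
  if w ∈ e.target then |(rawDeriv (E := Euc m) (F := Euc m) e.symm w).det| *
    rawDeriv (E := Euc m) (F := Euc m) e (e.symm w) (X (e.symm w)) k else 0

variable [IsManifold 𝓘(ℝ, Euc m) ∞ N]

theorem abs_det_chart_mul {e : OpenPartialHomeomorph N (Euc m)} (he : e ∈ atlas (Euc m) N)
    {x : N} (hx : x ∈ e.source) : |(rawDeriv (E := Euc m) (F := Euc m) e x).det| *
      |(rawDeriv (E := Euc m) (F := Euc m) e.symm (e x)).det| = 1 := by
  rw [← abs_mul, det_chart_mul_det_symm he hx, abs_one]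

theorem pushDens_dens0 {e : OpenPartialHomeomorph N (Euc m)} (he : e ∈ atlas (Euc m) N)
    {γ : N → ℝ} (hγ : ∀ y ∉ e.source, γ y = 0) : pushDens e (dens0 e γ) = γ := by
  funext y
  by_cases hy : y ∈ e.source
  · rw [pushDens_of_mem hy, dens0, if_pos (e.map_source hy), dens, e.left_inv hy]
    linear_combination γ y * abs_det_chart_mul he hy
  · rw [pushDens_eq_zero fun h => absurd h hy, hγ y hy]

theorem pushField_fieldIn {e : OpenPartialHomeomorph N (Euc m)} (he : e ∈ atlas (Euc m) N)
    {X : N → Euc m} (hX : ∀ y ∉ e.source, X y = 0) :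
    pushField e (fieldOf (fieldIn e X)) = X := by
  funext y
  by_cases hy : y ∈ e.source
  · have h1 : fieldOf (fieldIn e X) (e y) =
        |(rawDeriv (E := Euc m) (F := Euc m) e.symm (e y)).det| •
          rawDeriv (E := Euc m) (F := Euc m) e y (X y) := by
      ext k
      simp only [fieldOf_apply, fieldIn, if_pos (e.map_source hy), e.left_inv hy]
      rfl
    rw [pushField_of_mem hy, h1, map_smul, rawDeriv_symm_chart_apply he hy, smul_smul,
      abs_det_chart_mul he hy, one_smul]
  · rw [pushField_eq_zero fun h => absurd h hy, hX y hy]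

theorem dens_pushDens {e : OpenPartialHomeomorph N (Euc m)} (he : e ∈ atlas (Euc m) N)
    (g : Euc m → ℝ) {z : Euc m} (hz : z ∈ e.target) : dens e (pushDens e g) z = g z := by
  have hx := e.map_target hz
  have h := abs_det_chart_mul he hx
  rw [e.right_inv hz] at h
  rw [dens, pushDens_of_mem hx, e.right_inv hz]
  linear_combination g z * h

theorem dens0_pushDens {e e' : OpenPartialHomeomorph N (Euc m)} (he : e ∈ atlas (Euc m) N)
    (he' : e' ∈ atlas (Euc m) N) (g : Euc m → ℝ) {w : Euc m} (hw : w ∈ chartDomain id e' e) :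
    dens0 e' (pushDens e g) w =
      |(fderiv ℝ (inCharts id e' e) w).det| * g (inCharts id e' e w) := by
  have hx : e'.symm w ∈ e.source := hw.2
  rw [dens0, if_pos hw.1, ← dens_transition he' he _ hw]
  congr 1
  exact dens_pushDens he g (e.map_source hx)

omit [IsManifold 𝓘(ℝ, Euc m) ∞ N] in
theorem dens0_pushDens_of_notMem {e e' : OpenPartialHomeomorph N (Euc m)} (g : Euc m → ℝ)
    {w : Euc m} (hw : w ∉ chartDomain id e' e) : dens0 e' (pushDens e g) w = 0 := by
  unfold dens0
  split_ifs with h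
  · have hx : e'.symm w ∉ e.source := fun hx => hw ⟨h, hx⟩
    rw [dens, pushDens_eq_zero fun h' => absurd h' hx, zero_mul]
  · rfl

omit [ChartedSpace (Euc m) N] [IsManifold 𝓘(ℝ, Euc m) ∞ N] in
theorem transition_left_inv {e e' : OpenPartialHomeomorph N (Euc m)} {w : Euc m}
    (hw : w ∈ chartDomain id e' e) : inCharts id e e' (inCharts id e' e w) = w := by
  have hx : e'.symm w ∈ e.source := hw.2
  simp only [inCharts, id, e.left_inv hx, e'.right_inv hw.1]

omit [ChartedSpace (Euc m) N] [IsManifold 𝓘(ℝ, Euc m) ∞ N] in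
theorem transition_mem {e e' : OpenPartialHomeomorph N (Euc m)} {w : Euc m}
    (hw : w ∈ chartDomain id e' e) : inCharts id e' e w ∈ chartDomain id e e' := by
  rw [← image_transition]
  exact mem_image_of_mem _ hw

theorem fderiv_transition_comp {e e' : OpenPartialHomeomorph N (Euc m)} (he : e ∈ atlas (Euc m) N)
    (he' : e' ∈ atlas (Euc m) N) {w : Euc m} (hw : w ∈ chartDomain id e' e) (v : Euc m) :
    fderiv ℝ (inCharts id e' e) w (fderiv ℝ (inCharts id e e') (inCharts id e' e w) v) = v := by
  have hx : e'.symm w ∈ e.source := hw.2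
  have h1 := rawDeriv_symm_chart_apply he' (e'.map_target hw.1)
  rw [e'.right_inv hw.1] at h1
  rw [fderiv_transition he' he hw, fderiv_transition he he' (transition_mem hw)]
  simp only [ContinuousLinearMap.comp_apply]
  simp only [inCharts, id, e.left_inv hx, h1]
  exact rawDeriv_chart_symm_apply he hx v

theorem det_transition_ne_zero {e e' : OpenPartialHomeomorph N (Euc m)} (he : e ∈ atlas (Euc m) N)
    (he' : e' ∈ atlas (Euc m) N) {w : Euc m} (hw : w ∈ chartDomain id e' e) :
    (fderiv ℝ (inCharts id e' e) w).det ≠ 0 := by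
  have h : (fderiv ℝ (inCharts id e' e) w).comp
      (fderiv ℝ (inCharts id e e') (inCharts id e' e w)) = ContinuousLinearMap.id ℝ (Euc m) :=
    ContinuousLinearMap.ext fun v => fderiv_transition_comp he he' hw v
  have h1 := congrArg ContinuousLinearMap.det h
  rw [ContinuousLinearMap.det_comp] at h1
  exact left_ne_zero_of_mul_eq_one (h1.trans LinearMap.det_id)

omit [IsManifold 𝓘(ℝ, Euc m) ∞ N] in
theorem fieldIn_pushField_of_notMem {e e' : OpenPartialHomeomorph N (Euc m)} (X : Euc m → Euc m)
    (k : Fin m) {w : Euc m} (hw : w ∉ chartDomain id e' e) :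
    fieldIn e' (pushField e X) k w = 0 := by
  unfold fieldIn
  split_ifs with h
  · have hx : e'.symm w ∉ e.source := fun hx => hw ⟨h, hx⟩
    rw [pushField_eq_zero fun h' => absurd h' hx, map_zero]
    simp
  · rfl

theorem fieldIn_pushField {e e' : OpenPartialHomeomorph N (Euc m)} (he : e ∈ atlas (Euc m) N)
    (he' : e' ∈ atlas (Euc m) N) (X : Euc m → Euc m) (k : Fin m) {w : Euc m}
    (hw : w ∈ chartDomain id e' e) :
    fieldIn e' (pushField e X) k w = |(fderiv ℝ (inCharts id e' e) w).det| *
      fderiv ℝ (inCharts id e e') (inCharts id e' e w) (X (inCharts id e' e w)) k := by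
  have hx : e'.symm w ∈ e.source := hw.2
  rw [fieldIn, if_pos hw.1, pushField_of_mem hx, fderiv_transition he he' (transition_mem hw),
    fderiv_transition he' he hw, ContinuousLinearMap.det_comp, abs_mul]
  simp only [ContinuousLinearMap.comp_apply, inCharts, id, e.left_inv hx, map_smul]
  simp only [PiLp.smul_apply, smul_eq_mul]
  ring

theorem cofForm_eq_det_mul {A B : Euc m →L[ℝ] Euc m} (h : ∀ v, A (B v) = v) (ξ : Euc m →L[ℝ] ℝ)
    (v : Euc m) : cofForm A ξ v = A.det * ξ (B v) := by
  have h1 := cofForm_comp h (ContinuousLinearMap.id ℝ (Euc m)) (ContinuousLinearMap.id ℝ (Euc m)) ξ v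
  have h2 := cofForm_self (ContinuousLinearMap.id ℝ (Euc m)) ξ (B v)
  have h3 : (ContinuousLinearMap.id ℝ (Euc m)).det = 1 := LinearMap.det_id
  simp only [ContinuousLinearMap.comp_id] at h1 h2
  rw [h1, h2, h3]
  ring

theorem covRow_proj (k : Fin m) :
    covRow (EuclideanSpace.proj (𝕜 := ℝ) k : Euc m →L[ℝ] ℝ) = Pi.single k 1 := by
  funext l
  simp [covRow, bv_apply, Pi.single_apply, eq_comm]

/-- Up to a locally constant sign, vector densities transform by the cofactor matrix. -/
theorem fieldIn_pushField_eventuallyEq {e e' : OpenPartialHomeomorph N (Euc m)}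
    (he : e ∈ atlas (Euc m) N) (he' : e' ∈ atlas (Euc m) N) {w : Euc m}
    (hw : w ∈ chartDomain id e' e) : ∃ c : ℝ,
      c * (fderiv ℝ (inCharts id e' e) w).det = |(fderiv ℝ (inCharts id e' e) w).det| ∧
      ∀ (X : Fin m → Euc m → ℝ) k, fieldIn e' (pushField e (fieldOf X)) k =ᶠ[𝓝 w] fun w' =>
        c * ∑ i, X i (inCharts id e' e w') *
          rowDet m (Function.update (jacRows (inCharts id e' e) w') i (Pi.single k 1)) := by
  have hU := isOpen_chartDomain (f := (id : N → N)) continuous_id e' e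
  have hcont : ContinuousAt (fun w => (fderiv ℝ (inCharts id e' e) w).det) w :=
    (ContinuousLinearMap.continuous_det.comp_continuousOn
      ((contDiffOn_inCharts contMDiff_id he' he).continuousOn_fderiv_of_isOpen hU
        (by simp))).continuousAt (hU.mem_nhds hw)
  have hne := det_transition_ne_zero he he' hw
  obtain ⟨c, hc⟩ : ∃ c : ℝ, ∀ᶠ w' in 𝓝 w, c * (fderiv ℝ (inCharts id e' e) w').det =
      |(fderiv ℝ (inCharts id e' e) w').det| := by
    rcases hne.lt_or_gt with h | h
    · exact ⟨-1, (hcont.eventually (gt_mem_nhds h)).mono fun w' h' => by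
        rw [abs_of_neg h', neg_one_mul]⟩
    · exact ⟨1, (hcont.eventually (lt_mem_nhds h)).mono fun w' h' => by
        rw [abs_of_pos h', one_mul]⟩
  refine ⟨c, hc.self_of_nhds, fun X k => ?_⟩
  filter_upwards [hc, hU.mem_nhds hw] with w' hc' hw'
  have h1 := cofForm_eq_det_mul (fderiv_transition_comp he he' hw')
    (EuclideanSpace.proj (𝕜 := ℝ) k) (fieldOf X (inCharts id e' e w'))
  rw [cofForm, covRow_proj] at h1
  rw [fieldIn_pushField he he' _ _ hw', ← hc', mul_assoc]
  congr 1
  exact h1.symm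

theorem contDiffOn_fieldIn_pushField {e e' : OpenPartialHomeomorph N (Euc m)}
    (he : e ∈ atlas (Euc m) N) (he' : e' ∈ atlas (Euc m) N) {X : Fin m → Euc m → ℝ}
    (hX : ∀ i, ContDiff ℝ ∞ (X i)) (k : Fin m) :
    ContDiffOn ℝ ∞ (fieldIn e' (pushField e (fieldOf X)) k) (chartDomain id e' e) := by
  intro w hw
  have hU := isOpen_chartDomain (f := (id : N → N)) continuous_id e' e
  have hs := contDiffOn_inCharts (contMDiff_id (M := N)) he' he
  obtain ⟨c, -, hc⟩ := fieldIn_pushField_eventuallyEq he he' hw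
  refine (ContDiffAt.congr_of_eventuallyEq ?_ (hc X k)).contDiffWithinAt
  refine contDiffAt_const.mul (ContDiffAt.sum fun i _ => ?_)
  refine ((hX i).contDiffAt.comp w (hs.contDiffAt (hU.mem_nhds hw))).mul ?_
  refine (rowDet m).contDiff.contDiffAt.comp w ?_
  have hj := (contDiffOn_jacRows hU hs).contDiffAt (hU.mem_nhds hw)
  refine contDiffAt_pi.2 fun p => ?_
  by_cases hp : p = i
  · subst hp; simpa using contDiffAt_const
  · simpa [Function.update_of_ne hp] using contDiffAt_pi.1 hj p

/-- Piola's identity: the divergence is compatible with changes of charts. -/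
theorem divg_fieldIn_pushField {e e' : OpenPartialHomeomorph N (Euc m)}
    (he : e ∈ atlas (Euc m) N) (he' : e' ∈ atlas (Euc m) N) {X : Fin m → Euc m → ℝ}
    (hX : ∀ i, ContDiff ℝ ∞ (X i)) {w : Euc m} (hw : w ∈ chartDomain id e' e) :
    divg (fieldIn e' (pushField e (fieldOf X))) w = dens0 e' (pushDens e (divg X)) w := by
  have hU := isOpen_chartDomain (f := (id : N → N)) continuous_id e' e
  have hs := contDiffOn_inCharts (contMDiff_id (M := N)) he' he
  set s := inCharts (id : N → N) e' e
  have hsw : ContDiffAt ℝ ∞ s w := hs.contDiffAt (hU.mem_nhds hw)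
  obtain ⟨c, hc1, hc⟩ := fieldIn_pushField_eventuallyEq he he' hw
  have hXs : ∀ i, DifferentiableAt ℝ (fun y => X i (s y)) w := fun i =>
    ((hX i).contDiffAt.comp w hsw).differentiableAt (by simp)
  have hrow : ∀ i k, DifferentiableAt ℝ (fun y => rowDet m
      (Function.update (jacRows s y) i (Pi.single k 1))) w := by
    intro i k
    refine ((rowDet m).contDiff (n := ∞)).contDiffAt.comp w ?_ |>.differentiableAt (by simp)
    have hj := (contDiffOn_jacRows hU hs).contDiffAt (hU.mem_nhds hw)
    refine contDiffAt_pi.2 fun p => ?_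
    by_cases hp : p = i
    · subst hp; simpa using contDiffAt_const
    · simpa [Function.update_of_ne hp] using contDiffAt_pi.1 hj p
  have h1 : divg (fieldIn e' (pushField e (fieldOf X))) w =
      c * ∑ i, rowDet m (Function.update (jacRows s w) i (gradRow (fun y => X i (s y)) w)) := by
    simp_rw [← sum_fderiv_mul_cofactor hsw (hXs _)]
    rw [Finset.sum_comm, Finset.mul_sum]
    refine Finset.sum_congr rfl fun k _ => ?_
    have hmul : ∀ i, DifferentiableAt ℝ (fun y => X i (s y) * rowDet m
        (Function.update (jacRows s y) i (Pi.single k 1))) w := fun i => (hXs i).fun_mul (hrow i k)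
    rw [(hc X k).fderiv_eq]
    change fderiv ℝ (fun w' => c * ∑ i, X i (s w') * rowDet m
      (Function.update (jacRows s w') i (Pi.single k 1))) w (bv k) = _
    rw [fderiv_const_mul (DifferentiableAt.fun_sum fun i _ => hmul i),
      fderiv_fun_sum fun i _ => hmul i]
    simp
  have h2 : ∀ i, rowDet m (Function.update (jacRows s w) i (gradRow (fun y => X i (s y)) w)) =
      fderiv ℝ (X i) (s w) (bv i) * (fderiv ℝ s w).det := by
    intro i
    have hg : gradRow (fun y => X i (s y)) w = ∑ p, fderiv ℝ (X i) (s w) (bv p) •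
        jacRows s w p := by
      rw [jacRows_eq_linRows, ← covRow_comp_eq_sum]
      have h3 := fderiv_comp w ((hX i).differentiable (by simp) (s w)) (hsw.differentiableAt (by simp))
      rw [← h3]
      rfl
    have hlin : rowDet m (Function.update (jacRows s w) i (∑ p, fderiv ℝ (X i) (s w) (bv p) •
        jacRows s w p)) = ∑ p, fderiv ℝ (X i) (s w) (bv p) *
          rowDet m (Function.update (jacRows s w) i (jacRows s w p)) := by
      change (rowDet m).toContinuousLinearMap (jacRows s w) i _ = _
      rw [map_sum]
      refine Finset.sum_congr rfl fun p _ => ?_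
      rw [map_smul, smul_eq_mul]
      rfl
    rw [hg, hlin, Finset.sum_eq_single i, Function.update_eq_self, rowDet_jacRows]
    · intro p _ hp
      rw [rowDet_eq_zero (i := i) (j := p) hp.symm (by simp [Function.update_of_ne hp]), mul_zero]
    · simp
  rw [h1, dens0_pushDens he he' _ hw, Finset.sum_congr rfl fun i _ => h2 i, ← Finset.sum_mul,
    ← hc1]
  change c * (divg X (s w) * _) = _
  ring

/-- Test functions and fields over a subset of the common domain of two charts. -/
theorem isTest_of_transition [T2Space N] {e e' : OpenPartialHomeomorph N (Euc m)}
    (he : e ∈ atlas (Euc m) N) (he' : e' ∈ atlas (Euc m) N) {O : Set (Euc m)}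
    (hO : O ⊆ chartDomain id e e') {K : Set (Euc m)} (hK : IsCompact K) (hKO : K ⊆ O)
    {b : Euc m → ℝ} (hb : ContDiffOn ℝ ∞ b (chartDomain id e' e))
    (h0 : ∀ w, (w ∈ chartDomain id e' e → inCharts id e' e w ∉ K) → b w = 0) :
    IsTest b (inCharts id e e' '' O) := by
  have hU := isOpen_chartDomain (f := (id : N → N)) continuous_id e' e
  have hK' : IsCompact (inCharts id e e' '' K) := hK.image_of_continuousOn
    (((contDiffOn_inCharts (contMDiff_id (M := N)) he he').continuousOn).mono (hKO.trans hO))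
  have hz : ∀ w ∉ inCharts id e e' '' K, b w = 0 := fun w hw =>
    h0 w fun hw' h => hw ⟨_, h, transition_left_inv hw'⟩
  have hsub : tsupport b ⊆ inCharts id e e' '' K :=
    closure_minimal (fun z h => by by_contra h'; exact h (hz z h')) hK'.isClosed
  refine ⟨contDiff_iff_contDiffAt.2 fun w => ?_, HasCompactSupport.intro hK' hz,
    hsub.trans (image_mono hKO)⟩
  by_cases hw : w ∈ chartDomain id e' e
  · exact hb.contDiffAt (hU.mem_nhds hw)
  · refine (contDiffAt_const (c := (0 : ℝ))).congr_of_eventuallyEq ?_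
    have hwK : w ∉ inCharts id e e' '' K := by
      rintro ⟨z, hz, rfl⟩
      exact hw (transition_mem (hO (hKO hz)))
    filter_upwards [hK'.isClosed.isOpen_compl.mem_nhds hwK] with w' hw'
    exact hz w' hw'

theorem isTest_fieldIn_pushField [T2Space N] {e e' : OpenPartialHomeomorph N (Euc m)}
    (he : e ∈ atlas (Euc m) N) (he' : e' ∈ atlas (Euc m) N) {O : Set (Euc m)}
    (hO : O ⊆ chartDomain id e e') {X : Fin m → Euc m → ℝ} (hX : ∀ i, IsTest (X i) O) (k : Fin m) :
    IsTest (fieldIn e' (pushField e (fieldOf X)) k) (inCharts id e e' '' O) := by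
  refine isTest_of_transition he he' hO (isCompact_iUnion fun i => (hX i).2.isCompact)
    (iUnion_subset fun i => (hX i).3) (contDiffOn_fieldIn_pushField he he' (fun i => (hX i).1) k)
    fun w hw => ?_
  by_cases h : w ∈ chartDomain id e' e
  · have h1 : fieldOf X (inCharts id e' e w) = 0 := by
      ext i
      exact (image_eq_zero_of_notMem_tsupport fun h' => hw h (mem_iUnion.2 ⟨i, h'⟩) : X i _ = 0)
    rw [fieldIn_pushField he he' _ _ h, h1, map_zero]
    simp
  · exact fieldIn_pushField_of_notMem _ _ h

theorem isTest_dens0_pushDens [T2Space N] {e e' : OpenPartialHomeomorph N (Euc m)}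
    (he : e ∈ atlas (Euc m) N) (he' : e' ∈ atlas (Euc m) N) {O : Set (Euc m)}
    (hO : O ⊆ chartDomain id e e') {g : Euc m → ℝ} (hg : IsTest g O) :
    IsTest (dens0 e' (pushDens e g)) (inCharts id e e' '' O) := by
  have hU := isOpen_chartDomain (f := (id : N → N)) continuous_id e' e
  have hs := contDiffOn_inCharts (contMDiff_id (M := N)) he' he
  refine isTest_of_transition he he' hO hg.2.isCompact hg.3 (fun w hw => ?_) fun w hw => ?_
  · have hdet : ContDiffAt ℝ ∞ (fun w => (fderiv ℝ (inCharts id e' e) w).det) w := by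
      have : (fun w => (fderiv ℝ (inCharts (id : N → N) e' e) w).det) = fun w =>
        rowDet m (jacRows (inCharts id e' e) w) := funext fun w => (rowDet_jacRows _ w).symm
      rw [this]
      exact (rowDet m).contDiff.contDiffAt.comp w
        ((contDiffOn_jacRows hU hs).contDiffAt (hU.mem_nhds hw))
    have h1 : ContDiffAt ℝ ∞ (fun w => |(fderiv ℝ (inCharts id e' e) w).det| *
        g (inCharts id e' e w)) w :=
      (hdet.abs (det_transition_ne_zero he he' hw)).mul
        (hg.1.contDiffAt.comp w (hs.contDiffAt (hU.mem_nhds hw)))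
    refine (h1.congr_of_eventuallyEq ?_).contDiffWithinAt
    filter_upwards [hU.mem_nhds hw] with w' hw' using dens0_pushDens he he' g hw'
  · by_cases h : w ∈ chartDomain id e' e
    · rw [dens0_pushDens he he' g h, image_eq_zero_of_notMem_tsupport (hw h), mul_zero]
    · exact dens0_pushDens_of_notMem g h

/-- The pull-back of a one-form with components `θ` under a change of charts. -/
def pullTransition (e e' : OpenPartialHomeomorph N (Euc m)) (θ : Fin m → Euc m → ℝ) (j : Fin m)
    (z : Euc m) : ℝ := ∑ k, θ k (inCharts id e e' z) * fderiv ℝ (inCharts id e e') z (bv j) k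

theorem contDiffOn_pullTransition {e e' : OpenPartialHomeomorph N (Euc m)}
    (he : e ∈ atlas (Euc m) N) (he' : e' ∈ atlas (Euc m) N) {θ : Fin m → Euc m → ℝ}
    {O V : Set (Euc m)} (hO : IsOpen O) (hOW : O ⊆ chartDomain id e e')
    (hV : MapsTo (inCharts id e e') O V) (hθ : ∀ k, ContDiffOn ℝ ∞ (θ k) V) (j : Fin m) :
    ContDiffOn ℝ ∞ (pullTransition e e' θ j) O := by
  have hs := (contDiffOn_inCharts (contMDiff_id (M := N)) he he').mono hOW
  refine ContDiffOn.sum fun k _ => ((hθ k).comp hs hV).mul ?_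
  exact (EuclideanSpace.proj (𝕜 := ℝ) k).contDiff.comp_contDiffOn
    ((hs.fderiv_of_isOpen hO (m := ∞) (by simp)).clm_apply contDiffOn_const)

omit [ChartedSpace (Euc m) N] [IsManifold 𝓘(ℝ, Euc m) ∞ N] in
theorem sum_pullTransition_mul (e e' : OpenPartialHomeomorph N (Euc m)) (θ : Fin m → Euc m → ℝ)
    (X : Fin m → Euc m → ℝ) (z : Euc m) : ∑ j, pullTransition e e' θ j z * X j z =
      ∑ k, θ k (inCharts id e e' z) * fderiv ℝ (inCharts id e e') z (fieldOf X z) k := by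
  simp only [pullTransition, Finset.sum_mul]
  rw [Finset.sum_comm]
  refine Finset.sum_congr rfl fun k _ => ?_
  conv_rhs => rw [← sum_smul_bv (fieldOf X z), map_sum]
  simp only [map_smul, WithLp.ofLp_sum, Finset.sum_apply, PiLp.smul_apply, smul_eq_mul,
    fieldOf_apply, Finset.mul_sum]
  exact Finset.sum_congr rfl fun j _ => by ring

/-- The pairing of one-forms with vector densities is compatible with changes of charts. -/
theorem sum_integral_transition [T2Space N] {e e' : OpenPartialHomeomorph N (Euc m)}
    (he : e ∈ atlas (Euc m) N) (he' : e' ∈ atlas (Euc m) N) {θ : Fin m → Euc m → ℝ}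
    {O V : Set (Euc m)} (hO : IsOpen O) (hOW : O ⊆ chartDomain id e e') (hVo : IsOpen V)
    (hV : MapsTo (inCharts id e e') O V) (hθ : ∀ k, ContDiffOn ℝ ∞ (θ k) V)
    {X : Fin m → Euc m → ℝ} (hX : ∀ i, IsTest (X i) O) :
    ∑ k, ∫ w, θ k w * fieldIn e' (pushField e (fieldOf X)) k w =
      ∑ j, ∫ z, pullTransition e e' θ j z * X j z := by
  have hi1 : ∀ k, Integrable fun w => θ k w * fieldIn e' (pushField e (fieldOf X)) k w := by
    intro k
    have h1 := (isTest_fieldIn_pushField he he' hOW hX k).mono hV.image_subset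
    simpa [mul_comm] using (h1.mul_left hVo (hθ k)).integrable volume
  have hi2 : ∀ j, Integrable fun z => pullTransition e e' θ j z * X j z := by
    intro j
    simpa [mul_comm] using ((hX j).mul_left hO
      (contDiffOn_pullTransition he he' hO hOW hV hθ j)).integrable volume
  rw [← integral_finsetSum _ fun k _ => hi1 k, ← integral_finsetSum _ fun j _ => hi2 j]
  simp only [sum_pullTransition_mul]
  have hX0 : ∀ z ∉ O, fieldOf X z = 0 := fun z hz => by
    ext i; exact (hX i).eq_zero hz
  have hL : ∫ w in chartDomain id e' e, (∑ k, θ k w * fieldIn e' (pushField e (fieldOf X)) k w) =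
      ∫ w, (∑ k, θ k w * fieldIn e' (pushField e (fieldOf X)) k w) :=
    setIntegral_eq_integral_of_forall_compl_eq_zero fun w hw =>
      Finset.sum_eq_zero fun k _ => by rw [fieldIn_pushField_of_notMem _ _ hw, mul_zero]
  have hR : ∫ z in chartDomain id e e', (∑ k, θ k (inCharts id e e' z) *
      fderiv ℝ (inCharts id e e') z (fieldOf X z) k) =
      ∫ z, (∑ k, θ k (inCharts id e e' z) *
        fderiv ℝ (inCharts id e e') z (fieldOf X z) k) :=
    setIntegral_eq_integral_of_forall_compl_eq_zero fun z hz => by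
      rw [hX0 z fun h => hz (hOW h), map_zero]
      simp
  rw [← hL, ← hR, integral_transition he' he]
  refine setIntegral_congr_fun (isOpen_chartDomain continuous_id e' e).measurableSet
    fun w hw => ?_
  simp only [transition_left_inv hw, Finset.mul_sum]
  refine Finset.sum_congr rfl fun k _ => ?_
  rw [fieldIn_pushField he he' _ _ hw]
  ring

end ChartChange

/-! ### Gluing local primitives of a weakly exact form -/

section Gluing

open MeasureTheory Filter Topology Set

variable {m : ℕ}

theorem FinSigned.exists_weighted_comp (σ : FinSigned m) {b : Euc m → ℝ} (hb : IsCc b)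
    {a : Euc m → Euc m} (ha : Measurable a) :
    ∃ κ : FinSigned m, ∀ g, IsCc g → κ.int g = σ.int fun w => b w * g (a w) := by
  obtain ⟨κ₁, h₁⟩ := FinSigned.exists_map σ.pos (hb.integrable _) ha.aemeasurable
  obtain ⟨κ₂, h₂⟩ := FinSigned.exists_map σ.neg (hb.integrable _) ha.aemeasurable
  obtain ⟨κ₃, h₃⟩ := κ₂.exists_neg
  obtain ⟨κ, h⟩ := FinSigned.exists_add κ₁ κ₃
  refine ⟨κ, fun g hg => ?_⟩
  have e₁ := h₁ g hg
  have e₂ := h₂ g hg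
  have e₃ := h₃ g hg
  have e := h g hg
  simp only at e₁ e₂ e₃ e
  rw [← e, ← e₁, ← e₃, ← e₂, ← sub_eq_add_neg]
  rfl

variable {N : Type*} [TopologicalSpace N] [ChartedSpace (Euc m) N] [IsManifold 𝓘(ℝ, Euc m) ∞ N]
  [T2Space N]

/-- The global form of Piola's identity. -/
theorem divg_fieldIn_pushField_eq {e e' : OpenPartialHomeomorph N (Euc m)}
    (he : e ∈ atlas (Euc m) N) (he' : e' ∈ atlas (Euc m) N) {O : Set (Euc m)}
    (hO : O ⊆ chartDomain id e e') {X : Fin m → Euc m → ℝ} (hX : ∀ i, IsTest (X i) O) :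
    divg (fieldIn e' (pushField e (fieldOf X))) = dens0 e' (pushDens e (divg X)) := by
  funext w
  by_cases hw : w ∈ chartDomain id e' e
  · exact divg_fieldIn_pushField he he' (fun i => (hX i).1) hw
  · rw [dens0_pushDens_of_notMem _ hw]
    refine (isTest_divg fun k => isTest_fieldIn_pushField he he' hO hX k).eq_zero ?_
    rintro ⟨z, hz, rfl⟩
    exact hw (transition_mem (hO hz))

/-- Two regularizations of the same current differ by a smooth density. -/
theorem exists_density_transition {e e' : OpenPartialHomeomorph N (Euc m)}
    (he : e ∈ atlas (Euc m) N) (he' : e' ∈ atlas (Euc m) N) {O : Set (Euc m)} (hO : IsOpen O)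
    (hOW : O ⊆ chartDomain id e e') {z₀ : Euc m} (hz₀ : z₀ ∈ O) {σ σ' : FinSigned m}
    {θ θ' : Fin m → Euc m → ℝ} (hθ : ∀ j, ContDiff ℝ ∞ (θ j)) (hθ' : ∀ j, ContDiff ℝ ∞ (θ' j))
    (h : ∀ X : Fin m → Euc m → ℝ, (∀ i, IsTest (X i) O) →
      (∑ j, ∫ z, θ j z * X j z) - σ.int (divg X) =
        (∑ j, ∫ w, θ' j w * fieldIn e' (pushField e (fieldOf X)) j w) -
          σ'.int (dens0 e' (pushDens e (divg X)))) :
    ∃ ρ > 0, Metric.ball z₀ ρ ⊆ O ∧ ∃ u : Euc m → ℝ, ContDiff ℝ ∞ u ∧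
      ∀ g, IsTest g (Metric.ball z₀ ρ) →
        σ'.int (dens0 e' (pushDens e g)) = σ.int g + ∫ z, u z * g z := by
  obtain ⟨R, hR, hRO⟩ := Metric.isOpen_iff.1 hO z₀ hz₀
  have h3 : Metric.ball z₀ (3 * (R / 4)) ⊆ O :=
    (Metric.ball_subset_ball (by linarith)).trans hRO
  -- The push-forward of `σ'` under the change of charts, cut off near `z₀`.
  let bump : ContDiffBump z₀ := ⟨3 * (R / 4), 7 * (R / 8), by positivity, by linarith⟩
  have hbump : IsTest bump O := ⟨bump.contDiff, bump.hasCompactSupport, by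
    rw [bump.tsupport_eq]
    exact (Metric.closedBall_subset_ball (by change 7 * (R / 8) < R; linarith)).trans hRO⟩
  have hU := isOpen_chartDomain (f := (id : N → N)) continuous_id e' e
  classical
  let a : Euc m → Euc m := (chartDomain id e' e).piecewise (inCharts id e' e) fun _ => z₀
  have ha : Measurable a := by
    refine ContinuousOn.measurable_piecewise
      (contDiffOn_inCharts (contMDiff_id (M := N)) he' he).continuousOn continuousOn_const
      hU.measurableSet
  obtain ⟨κ₁, hκ₁⟩ := σ'.exists_weighted_comp (isTest_dens0_pushDens he he' hOW hbump).isCc ha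
  obtain ⟨κ₂, hκ₂⟩ := σ.exists_neg
  obtain ⟨κ, hκ⟩ := FinSigned.exists_add κ₁ κ₂
  have key : ∀ g, IsTest g (Metric.ball z₀ (3 * (R / 4))) →
      κ.int g = σ'.int (dens0 e' (pushDens e g)) - σ.int g := by
    intro g hg
    have h₁ := hκ g hg.isCc
    have h₂ := hκ₂ g hg.isCc
    simp only at h₁ h₂
    rw [← h₁, hκ₁ g hg.isCc, ← h₂, ← sub_eq_add_neg]
    congr 2
    funext w
    by_cases hw : w ∈ chartDomain id e' e
    · rw [dens0_pushDens he he' _ hw, dens0_pushDens he he' _ hw]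
      simp only [a, Set.piecewise_eq_of_mem _ _ _ hw]
      by_cases hz : inCharts id e' e w ∈ Metric.ball z₀ (3 * (R / 4))
      · rw [bump.one_of_mem_closedBall (Metric.ball_subset_closedBall hz), mul_one]
      · rw [hg.eq_zero hz, mul_zero, mul_zero]
    · rw [dens0_pushDens_of_notMem _ hw, dens0_pushDens_of_notMem _ hw, zero_mul]
  have hpt : ∀ j, ContDiffOn ℝ ∞ (pullTransition e e' θ' j) O := fun j =>
    contDiffOn_pullTransition he he' hO hOW (mapsTo_univ _ _) (fun k => (hθ' k).contDiffOn) j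
  obtain ⟨u, hu, hu'⟩ := exists_density (κ := κ) (w₀ := z₀) (r := R / 4) (by positivity)
    (θ := fun j z => pullTransition e e' θ' j z - θ j z)
    (fun j => ((hpt j).mono h3).sub (hθ j).contDiffOn) fun X hX => by
      have hXO : ∀ i, IsTest (X i) O := fun i => (hX i).mono h3
      rw [key _ (isTest_divg hX)]
      have h1 := h X hXO
      rw [sum_integral_transition he he' hO hOW isOpen_univ (mapsTo_univ _ _)
        (fun k => (hθ' k).contDiffOn) hXO] at h1
      have h2 : ∀ j, (∫ z, (pullTransition e e' θ' j z - θ j z) * X j z) =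
          (∫ z, pullTransition e e' θ' j z * X j z) - ∫ z, θ j z * X j z := by
        intro j
        simp only [sub_mul]
        refine integral_sub ?_ ?_
        · simpa [mul_comm] using ((hXO j).mul_left hO (hpt j)).integrable volume
        · simpa [mul_comm] using ((hXO j).mul_left hO (hθ j).contDiffOn).integrable volume
      simp only [h2, Finset.sum_sub_distrib]
      linarith
  refine ⟨R / 4, by positivity, (Metric.ball_subset_ball (by linarith)).trans hRO, u, hu,
    fun g hg => ?_⟩
  rw [← hu' g hg, key g (hg.mono (Metric.ball_subset_ball (by linarith)))]
  ring

end Gluing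

section GluingLocal

open MeasureTheory Filter Topology Set

variable {m : ℕ}
variable {N : Type*} [TopologicalSpace N] [ChartedSpace (Euc m) N]

theorem mul_pushDens (χ : N → ℝ) (e : OpenPartialHomeomorph N (Euc m)) (g : Euc m → ℝ) :
    (fun x => χ x * pushDens e g x) = pushDens e fun z => g z * χ (e.symm z) := by
  funext x
  by_cases hx : x ∈ e.source
  · rw [pushDens_of_mem hx, pushDens_of_mem hx, e.left_inv hx]
    ring
  · rw [pushDens_eq_zero fun h => absurd h hx, pushDens_eq_zero fun h => absurd h hx, mul_zero]

variable [IsManifold 𝓘(ℝ, Euc m) ∞ N] [T2Space N]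

/-- On the subset `V` of the chart `e`, the current `𝒯` is the smooth form `∑ θⱼ dyⱼ` up to the
exterior derivative of the signed measure `σ`. -/
def IsRegularized (𝒯 : (N → Euc m) → ℝ) (e : OpenPartialHomeomorph N (Euc m)) (V : Set (Euc m))
    (θ : Fin m → Euc m → ℝ) (σ : FinSigned m) : Prop :=
  (∀ j, ContDiff ℝ ∞ (θ j)) ∧ ∀ X : Fin m → Euc m → ℝ, (∀ i, IsTest (X i) V) →
    𝒯 (pushField e (fieldOf X)) = (∑ j, ∫ z, θ j z * X j z) - σ.int (divg X)

/-- Near each point, the measure of a second regularization, cut off by `χ`, is the measure of the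
first one times `χ` up to a smooth density. -/
theorem exists_density_mul_transition {𝒯 : (N → Euc m) → ℝ}
    {e e' : OpenPartialHomeomorph N (Euc m)}
    (he : e ∈ atlas (Euc m) N) (he' : e' ∈ atlas (Euc m) N) {V V' : Set (Euc m)} (hV : IsOpen V)
    (hVt : V ⊆ e.target) (hV' : IsOpen V') {σ σ' : FinSigned m} {θ θ' : Fin m → Euc m → ℝ}
    (h : IsRegularized 𝒯 e V θ σ) (h' : IsRegularized 𝒯 e' V' θ' σ') {χ : N → ℝ}
    (hχ : ContMDiff 𝓘(ℝ, Euc m) 𝓘(ℝ, ℝ) ∞ χ) (hχs : tsupport χ ⊆ e'.source ∩ e' ⁻¹' V')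
    {z₀ : Euc m} (hz₀ : z₀ ∈ V) :
    ∃ ρ > 0, Metric.ball z₀ ρ ⊆ V ∧ ∃ u : Euc m → ℝ, ContDiffOn ℝ ∞ u (Metric.ball z₀ ρ) ∧
      ∀ g, IsTest g (Metric.ball z₀ ρ) →
        σ'.int (dens0 e' fun x => χ x * pushDens e g x) =
          σ.int (fun z => g z * χ (e.symm z)) + ∫ z, u z * g z := by
  by_cases hy : e.symm z₀ ∈ tsupport χ
  · have hU := isOpen_chartDomain (f := (id : N → N)) continuous_id e e'
    have hs := contDiffOn_inCharts (contMDiff_id (M := N)) he he'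
    set O : Set (Euc m) := V ∩ (chartDomain id e e' ∩ inCharts id e e' ⁻¹' V') with hOdef
    have hO : IsOpen O := hV.inter (hs.continuousOn.isOpen_inter_preimage hU hV')
    have hOW : O ⊆ chartDomain id e e' := fun z hz => hz.2.1
    have hOV : O ⊆ V := inter_subset_left
    have hmap : inCharts id e e' '' O ⊆ V' := by
      rintro _ ⟨z, hz, rfl⟩
      exact hz.2.2
    obtain ⟨ρ, hρ, hρO, u, hu, hu'⟩ := exists_density_transition he he' hO hOW
      (z₀ := z₀) ⟨hz₀, ⟨hVt hz₀, (hχs hy).1⟩, (hχs hy).2⟩ (σ := σ) (σ' := σ') h.1 h'.1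
      fun X hX => by
        have h1 := h.2 X fun i => (hX i).mono hOV
        have h2 := h'.2 (fieldIn e' (pushField e (fieldOf X))) fun i =>
          (isTest_fieldIn_pushField he he' hOW hX i).mono hmap
        rw [divg_fieldIn_pushField_eq he he' hOW hX, pushField_fieldIn he'] at h2
        · rw [← h1, ← h2]
        · intro y hy
          refine pushField_eq_zero fun hye => ?_
          ext i
          refine (hX i).eq_zero fun hyO => hy ?_
          have h3 := (hOW hyO).2
          simpa [e.left_inv hye] using h3
    have hball : Metric.ball z₀ ρ ⊆ e.target := (hρO.trans hOV).trans hVt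
    have hχe := (contDiffOn_comp_symm hχ he).mono hball
    refine ⟨ρ, hρ, hρO.trans hOV, fun z => u z * χ (e.symm z), hu.contDiffOn.mul hχe,
      fun g hg => ?_⟩
    rw [mul_pushDens, hu' _ (hg.mul_left Metric.isOpen_ball hχe)]
    congr 2
    funext z
    ring
  -- Away from the support of `χ` both measures vanish.
  · have hO : IsOpen (V ∩ (e.target ∩ e.symm ⁻¹' (tsupport χ)ᶜ)) :=
      hV.inter (e.symm.isOpen_inter_preimage (isClosed_tsupport χ).isOpen_compl)
    obtain ⟨ρ, hρ, hρO⟩ := Metric.isOpen_iff.1 hO z₀ ⟨hz₀, hVt hz₀, hy⟩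
    refine ⟨ρ, hρ, hρO.trans inter_subset_left, fun _ => 0, contDiffOn_const, fun g hg => ?_⟩
    have hz : ∀ z, g z * χ (e.symm z) = 0 := by
      intro z
      by_cases hzb : z ∈ Metric.ball z₀ ρ
      · rw [image_eq_zero_of_notMem_tsupport (hρO hzb).2.2, mul_zero]
      · rw [hg.eq_zero hzb, zero_mul]
    rw [mul_pushDens, σ.int_congr_zero hz, σ'.int_congr_zero]
    · simp
    · intro w
      rw [dens0]
      split_ifs
      · rw [dens, pushDens_eq_zero fun _ => hz _, zero_mul]
      · rfl

variable {r : N → ℝ} {θ : N → Fin m → Euc m → ℝ} {σ : N → FinSigned m}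

/-- Subtracting the exterior derivative of the glued measure `∑ χ_q σ_q` turns the current into a
smooth form near each point `y`: by the comparison of regularizations the glued measure is `σ_y` up
to a smooth density `w`. -/
theorem exists_local_smooth {𝒯 : (N → Euc m) → ℝ} (hr : ∀ q, 0 < r q)
    (hrt : ∀ q, Metric.ball (chartAt (Euc m) q q) (r q) ⊆ (chartAt (Euc m) q).target)
    (h : ∀ q, IsRegularized 𝒯 (chartAt (Euc m) q) (Metric.ball (chartAt (Euc m) q q) (r q))
      (θ q) (σ q)) {s : Finset N} {χ : N → N → ℝ}
    (hχ : ∀ q, ContMDiff 𝓘(ℝ, Euc m) 𝓘(ℝ, ℝ) ∞ (χ q))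
    (hχs : ∀ q, tsupport (χ q) ⊆ (chartAt (Euc m) q).source ∩
      chartAt (Euc m) q ⁻¹' Metric.ball (chartAt (Euc m) q q) (r q))
    (hsum : ∀ x, ∑ q ∈ s, χ q x = 1) (y : N) :
    ∃ ρ > 0, Metric.ball (chartAt (Euc m) y y) ρ ⊆ (chartAt (Euc m) y).target ∧
      ∃ η : Fin m → Euc m → ℝ,
        (∀ j, ContDiffOn ℝ ∞ (η j) (Metric.ball (chartAt (Euc m) y y) ρ)) ∧
        ∀ X : Fin m → Euc m → ℝ, (∀ i, IsTest (X i) (Metric.ball (chartAt (Euc m) y y) ρ)) →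
          𝒯 (pushField (chartAt (Euc m) y) (fieldOf X)) + ∑ q ∈ s, (σ q).int
            (dens0 (chartAt (Euc m) q) fun x => χ q x * pushDens (chartAt (Euc m) y) (divg X) x) =
          ∑ j, ∫ z, η j z * X j z := by
  set e := chartAt (Euc m) y with hedef
  have he : e ∈ atlas (Euc m) N := chart_mem_atlas _ y
  choose ρ hρ hρV u hu hu' using fun q => exists_density_mul_transition he
    (chart_mem_atlas (Euc m) q) Metric.isOpen_ball (hrt y) Metric.isOpen_ball (h y) (h q) (hχ q)
    (hχs q) (Metric.mem_ball_self (hr y))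
  obtain ⟨δ, hδ, hδρ⟩ : ∃ δ > 0, ∀ q ∈ s, δ ≤ ρ q := by
    rcases s.eq_empty_or_nonempty with rfl | hs
    · exact ⟨1, one_pos, by simp⟩
    · exact ⟨s.inf' hs ρ, (Finset.lt_inf'_iff hs).2 fun q _ => hρ q, fun q hq =>
        Finset.inf'_le _ hq⟩
  set ε := min δ (r y)
  have hε : 0 < ε := lt_min hδ (hr y)
  have hεV : Metric.ball (e y) ε ⊆ Metric.ball (e y) (r y) :=
    Metric.ball_subset_ball (min_le_right _ _)
  have hερ : ∀ q ∈ s, Metric.ball (e y) ε ⊆ Metric.ball (e y) (ρ q) := fun q hq =>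
    Metric.ball_subset_ball ((min_le_left _ _).trans (hδρ q hq))
  have hεt := hεV.trans (hrt y)
  -- The local form is `θ_y - dw`.
  set w : Euc m → ℝ := fun z => ∑ q ∈ s, u q z
  have hw : ContDiffOn ℝ ∞ w (Metric.ball (e y) ε) :=
    ContDiffOn.sum fun q hq => (hu q).mono (hερ q hq)
  have hwd : ∀ j, ContDiffOn ℝ ∞ (fun z => fderiv ℝ w z (bv j)) (Metric.ball (e y) ε) := fun j =>
    (hw.fderiv_of_isOpen Metric.isOpen_ball (m := ∞) (by simp)).clm_apply contDiffOn_const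
  have hθ := fun j => ((h y).1 j).contDiffOn (s := Metric.ball (e y) ε)
  refine ⟨ε, hε, hεt, fun j z => θ y j z - fderiv ℝ w z (bv j), fun j => (hθ j).sub (hwd j),
    fun X hX => ?_⟩
  have hint : ∀ {c g : Euc m → ℝ}, ContDiffOn ℝ ∞ c (Metric.ball (e y) ε) →
      IsTest g (Metric.ball (e y) ε) → Integrable fun z => c z * g z := fun hc hg => by
    simpa [mul_comm] using (hg.mul_left Metric.isOpen_ball hc).integrable volume
  have hd := isTest_divg hX
  have hS : ∑ q ∈ s, (σ q).int (dens0 (chartAt (Euc m) q) fun x => χ q x * pushDens e (divg X) x) =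
      (σ y).int (divg X) + ∫ z, w z * divg X z := by
    rw [Finset.sum_congr rfl fun q hq => hu' q _ (hd.mono (hερ q hq)), Finset.sum_add_distrib]
    congr 1
    · have hcc : ∀ q, IsCc fun z => divg X z * χ q (e.symm z) := fun q =>
        (hd.mul_left Metric.isOpen_ball ((contDiffOn_comp_symm (hχ q) he).mono hεt)).isCc
      rw [← (σ y).int_sum s hcc]
      congr 1
      funext z
      rw [← Finset.mul_sum, hsum, mul_one]
    · rw [← integral_finsetSum _ fun q hq => hint ((hu q).mono (hερ q hq)) hd]
      simp only [w, Finset.sum_mul]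
  have hw1 : (∫ z, w z * divg X z) = -∑ j, ∫ z, fderiv ℝ w z (bv j) * X j z := by
    simp only [divg, Finset.mul_sum]
    rw [integral_finsetSum _ fun j _ => hint hw ((hX j).fderiv (bv j)), ← Finset.sum_neg_distrib]
    exact Finset.sum_congr rfl fun j _ =>
      integral_mul_fderiv_test Metric.isOpen_ball hw (hX j) (bv j)
  have h3 : ∀ j, (∫ z, (θ y j z - fderiv ℝ w z (bv j)) * X j z) =
      (∫ z, θ y j z * X j z) - ∫ z, fderiv ℝ w z (bv j) * X j z := fun j => by
    simp only [sub_mul]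
    exact integral_sub (hint (hθ j) (hX j)) (hint (hwd j) (hX j))
  simp only [h3, Finset.sum_sub_distrib]
  rw [hS, hw1, (h y).2 X fun i => (hX i).mono hεV]
  ring

end GluingLocal

section GluingGlobal

open MeasureTheory Filter Topology Set

variable {m : ℕ}
variable {N : Type*} [TopologicalSpace N] [ChartedSpace (Euc m) N] [IsManifold 𝓘(ℝ, Euc m) ∞ N]

/-- Smoothness of a form can be checked at the centre of each preferred chart. -/
theorem mem_smoothForms_of_contDiffAt {k : ℕ} {β : RawForm (Euc m) N k}
    (h : ∀ x, ContDiffAt ℝ ∞ (β.inChart (chartAt (Euc m) x)) (chartAt (Euc m) x x)) :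
    β ∈ smoothForms (Euc m) N k := by
  intro e he z hz
  have he' := chart_mem_atlas (Euc m) (e.symm z)
  have hz' : z ∈ chartDomain (id : N → N) e (chartAt (Euc m) (e.symm z)) :=
    ⟨hz, mem_chart_source _ _⟩
  have h0 := RawForm.inChart_pullback_eventuallyEq contMDiff_id he he' β hz'
  rw [RawForm.pullback_id] at h0
  refine ContDiffAt.contDiffWithinAt (ContDiffAt.congr_of_eventuallyEq ?_ h0)
  have hopen := isOpen_chartDomain (f := (id : N → N)) continuous_id e
    (chartAt (Euc m) (e.symm z))
  have h1 : ContDiffAt ℝ ∞ (inCharts (id : N → N) e (chartAt (Euc m) (e.symm z))) z :=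
    (contDiffOn_inCharts contMDiff_id he he').contDiffAt (hopen.mem_nhds hz')
  exact (contDiff_alternating_compContinuousLinearMap k).contDiffAt.comp z
    (((h (e.symm z)).comp z h1).prodMk (h1.fderiv_right (m := ∞) (by simp)))

/-- The covector with given components, as an alternating form. -/
def covForm (c : Fin m → ℝ) : Euc m [⋀^Fin 1]→L[ℝ] ℝ :=
  ContinuousAlternatingMap.ofSubsingleton ℝ (Euc m) ℝ (0 : Fin 1)
    (∑ j, c j • EuclideanSpace.proj (𝕜 := ℝ) j)

theorem covForm_apply (c : Fin m → ℝ) (v : Fin 1 → Euc m) : covForm c v = ∑ j, c j * v 0 j := by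
  simp [covForm]

theorem contDiffOn_covForm {a : Fin m → Euc m → ℝ} {U : Set (Euc m)}
    (h : ∀ j, ContDiffOn ℝ ∞ (a j) U) : ContDiffOn ℝ ∞ (fun z => covForm fun j => a j z) U := by
  have h1 : ContDiffOn ℝ ∞ (fun z => ∑ j, a j z •
      (EuclideanSpace.proj (𝕜 := ℝ) j : Euc m →L[ℝ] ℝ)) U :=
    ContDiffOn.sum fun j _ => (h j).smul contDiffOn_const
  let L : (Euc m →L[ℝ] ℝ) ≃L[ℝ] (Euc m [⋀^Fin 1]→L[ℝ] ℝ) :=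
    (ContinuousAlternatingMap.ofSubsingletonLIE (0 : Fin 1)).toContinuousLinearEquiv
  exact L.contDiff.comp_contDiffOn h1

/-- A current that is given by a smooth form near each point is given by a smooth form. -/
theorem exists_smoothForm_of_local [T2Space N] {𝒯 : (N → Euc m) → ℝ} {S : (N → ℝ) → ℝ}
    (h : ∀ y : N, ∃ ρ > 0, Metric.ball (chartAt (Euc m) y y) ρ ⊆ (chartAt (Euc m) y).target ∧
      ∃ η : Fin m → Euc m → ℝ,
        (∀ j, ContDiffOn ℝ ∞ (η j) (Metric.ball (chartAt (Euc m) y y) ρ)) ∧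
        ∀ X : Fin m → Euc m → ℝ, (∀ i, IsTest (X i) (Metric.ball (chartAt (Euc m) y y) ρ)) →
          𝒯 (pushField (chartAt (Euc m) y) (fieldOf X)) +
            S (pushDens (chartAt (Euc m) y) (divg X)) = ∑ j, ∫ z, η j z * X j z) :
    ∃ β ∈ smoothForms (Euc m) N 1, ∀ y : N, ∃ ρ > 0,
      Metric.ball (chartAt (Euc m) y y) ρ ⊆ (chartAt (Euc m) y).target ∧
      ∀ X : Fin m → Euc m → ℝ, (∀ i, IsTest (X i) (Metric.ball (chartAt (Euc m) y y) ρ)) →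
          𝒯 (pushField (chartAt (Euc m) y) (fieldOf X)) +
            S (pushDens (chartAt (Euc m) y) (divg X)) =
          ∑ j, ∫ z, (β.inChart (chartAt (Euc m) y) z fun _ => bv j) * X j z := by
  choose ρ hρ hρt η hη hη' using h
  let β : RawForm (Euc m) N 1 := fun x => (covForm fun j => η x j (chartAt (Euc m) x x)
    ).compContinuousLinearMap (rawDeriv (E := Euc m) (F := Euc m) (chartAt (Euc m) x) x)
  have key : ∀ p, ∀ z ∈ Metric.ball (chartAt (Euc m) p p) (ρ p),
      β.inChart (chartAt (Euc m) p) z = covForm fun j => η p j z := by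
    intro p z hz
    set e := chartAt (Euc m) p with hedef
    have he : e ∈ atlas (Euc m) N := chart_mem_atlas _ p
    have hzt : z ∈ e.target := hρt p hz
    set x := e.symm z with hxdef
    set e' := chartAt (Euc m) x with hedef'
    have he' : e' ∈ atlas (Euc m) N := chart_mem_atlas _ x
    have hU := isOpen_chartDomain (f := (id : N → N)) continuous_id e e'
    have hs := contDiffOn_inCharts (contMDiff_id (M := N)) he he'
    have hzU : z ∈ chartDomain (id : N → N) e e' := ⟨hzt, mem_chart_source _ x⟩
    have hzx : inCharts (id : N → N) e e' z = e' x := rfl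
    set O : Set (Euc m) := Metric.ball (e p) (ρ p) ∩
      (chartDomain id e e' ∩ inCharts id e e' ⁻¹' Metric.ball (e' x) (ρ x)) with hOdef
    have hO : IsOpen O :=
      Metric.isOpen_ball.inter (hs.continuousOn.isOpen_inter_preimage hU Metric.isOpen_ball)
    have hOW : O ⊆ chartDomain id e e' := fun z hz => hz.2.1
    have hOp : O ⊆ Metric.ball (e p) (ρ p) := inter_subset_left
    have hmap : MapsTo (inCharts id e e') O (Metric.ball (e' x) (ρ x)) := fun z hz => hz.2.2
    have hzO : z ∈ O := by
      refine ⟨hz, hzU, ?_⟩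
      rw [mem_preimage, hzx]
      exact Metric.mem_ball_self (hρ x)
    have hpt : ∀ j, ContDiffOn ℝ ∞ (pullTransition e e' (η x) j) O := fun j =>
      contDiffOn_pullTransition he he' hO hOW hmap (hη x) j
    -- Both local forms represent the same current on the common domain.
    have heq : ∀ j, pullTransition e e' (η x) j z = η p j z := by
      intro j
      refine eqOn_of_forall_integral_test hO (hpt j).continuousOn
        ((hη p j).continuousOn.mono hOp) (fun g hg => ?_) hzO
      set X : Fin m → Euc m → ℝ := Pi.single j g with hXdef
      have hX : ∀ i, IsTest (X i) O := by
        intro i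
        by_cases hij : i = j
        · subst hij; simpa [hXdef] using hg
        · have : X i = fun _ => 0 := by simp [hXdef, hij]; rfl
          rw [this]
          exact isTest_zero O
      have hsum : ∀ a : Fin m → Euc m → ℝ, ∑ i, ∫ w, a i w * X i w = ∫ w, a j w * g w := by
        intro a
        rw [Finset.sum_eq_single j (fun i _ hij => by simp [hXdef, hij]) (by simp)]
        simp [hXdef]
      have h1 := hη' p X fun i => (hX i).mono hOp
      have h2 := hη' x (fieldIn e' (pushField e (fieldOf X))) fun i =>
        (isTest_fieldIn_pushField he he' hOW hX i).mono hmap.image_subset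
      rw [← hedef', divg_fieldIn_pushField_eq he he' hOW hX, pushField_fieldIn he',
        pushDens_dens0 he', sum_integral_transition he he' hO hOW Metric.isOpen_ball hmap (hη x) hX,
        hsum] at h2
      · rw [← hedef, hsum] at h1
        exact h2.symm.trans h1
      all_goals
        intro y hy
        have hyO : y ∈ e.source → e y ∉ O := fun hye hyO => hy (by
          have h3 := (hOW hyO).2
          simpa [e.left_inv hye] using h3)
      · exact pushDens_eq_zero fun hye => (isTest_divg hX).eq_zero (hyO hye)
      · refine pushField_eq_zero fun hye => ?_
        ext i
        exact (hX i).eq_zero (hyO hye)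
    ext v
    have hD := fderiv_transition he he' hzU
    rw [RawForm.inChart_eq]
    change covForm (fun j => η x j (e' x)) (fun i => rawDeriv (E := Euc m) (F := Euc m) e' x
      (rawDeriv (E := Euc m) (F := Euc m) e.symm z (v i))) = _
    rw [covForm_apply, covForm_apply]
    simp only [← heq]
    have h4 := sum_pullTransition_mul e e' (η x) (fun j _ => v 0 j) z
    rw [hzx, hD] at h4
    exact h4.symm
  refine ⟨β, mem_smoothForms_of_contDiffAt fun x => ?_, fun y => ⟨ρ y, hρ y, hρt y, fun X hX => ?_⟩⟩
  · have h1 := (contDiffOn_covForm (hη x)).contDiffAt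
      (Metric.isOpen_ball.mem_nhds (Metric.mem_ball_self (hρ x)))
    refine h1.congr_of_eventuallyEq ?_
    filter_upwards [Metric.isOpen_ball.mem_nhds (Metric.mem_ball_self (hρ x))] with z hz
      using key x z hz
  · rw [hη' y X hX]
    refine Finset.sum_congr rfl fun j _ => (hX j).integral_congr fun z hz => ?_
    rw [key y z hz, covForm_apply]
    simp [bv_apply]

/-- A smooth form that is a primitive of `α` in the weak sense near `y` is one at `y`: its pairing
with the fields `curlField g i j` determines the components of its exterior derivative. -/
theorem d_eq_of_integral_curlField {α : RawForm (Euc m) N 2} (hα : α ∈ smoothForms (Euc m) N 2)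
    {β : RawForm (Euc m) N 1} (hβ : β ∈ smoothForms (Euc m) N 1) {y : N} {ρ : ℝ} (hρ : 0 < ρ)
    (hρt : Metric.ball (chartAt (Euc m) y y) ρ ⊆ (chartAt (Euc m) y).target)
    (h : ∀ i j, i ≠ j → ∀ g, IsTest g (Metric.ball (chartAt (Euc m) y y) ρ) →
      ∑ k, ∫ z, (β.inChart (chartAt (Euc m) y) z fun _ => bv k) * curlField g i j k z =
        -∫ z, twoFormComp α (chartAt (Euc m) y) i j z * g z) :
    β.d.val y = α.val y := by
  set e := chartAt (Euc m) y with hedef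
  have he : e ∈ atlas (Euc m) N := chart_mem_atlas _ y
  have hy : e y ∈ e.target := e.map_source (mem_chart_source _ y)
  have hb : ∀ k, ContDiffOn ℝ ∞ (fun z => β.inChart e z fun _ => bv k) e.target := fun k =>
    (ContinuousAlternatingMap.apply ℝ (Euc m) ℝ fun _ : Fin 1 => bv k).contDiff.comp_contDiffOn
      (hβ e he)
  have hbd : ∀ k v, ContDiffOn ℝ ∞ (fun z => fderiv ℝ (fun z => β.inChart e z fun _ => bv k) z v)
      e.target := fun k v =>
    ((hb k).fderiv_of_isOpen e.open_target (m := ∞) (by simp)).clm_apply contDiffOn_const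
  have hcomp : ∀ i j, i ≠ j → α.inChart e (e y) ![bv i, bv j] =
      extDeriv (β.inChart e) (e y) ![bv i, bv j] := by
    intro i j hij
    rw [extDeriv_one_apply (((hβ e he).contDiffAt (e.open_target.mem_nhds hy)).differentiableAt
      (by simp))]
    refine eqOn_of_forall_integral_test Metric.isOpen_ball
      ((contDiffOn_twoFormComp hα he i j).continuousOn.mono hρt)
      (((hbd j (bv i)).sub (hbd i (bv j))).continuousOn.mono hρt) (fun g hg => ?_)
      (Metric.mem_ball_self hρ)
    have hint : ∀ {c g : Euc m → ℝ}, ContDiffOn ℝ ∞ c e.target →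
        IsTest g (Metric.ball (e y) ρ) → Integrable fun z => c z * g z := fun hc hg => by
      simpa [mul_comm] using (hg.mul_left Metric.isOpen_ball (hc.mono hρt)).integrable volume
    have h1 := h i j hij g hg
    have h2 : ∀ k, (∫ z, (β.inChart e z fun _ => bv k) * curlField g i j k z) =
        (if k = j then -∫ z, fderiv ℝ (fun z => β.inChart e z fun _ => bv j) z (bv i) * g z else 0)
        - if k = i then -∫ z, fderiv ℝ (fun z => β.inChart e z fun _ => bv i) z (bv j) * g z
          else 0 := by
      intro k
      by_cases hkj : k = j
      · subst hkj
        simp only [curlField, if_true, if_neg hij.symm, sub_zero]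
        exact integral_mul_fderiv_test Metric.isOpen_ball ((hb k).mono hρt) hg _
      · by_cases hki : k = i
        · subst hki
          simp only [curlField, if_true, if_neg hkj, zero_sub, mul_neg]
          rw [integral_neg, integral_mul_fderiv_test Metric.isOpen_ball ((hb k).mono hρt) hg]
        · simp [curlField, hkj, hki]
    simp only [h2, Finset.sum_sub_distrib, Finset.sum_ite_eq', Finset.mem_univ, if_true] at h1
    simp only [sub_mul]
    rw [integral_sub (hint (hbd j (bv i)) hg) (hint (hbd i (bv j)) hg)]
    linarith
  have hall : α.inChart e (e y) = extDeriv (β.inChart e) (e y) := by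
    ext v
    have hv : v = ![v 0, v 1] := by
      funext i; fin_cases i <;> rfl
    rw [hv, twoForm_apply_eq_sum, twoForm_apply_eq_sum (extDeriv _ _)]
    refine Finset.sum_congr rfl fun i _ => Finset.sum_congr rfl fun j _ => ?_
    by_cases hij : i = j
    · subst hij
      have h1 := twoForm_swap (α.inChart e (e y)) (bv i) (bv i)
      have h2 := twoForm_swap (extDeriv (β.inChart e) (e y)) (bv i) (bv i)
      rw [show α.inChart e (e y) ![bv i, bv i] = 0 by linarith,
        show extDeriv (β.inChart e) (e y) ![bv i, bv i] = 0 by linarith]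
    · rw [hcomp i j hij]
  change (extDeriv (β.inChart e) (e y)).compContinuousLinearMap
    (rawDeriv (E := Euc m) (F := Euc m) e y) = _
  rw [← hall, RawForm.inChart_eq, e.left_inv (mem_chart_source _ y)]
  ext v
  change α.val y (fun i => rawDeriv (E := Euc m) (F := Euc m) e.symm (e y)
    (rawDeriv (E := Euc m) (F := Euc m) e y (v i))) = _
  simp only [rawDeriv_symm_chart_apply he (mem_chart_source (Euc m) y)]

/-- A form with a weak primitive of order zero is exact: the primitive can be made smooth by
subtracting an exterior derivative, which does not affect the weak identity. -/
theorem mem_exactForms_of_weak_primitive [T2Space N] [CompactSpace N] {𝒯 : (N → Euc m) → ℝ}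
    {α : RawForm (Euc m) N 2} (hα : α ∈ smoothForms (Euc m) N 2)
    (h : ∀ q : N, ∃ r > 0, Metric.ball (chartAt (Euc m) q q) (3 * r) ⊆ (chartAt (Euc m) q).target ∧
      (∃ κ : Fin m → FinSigned m, ∀ X : Fin m → Euc m → ℝ,
        (∀ i, IsTest (X i) (Metric.ball (chartAt (Euc m) q q) (3 * r))) →
          𝒯 (pushField (chartAt (Euc m) q) (fieldOf X)) = ∑ j, (κ j).int (X j)) ∧
      ∀ i j, i ≠ j → ∀ g, IsTest g (Metric.ball (chartAt (Euc m) q q) (3 * r)) →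
        𝒯 (pushField (chartAt (Euc m) q) (fieldOf (curlField g i j))) =
          -∫ z, twoFormComp α (chartAt (Euc m) q) i j z * g z) :
    α ∈ exactForms (Euc m) N 1 := by
  have hreg : ∀ q : N, ∃ r > 0, Metric.ball (chartAt (Euc m) q q) r ⊆ (chartAt (Euc m) q).target ∧
      (∀ i j, i ≠ j → ∀ g, IsTest g (Metric.ball (chartAt (Euc m) q q) r) →
        𝒯 (pushField (chartAt (Euc m) q) (fieldOf (curlField g i j))) =
          -∫ z, twoFormComp α (chartAt (Euc m) q) i j z * g z) ∧
      ∃ θ σ, IsRegularized 𝒯 (chartAt (Euc m) q) (Metric.ball (chartAt (Euc m) q q) r) θ σ := by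
    intro q
    obtain ⟨r, hr, hrt, ⟨κ, hκ⟩, hcurl⟩ := h q
    have hsub : Metric.ball (chartAt (Euc m) q q) r ⊆ Metric.ball (chartAt (Euc m) q q) (3 * r) :=
      Metric.ball_subset_ball (by linarith)
    obtain ⟨θ, σ, hθ, hσ⟩ := exists_regularization (κ := κ) hr
      (a := twoFormComp α (chartAt (Euc m) q))
      (fun i j => (contDiffOn_twoFormComp hα (chart_mem_atlas _ q) i j).mono hrt)
      fun i j g hg => by
        by_cases hij : i = j
        · subst hij
          have h0 : ∀ z, twoFormComp α (chartAt (Euc m) q) i i z = 0 := fun z => by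
            have := twoForm_swap (α.inChart (chartAt (Euc m) q) z) (bv i) (bv i)
            change α.inChart (chartAt (Euc m) q) z ![bv i, bv i] = 0
            linarith
          simp [h0]
        · rw [← hcurl i j hij g hg, hκ _ fun k => hg.curlField i j k]
          have hk : ∀ k, (κ k).int (curlField g i j k) =
              (if k = j then (κ j).int (fun z => fderiv ℝ g z (bv i)) else 0) -
                if k = i then (κ i).int (fun z => fderiv ℝ g z (bv j)) else 0 := by
            intro k
            by_cases hkj : k = j
            · subst hkj
              simp only [if_neg (Ne.symm hij), if_true, sub_zero]
              congr 1
              funext z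
              simp [curlField, Ne.symm hij]
            · by_cases hki : k = i
              · subst hki
                simp only [if_neg hkj, if_true, zero_sub]
                have : curlField g k j k = fun z => (-1) * fderiv ℝ g z (bv j) := by
                  funext z
                  simp [curlField, hkj]
                rw [this, FinSigned.int_mul_left, neg_one_mul]
              · rw [FinSigned.int_congr_zero]
                · simp [hkj, hki]
                · intro z; simp [curlField, hkj, hki]
          simp [hk]
    exact ⟨r, hr, hsub.trans hrt, fun i j hij g hg => hcurl i j hij g (hg.mono hsub), θ, σ, hθ,
      fun X hX => by rw [← hσ X hX, hκ X fun i => (hX i).mono hsub]⟩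
  choose r hr hrt hcurl θ σ hσ using hreg
  obtain ⟨s, χ, hχ, -, hχs, hsum⟩ := exists_finite_partition (E := Euc m)
    (fun q : N => (chartAt (Euc m) q).source ∩
      chartAt (Euc m) q ⁻¹' Metric.ball (chartAt (Euc m) q q) (r q))
    (fun q => (chartAt (Euc m) q).isOpen_inter_preimage Metric.isOpen_ball)
    fun q => ⟨mem_chart_source _ q, Metric.mem_ball_self (hr q)⟩
  obtain ⟨β, hβ, hβ'⟩ := exists_smoothForm_of_local (𝒯 := 𝒯) (S := fun γ => ∑ q ∈ s, (σ q).int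
    (dens0 (chartAt (Euc m) q) fun x => χ q x * γ x))
    (exists_local_smooth hr hrt hσ hχ hχs hsum)
  refine ⟨⟨β, hβ⟩, ?_⟩
  funext y
  change β.d.val y = α.val y
  obtain ⟨ρ, hρ, hρt, hβy⟩ := hβ' y
  have hmin : Metric.ball (chartAt (Euc m) y y) (min ρ (r y)) ⊆
      Metric.ball (chartAt (Euc m) y y) ρ := Metric.ball_subset_ball (min_le_left _ _)
  refine d_eq_of_integral_curlField hα hβ (lt_min hρ (hr y)) (hmin.trans hρt)
    fun i j hij g hg => ?_
  rw [← hβy _ fun k => (hg.mono hmin).curlField i j k, hcurl y i j hij g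
    (hg.mono (Metric.ball_subset_ball (min_le_right _ _)))]
  -- The correction does not contribute, because the field has no divergence.
  have hz : pushDens (chartAt (Euc m) y) (divg (curlField g i j)) = fun _ => 0 := by
    funext x
    exact pushDens_eq_zero fun _ => divg_curlField hg.1 i j _
  rw [hz]
  simp only [mul_zero]
  rw [Finset.sum_eq_zero, add_zero]
  intro q _
  refine FinSigned.int_congr_zero _ fun w => ?_
  rw [dens0]
  split_ifs
  · rw [dens, zero_mul]
  · rfl

end GluingGlobal

/-! ### Pull-back detects exactness -/

section Detect

open MeasureTheory Filter Topology Set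

variable {m : ℕ}
variable {M : Type*} [TopologicalSpace M] [ChartedSpace (Euc m) M] [IsManifold 𝓘(ℝ, Euc m) ∞ M]
variable {N : Type*} [TopologicalSpace N] [ChartedSpace (Euc m) N] [IsManifold 𝓘(ℝ, Euc m) ∞ N]
variable {𝒥 : AlmostComplexStructure (Euc m) M} {𝒥' : AlmostComplexStructure (Euc m) N} {f : M → N}

theorem integral_dens0_pushDens [T2Space N] {e e' : OpenPartialHomeomorph N (Euc m)}
    (he : e ∈ atlas (Euc m) N) (he' : e' ∈ atlas (Euc m) N) {g : Euc m → ℝ}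
    (hg : ∀ z ∉ chartDomain id e e', g z = 0) :
    ∫ w, dens0 e' (pushDens e g) w = ∫ z, g z := by
  have h1 : ∫ w in chartDomain id e' e, dens0 e' (pushDens e g) w =
      ∫ w, dens0 e' (pushDens e g) w :=
    setIntegral_eq_integral_of_forall_compl_eq_zero fun w hw => dens0_pushDens_of_notMem _ hw
  have h2 : ∫ z in chartDomain id e e', g z = ∫ z, g z :=
    setIntegral_eq_integral_of_forall_compl_eq_zero hg
  rw [← h1, ← h2, integral_transition he' he]
  exact setIntegral_congr_fun (isOpen_chartDomain continuous_id e' e).measurableSet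
    fun w hw => dens0_pushDens he he' g hw

omit [IsManifold 𝓘(ℝ, Euc m) ∞ M] in
/-- The degree is locally constant: it does not depend on the chart in which it is computed. -/
theorem degree_eq [T2Space N] (P : ChartPartition m M) {r c : N → ℝ} (hr : ∀ q, 0 < r q)
    (hc : ∀ q g, IsTest g (Metric.ball (chartAt (Euc m) q q) (r q)) →
      P.integ (degDens (m := m) f (pushDens (chartAt (Euc m) q) g)) = c q * ∫ w, g w)
    {q y : N} (hy : y ∈ (chartAt (Euc m) q).source)
    (hyr : chartAt (Euc m) q y ∈ Metric.ball (chartAt (Euc m) q q) (r q)) : c y = c q := by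
  set e := chartAt (Euc m) q with hedef
  set e' := chartAt (Euc m) y with hedef'
  have he : e ∈ atlas (Euc m) N := chart_mem_atlas _ q
  have he' : e' ∈ atlas (Euc m) N := chart_mem_atlas _ y
  have hU := isOpen_chartDomain (f := (id : N → N)) continuous_id e e'
  have hs := contDiffOn_inCharts (contMDiff_id (M := N)) he he'
  have hey : e.symm (e y) = y := e.left_inv hy
  set O : Set (Euc m) := Metric.ball (e q) (r q) ∩
    (chartDomain id e e' ∩ inCharts id e e' ⁻¹' Metric.ball (e' y) (r y)) with hOdef
  have hO : IsOpen O :=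
    Metric.isOpen_ball.inter (hs.continuousOn.isOpen_inter_preimage hU Metric.isOpen_ball)
  have hOW : O ⊆ chartDomain id e e' := fun z hz => hz.2.1
  have hOq : O ⊆ Metric.ball (e q) (r q) := inter_subset_left
  have hmap : MapsTo (inCharts id e e') O (Metric.ball (e' y) (r y)) := fun z hz => hz.2.2
  have hyO : e y ∈ O := by
    refine ⟨hyr, ⟨e.map_source hy, ?_⟩, ?_⟩
    · rw [mem_preimage, hey]
      exact mem_chart_source _ y
    · simp only [mem_preimage, inCharts, id, hey]
      exact Metric.mem_ball_self (hr y)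
  obtain ⟨δ, hδ, hδO⟩ := Metric.isOpen_iff.1 hO _ hyO
  obtain ⟨g, hg, -, -, hgpos⟩ := exists_bump_test (e y) (half_pos hδ) (half_lt_self hδ)
  have hgO := hg.mono hδO
  have h1 := hc q g (hgO.mono hOq)
  have h2 := hc y _ ((isTest_dens0_pushDens he he' hOW hgO).mono hmap.image_subset)
  rw [← hedef', pushDens_dens0 he', integral_dens0_pushDens he he' fun z hz =>
    hgO.eq_zero fun h => hz (hOW h)] at h2
  · exact mul_right_cancel₀ hgpos.ne' (h2.symm.trans h1)
  · intro x hx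
    refine pushDens_eq_zero fun hxe => hgO.eq_zero fun hxO => hx ?_
    have h3 := (hOW hxO).2
    simpa [e.left_inv hxe] using h3

theorem cofForm_smul_left (A : Euc m →L[ℝ] Euc m) (ξ : Euc m →L[ℝ] ℝ) (c : ℝ) (v : Euc m) :
    cofForm A (c • ξ) v = c * cofForm A ξ v := by
  simp only [cofForm_eq]
  rw [← smul_eq_mul, ← smul_dotProduct]
  rfl

theorem transferDens_smul (k : ℝ) (β : RawForm (Euc m) M 1) (X : N → Euc m) (x : M) :
    transferDens 𝒥 𝒥' f (k • β) X x = k * transferDens 𝒥 𝒥' f β X x := by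
  have h : toCov ((k • β).val x) = k • toCov (β.val x) := by
    ext v
    rfl
  rw [transferDens, transferDens, h, cofForm_smul_left]
  ring

/-- Along a surjective pseudoholomorphic map only exact forms have exact pull-back. The transfer of
a primitive, divided by the degree, is a weak primitive. -/
theorem mem_exactForms_of_pullback [T2Space M] [CompactSpace M] [T2Space N] [CompactSpace N]
    (hm : 2 ≤ m) (hf : IsPseudoholomorphic 𝒥 𝒥' f) (hsurj : Function.Surjective f)
    {α : RawForm (Euc m) N 2} (hα : α ∈ smoothForms (Euc m) N 2) {β : RawForm (Euc m) M 1}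
    (hβ : β ∈ smoothForms (Euc m) M 1) (hd : β.d = RawForm.pullback f α) :
    α ∈ exactForms (Euc m) N 1 := by
  obtain ⟨P⟩ := nonempty_chartPartition (m := m) (M := M)
  have hball : ∀ q : N, ∃ R > 0, Metric.closedBall (chartAt (Euc m) q q) R ⊆
      (chartAt (Euc m) q).target := fun q =>
    Metric.nhds_basis_closedBall.mem_iff.1
      ((chartAt (Euc m) q).open_target.mem_nhds (mem_chart_target _ q))
  choose R hR hRt using hball
  choose c hc using fun q => exists_degree hm P hf q (r := R q / 4) (by have := hR q; positivity)
    (by linarith [hR q]) (hRt q)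
  have hrt : ∀ q : N, Metric.ball (chartAt (Euc m) q q) (R q / 4) ⊆ (chartAt (Euc m) q).target :=
    fun q => (Metric.ball_subset_closedBall.trans
      (Metric.closedBall_subset_closedBall (by linarith [hR q]))).trans (hRt q)
  have hr : ∀ q, 0 < R q / 4 := fun q => by have := hR q; positivity
  have hcpos : ∀ q, 0 < c q := fun q => degree_pos P hf.1 hsurj q (hr q) (hrt q) (hc q)
  have hscale : ∀ q, ∀ X : Fin m → Euc m → ℝ,
      (∀ i, IsTest (X i) (Metric.ball (chartAt (Euc m) q q) (R q / 4))) →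
      (transferDens 𝒥 𝒥' f β fun y => (c y)⁻¹ • pushField (chartAt (Euc m) q) (fieldOf X) y) =
        transferDens 𝒥 𝒥' f ((c q)⁻¹ • β) (pushField (chartAt (Euc m) q) (fieldOf X)) := by
    intro q X hX
    funext x
    rw [transferDens_smul, transferDens, transferDens, mul_left_comm]
    congr 1
    rw [cofForm_smul]
    by_cases h : f x ∈ (chartAt (Euc m) q).source ∧
        chartAt (Euc m) q (f x) ∈ Metric.ball (chartAt (Euc m) q q) (R q / 4)
    · rw [degree_eq P hr hc h.1 h.2]
    · rw [pushField_eq_zero, cofForm_zero, mul_zero, mul_zero]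
      intro h1
      ext i
      exact (hX i).eq_zero fun h2 => h ⟨h1, h2⟩
  refine mem_exactForms_of_weak_primitive (𝒯 := fun X => P.integ (transferDens 𝒥 𝒥' f β
    fun y => (c y)⁻¹ • X y)) hα fun q => ⟨R q / 12, by have := hR q; positivity, ?_⟩
  -- Near `q` the factor `c⁻¹` is constant, and it is absorbed into the forms `β` and `α`.
  have h3 : 3 * (R q / 12) = R q / 4 := by ring
  rw [h3]
  refine ⟨hrt q, ?_, fun i j hij g hg => ?_⟩
  · obtain ⟨κ, hκ⟩ := exists_transfer_measure (𝒥 := 𝒥) (𝒥' := 𝒥') P hf.1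
      (Submodule.smul_mem _ (c q)⁻¹ hβ) q (hr q) (by linarith [hR q]) (hRt q)
    exact ⟨κ, fun X hX => by simp only [hscale q X hX, hκ X hX]⟩
  · have hd' : RawForm.d ((c q)⁻¹ • β) = RawForm.pullback f ((c q)⁻¹ • α) := by
      rw [RawForm.d_smul, hd, map_smul]
    have h4 := integ_transferDens_curlField P hf (Submodule.smul_mem _ (c q)⁻¹ hα)
      (Submodule.smul_mem _ (c q)⁻¹ hβ) hd' q hij (hg.mono (hrt q))
    simp only [hscale q _ fun k => hg.curlField i j k]
    have h5 : IsTest (fun y => g y * twoFormComp ((c q)⁻¹ • α) (chartAt (Euc m) q) i j y)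
        (Metric.ball (chartAt (Euc m) q q) (R q / 4)) :=
      hg.mul_left Metric.isOpen_ball ((contDiffOn_twoFormComp (Submodule.smul_mem _ (c q)⁻¹ hα)
        (chart_mem_atlas _ q) i j).mono (hrt q))
    rw [h4, hc q _ h5, ← integral_const_mul]
    congr 2
    funext w
    have h6 : twoFormComp ((c q)⁻¹ • α) (chartAt (Euc m) q) i j w =
        (c q)⁻¹ * twoFormComp α (chartAt (Euc m) q) i j w := rfl
    rw [h6]
    have := (hcpos q).ne'
    field_simp

omit [IsManifold 𝓘(ℝ, Euc m) ∞ N] in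
/-- In dimension zero there are no non-zero two-forms. -/
theorem mem_exactForms_of_subsingleton [Subsingleton (Euc m)] (α : RawForm (Euc m) N 2) :
    α ∈ exactForms (Euc m) N 1 := by
  have h : ∀ γ : RawForm (Euc m) N 2, γ = 0 := fun γ => by
    funext y
    ext v
    have h0 : ∀ w : Fin 2 → Euc m, γ.val y w = 0 := fun w => by
      rw [Subsingleton.elim w 0]
      exact (γ.val y).map_zero
    exact h0 v
  rw [h α]
  exact zero_mem _

theorem hPlus_le_and_hMinus_le_of_surjective [T2Space M] [CompactSpace M] [T2Space N]
    [CompactSpace N] (hm : m ≠ 1) (hf : IsPseudoholomorphic 𝒥 𝒥' f)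
    (hsurj : Function.Surjective f) : hPlus 𝒥' ≤ hPlus 𝒥 ∧ hMinus 𝒥' ≤ hMinus 𝒥 := by
  have hinj : ∀ α ∈ closedForms (Euc m) N 2, ∀ β ∈ smoothForms (Euc m) M 1,
      RawForm.d β = RawForm.pullback f α → α ∈ exactForms (Euc m) N 1 := by
    intro α hα β hβ hd
    rcases Nat.eq_zero_or_pos m with rfl | h
    · exact mem_exactForms_of_subsingleton α
    · exact mem_exactForms_of_pullback (by omega) hf hsurj hα.1 hβ hd
  exact ⟨rank_map_eigenForms_le hf hinj 1, rank_map_eigenForms_le hf hinj (-1)⟩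

end Detect

end MappingOrder

end

theorem mainTheorem9 :
    (∀ (M : Type u) [TopologicalSpace M] [T2Space M] [CompactSpace M]
        [ChartedSpace (EuclideanSpace ℝ (Fin 4)) M]
        (N : Type v) [TopologicalSpace N] [T2Space N] [CompactSpace N]
        [ChartedSpace (EuclideanSpace ℝ (Fin 4)) N]
        (μ : MappingOrder.Homology M 4) (ν : MappingOrder.Homology N 4)
        (f : C(M, N)) (d : ℤ),
        MappingOrder.IsFundamentalClass μ → MappingOrder.IsFundamentalClass ν →
        MappingOrder.HasDegree f μ ν d → d ≠ 0 →
        (0 < d → MappingOrder.bPlus ν ≤ MappingOrder.bPlus μ ∧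
          MappingOrder.bMinus ν ≤ MappingOrder.bMinus μ) ∧
        (d < 0 → MappingOrder.bMinus ν ≤ MappingOrder.bPlus μ ∧
          MappingOrder.bPlus ν ≤ MappingOrder.bMinus μ)) ∧
    (∀ (n : ℕ)
        (M : Type u) [TopologicalSpace M] [T2Space M] [CompactSpace M]
        [ChartedSpace (EuclideanSpace ℝ (Fin (2 * n))) M]
        [IsManifold 𝓘(ℝ, EuclideanSpace ℝ (Fin (2 * n))) ∞ M]
        (N : Type v) [TopologicalSpace N] [T2Space N] [CompactSpace N]
        [ChartedSpace (EuclideanSpace ℝ (Fin (2 * n))) N]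
        [IsManifold 𝓘(ℝ, EuclideanSpace ℝ (Fin (2 * n))) ∞ N]
        (J : MappingOrder.AlmostComplexStructure (EuclideanSpace ℝ (Fin (2 * n))) M)
        (J' : MappingOrder.AlmostComplexStructure (EuclideanSpace ℝ (Fin (2 * n))) N)
        (f : M → N),
        MappingOrder.IsPseudoholomorphic J J' f → Function.Surjective f →
        MappingOrder.hPlus J' ≤ MappingOrder.hPlus J ∧
        MappingOrder.hMinus J' ≤ MappingOrder.hMinus J) :=
  ⟨fun _ _ _ _ _ _ _ _ _ _ _ _ f _ _ _ h _ =>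
      MappingOrder.bPlus_le_and_bMinus_le_of_hasDegree f h,
    fun _ _ _ _ _ _ _ _ _ _ _ _ _ _ _ _ hf hsurj =>
      MappingOrder.hPlus_le_and_hMinus_le_of_surjective (by omega) hf hsurj⟩
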